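/- Let $p(n),k(n)$ be integers with $1\le k(n)<p(n)$, let $\beta_{\min}(n)>0$, and for each $n$ let $\mu_n$ be a probability distribution on $\mathbb{R}$ with mean zero and variance one. Write $p,k,\beta_{\min},\mu$ for their values at $n$. Let $X\in\mathbb{R}^{n\times p}$ have i.i.d. entries of law $\mu$, let $W\sim N(0,I_{n\times n})$ be independent of $X$, and for $\beta\in\mathbb{R}^p$ with support $S(\beta)=\{i:\beta_i\ne 0\}$ let $Y=X\beta+W$. A decoder is a measurable map $g$ from $(X,Y)$ to subsets of $\{1,\dots,p\}$. The signal class is $$\mathcal{C}(\beta_{\min})=\{\beta\in\mathbb{R}^p:\ |\beta_i|\ge\beta_{\min}\ \text{for all } i\in S(\beta)\}.$$ For a choice $(\beta^S)_{|S|=k}$ of signals $\beta^S\in\mathcal{C}(\beta_{\min})$ with $S(\beta^S)=S$, the average probability of error of $g$ is $$p_{err}(g,(\beta^S))=\binom{p}{k}^{-1}\sum_{|S|=k}\mathbb{P}\big[g(X,X\beta^S+W)\neq S\big].$$ Asymptotically reliable recovery over $\mathcal{C}(\beta_{\min})$ is possible if there are decoders $g_n$ for which $\sup_{(\beta^S)}p_{err}(g_n,(\beta^S))\to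 0$ as $n\to\infty$, the supremum being over all such choices of signals. Theorem. Let logarithms be taken to a fixed base $b\ge 2$ (for instance $b=2$ or $b=e$). If asymptotically reliable recovery over $\mathcal{C}(\beta_{\min})$ is possible, then for all sufficiently large $n$ $$n>\max\{f_1(p,k,\beta_{\min}),\ f_2(p,k,\beta_{\min}),\ k-1\},$$ where $$f_1(p,k,\beta_{\min})=\frac{\log\binom{p}{k}-1}{\frac12\log\left(1+k\beta_{\min}^2\left(1-\frac{k}{p}\right)\right)},\qquad f_2(p,k,\beta_{\min})=\frac{\log(p-k+1)-1}{\frac12\log\left(1+\beta_{\min}^2\left(1-\frac{1}{p-k+1}\right)\right)}.$$ -/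

import Mathlib

open MeasureTheory ProbabilityTheory Filter Topology
open scoped ENNReal

noncomputable section

namespace SupportRecovery

/-- The support `{i | β i ≠ 0}` of a signal `β ∈ ℝᵖ`. -/
def supp {p : ℕ} (β : Fin p → ℝ) : Finset (Fin p) :=
  Finset.univ.filter fun i => β i ≠ 0

/-- The signal class: the vectors `β ∈ ℝᵖ` with `|β i| ≥ βmin` at every index `i` of their
support. -/
def signalClass (p : ℕ) (βmin : ℝ) : Set (Fin p → ℝ) :=
  {β | ∀ i ∈ supp β, βmin ≤ |β i|}

/-- The law of a random `n × p` matrix with i.i.d. entries of law `μ`, a matrix being given by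
its array of entries. -/
def matrixLaw (μ : Measure ℝ) (n p : ℕ) : Measure (Fin n → Fin p → ℝ) :=
  Measure.pi fun _ : Fin n => Measure.pi fun _ : Fin p => μ

/-- The law `N(0, Iₙ)` of the additive noise. -/
def noiseLaw (n : ℕ) : Measure (Fin n → ℝ) :=
  Measure.pi fun _ : Fin n => gaussianReal 0 1

/-- The joint law of the measurement matrix `X` and of the noise `W`, which are independent. -/
def jointLaw (μ : Measure ℝ) (n p : ℕ) :
    Measure ((Fin n → Fin p → ℝ) × (Fin n → ℝ)) :=
  (matrixLaw μ n p).prod (noiseLaw n)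

/-- The observation vector `Y = X β + W`. -/
def observe {n p : ℕ} (X : Fin n → Fin p → ℝ) (β : Fin p → ℝ) (W : Fin n → ℝ) :
    Fin n → ℝ :=
  (Matrix.of X).mulVec β + W

/-- A decoder: a measurable map from the measurement matrix `X` and the observations `Y` to
an estimated subset of the indices. -/
structure Decoder (n p : ℕ) where
  /-- The estimated support, as a function of `X` and `Y`. -/
  estimate : (Fin n → Fin p → ℝ) → (Fin n → ℝ) → Finset (Fin p)
  measurable_estimate : ∀ S : Finset (Fin p),
    MeasurableSet {z : (Fin n → Fin p → ℝ) × (Fin n → ℝ) | estimate z.1 z.2 = S}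

/-- The probability, over the draw of `X` and `W`, that the decoder fails to return exactly the
support of the signal `β`. -/
def errorProb (μ : Measure ℝ) {n p : ℕ} (g : Decoder n p) (β : Fin p → ℝ) : ℝ≥0∞ :=
  jointLaw μ n p {z | g.estimate z.1 (observe z.1 β z.2) ≠ supp β}

/-- A choice of one signal of the class for each support: `β S` has support exactly `S`, for
every set `S` of `k` indices. -/
def IsSignalChoice (p k : ℕ) (βmin : ℝ) (β : Finset (Fin p) → Fin p → ℝ) : Prop :=
  ∀ S : Finset (Fin p), S.card = k → supp (β S) = S ∧ β S ∈ signalClass p βmin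

/-- The average probability of error when the support `S` is uniform over the subsets of
size `k`, and the signal with support `S` is `β S`. -/
def avgError (μ : Measure ℝ) {n p : ℕ} (k : ℕ) (g : Decoder n p)
    (β : Finset (Fin p) → Fin p → ℝ) : ℝ≥0∞ :=
  ((p.choose k : ℕ) : ℝ≥0∞)⁻¹ *
    ∑ S ∈ Finset.powersetCard k (Finset.univ : Finset (Fin p)), errorProb μ g (β S)

/-- The average probability of error of a decoder over the signal class: the support is uniform
over the subsets of size `k`, and the values on it are the worst ones that the class allows. -/
def classError (μ : Measure ℝ) {n p : ℕ} (k : ℕ) (βmin : ℝ) (g : Decoder n p) : ℝ≥0∞ :=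
  ⨆ (β : Finset (Fin p) → Fin p → ℝ) (_ : IsSignalChoice p k βmin β), avgError μ k g β

/-- Asymptotically reliable recovery over the signal class is possible, with `n` observations of
a `k n`-sparse signal in dimension `p n`, minimum value `βmin n` and entry law `μ n`: some
sequence of decoders has average probability of error over the class tending to `0`. -/
def AsymptoticallyReliable (μ : ℕ → Measure ℝ) (p k : ℕ → ℕ) (βmin : ℕ → ℝ) : Prop :=
  ∃ g : ∀ n : ℕ, Decoder n (p n),
    Tendsto (fun n : ℕ => classError (μ n) (k n) (βmin n) (g n)) atTop (𝓝 0)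

/-- `(log C(p,k) - 1) / (½ log (1 + k βmin² (1 - k/p)))`, with logarithms to base `b`. -/
def f₁ (b : ℝ) (p k : ℕ) (βmin : ℝ) : ℝ :=
  (Real.logb b (p.choose k : ℝ) - 1) /
    (1 / 2 * Real.logb b (1 + (k : ℝ) * βmin ^ 2 * (1 - (k : ℝ) / (p : ℝ))))

/-- `(log (p-k+1) - 1) / (½ log (1 + βmin² (1 - 1/(p-k+1))))`, with logarithms to base `b`. -/
def f₂ (b : ℝ) (p k : ℕ) (βmin : ℝ) : ℝ :=
  (Real.logb b ((p : ℝ) - (k : ℝ) + 1) - 1) /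
    (1 / 2 * Real.logb b (1 + βmin ^ 2 * (1 - 1 / ((p : ℝ) - (k : ℝ) + 1))))

end SupportRecovery

end

/-! The theorem follows from two bounds at fixed `n` with universal constants: the class error is at
least some ε > 0 when `n ≤ f₁` or `n ≤ f₂` (`exists_le_classError_of_le_threshold`), and also when
200 ≤ n < k (`exists_le_classError_of_lt_sparsity`). An error tending to 0 eventually excludes both.

Thresholds. Take M signals with distinct supports on a sphere of squared radius v about a centre c₀:
all flat signals of size k for `f₁`, and those containing a fixed set of k - 1 indices for `f₂`.
Given X, compare the law of Y - X c₀ with N(0, (1 + v) I), which does not depend on the signal. Up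
to the factor (1 + v)^(n/2) the density is exp J with J centred. Decoding regions are disjoint, so
the expectations of e^(-J) on success sum to at most (1 + v)^(n/2) ≤ M/2; the term -1 in the
thresholds provides this factor 2. Fano's inequality gives no uniform constant at the threshold, so
more than the mean of J is needed: E exp(-max(J, -T)) ≥ 3/4 for a universal T
(`exists_le_integral_exp_neg_logRatio`). The average error is then at least e^(-T)(3/4 - 1/2).

This truncated moment is bounded by showing that the negative part of J has second moment at most
C(1 + its mean)² (`le_integral_exp_neg_max`). J splits into a Gaussian quadratic part, a part
bilinear in signal and noise, and the centred sum of the squared signal coordinates. The Gaussian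
factors have comparable moments. The last part has no moments beyond the first, but its steps are
bounded below, and a walk with such steps has a lower tail decaying geometrically on the scale of
its mean negative part (`integral_sq_neg_walk_le`).

Dimension. If n ≤ |T| and columns i, j both lie in the span of n columns in T, moving a spike from i
to j can be compensated on T by a shift of the values there. The two signals give the same Y;
averaging the values over a huge cube makes the shift invisible, so T ∪ {i} and T ∪ {j} cannot both
be recovered (`sq_spanProb_le_worstError_add`). It remains that a random vector lies in the span of
n independent ones with probability at least e^(-800), whatever the entry law (`le_spanProb`). This
is delicate only for laws with atoms; the reason is that a random n × (n + 1) array whose kernel has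
small support already spans a vector agreeing with one of its rows there, while a kernel with large
support is itself evidence of linear dependence. -/

set_option linter.unusedSectionVars false

noncomputable section

namespace SupportRecovery

/-! ### Splitting off the first coordinate of a product measure. -/

section PiSucc

variable {E : Type*} [MeasurableSpace E] (ν : Measure E) [IsProbabilityMeasure ν]

theorem measurePreserving_cons (n : ℕ) :
    MeasurePreserving (fun q : E × (Fin n → E) => (Fin.cons q.1 q.2 : Fin (n + 1) → E))
      (ν.prod (Measure.pi fun _ : Fin n => ν)) (Measure.pi fun _ : Fin (n + 1) => ν) := by
  have h := (measurePreserving_piFinSuccAbove (fun _ : Fin (n + 1) => ν) 0).symm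
  convert h using 2
  simp [MeasurableEquiv.piFinSuccAbove, Fin.insertNthEquiv]

theorem measurableEmbedding_cons (n : ℕ) :
    MeasurableEmbedding (fun q : E × (Fin n → E) => (Fin.cons q.1 q.2 : Fin (n + 1) → E)) := by
  have h := (MeasurableEquiv.piFinSuccAbove (fun _ : Fin (n + 1) => E) 0).symm.measurableEmbedding
  convert h using 2
  simp [MeasurableEquiv.piFinSuccAbove, Fin.insertNthEquiv]

theorem integrable_pi_succ {n : ℕ} (F : (Fin (n + 1) → E) → ℝ) :
    Integrable F (Measure.pi fun _ : Fin (n + 1) => ν) ↔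
      Integrable (fun q : E × (Fin n → E) => F (Fin.cons q.1 q.2))
        (ν.prod (Measure.pi fun _ : Fin n => ν)) :=
  ((measurePreserving_cons ν n).integrable_comp_emb (measurableEmbedding_cons n)).symm

theorem integral_pi_succ {n : ℕ} (F : (Fin (n + 1) → E) → ℝ)
    (hF : Integrable F (Measure.pi fun _ : Fin (n + 1) => ν)) :
    ∫ x, F x ∂(Measure.pi fun _ : Fin (n + 1) => ν) =
      ∫ t, ∫ x, F (Fin.cons t x) ∂(Measure.pi fun _ : Fin n => ν) ∂ν := by
  rw [← (measurePreserving_cons ν n).integral_comp (measurableEmbedding_cons n),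
    integral_prod _ ((integrable_pi_succ ν F).1 hF)]

end PiSucc

/-! ### Lower tail of random walks whose steps are bounded below. -/

section LowerTail

variable {E : Type*} [MeasurableSpace E] (ν : Measure E) [IsProbabilityMeasure ν] (z : E → ℝ)

/-- The expected negative part of the centred random walk with steps `z - 1`, started at `s`. -/
def negMean (n : ℕ) (s : ℝ) : ℝ :=
  ∫ x, max (-(s + ∑ i, (z (x i) - 1))) 0 ∂(Measure.pi fun _ : Fin n => ν)

/-- The probability that the random walk with steps `z - 1`, started at `a`, enters `(-∞, 0]`
within `n` steps. -/
def hitProb : ℕ → ℝ → ℝ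
  | 0, a => if a ≤ 0 then 1 else 0
  | n + 1, a => if a ≤ 0 then 1 else ∫ t, hitProb n (a + (z t - 1)) ∂ν

variable {z}

theorem neg_walk_le (hz : ∀ t, 0 ≤ z t) {n : ℕ} (s : ℝ) (x : Fin n → E) :
    max (-(s + ∑ i, (z (x i) - 1))) 0 ≤ max (n - s) 0 := by
  apply max_le_max _ le_rfl
  have : ∑ i : Fin n, (-1 : ℝ) ≤ ∑ i, (z (x i) - 1) :=
    Finset.sum_le_sum fun i _ => by linarith [hz (x i)]
  simp at this
  simp only [Finset.sum_sub_distrib, Finset.sum_const, Finset.card_univ, Fintype.card_fin,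
    nsmul_eq_mul, mul_one]
  linarith

theorem integrable_neg_walk (hzm : Measurable z) (hz : ∀ t, 0 ≤ z t) (n : ℕ) (s : ℝ) :
    Integrable (fun x : Fin n → E => max (-(s + ∑ i, (z (x i) - 1))) 0)
      (Measure.pi fun _ : Fin n => ν) := by
  refine Integrable.of_bound (C := max (n - s) 0) ?_ (ae_of_all _ fun x => ?_)
  · exact Measurable.aestronglyMeasurable (by fun_prop)
  · rw [Real.norm_of_nonneg (le_max_right _ _)]
    exact neg_walk_le hz s x

theorem negMean_nonneg (n : ℕ) (s : ℝ) : 0 ≤ negMean ν z n s :=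
  integral_nonneg fun _ => le_max_right _ _

theorem negMean_le (hz : ∀ t, 0 ≤ z t) (hzm : Measurable z) (n : ℕ) (s : ℝ) :
    negMean ν z n s ≤ max (n - s) 0 := by
  calc negMean ν z n s ≤ ∫ x, max (n - s) 0 ∂(Measure.pi fun _ : Fin n => ν) :=
        integral_mono (integrable_neg_walk ν hzm hz n s) (integrable_const _)
          (fun x => neg_walk_le hz s x)
    _ = _ := by simp

theorem negMean_antitone (hzm : Measurable z) (hz : ∀ t, 0 ≤ z t) (n : ℕ) :
    Antitone (negMean ν z n) := fun s s' h =>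
  integral_mono (integrable_neg_walk ν hzm hz n s') (integrable_neg_walk ν hzm hz n s)
    fun x => max_le_max (by linarith) le_rfl

theorem negMean_zero (s : ℝ) : negMean ν z 0 s = max (-s) 0 := by
  simp [negMean]

theorem negMean_succ (hzm : Measurable z) (hz : ∀ t, 0 ≤ z t) (n : ℕ) (s : ℝ) :
    negMean ν z (n + 1) s = ∫ t, negMean ν z n (s + (z t - 1)) ∂ν := by
  unfold negMean
  rw [integral_pi_succ ν _ (integrable_neg_walk ν hzm hz (n + 1) s)]
  simp only [Fin.sum_univ_succ, Fin.cons_zero, Fin.cons_succ, add_assoc]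

theorem integrable_negMean_step (hzm : Measurable z) (hz : ∀ t, 0 ≤ z t) (n : ℕ) (s : ℝ) :
    Integrable (fun t => negMean ν z n (s + (z t - 1))) ν := by
  refine Integrable.of_bound (C := max (n - s + 1) 0) ?_ (ae_of_all _ fun t => ?_)
  · exact ((negMean_antitone ν hzm hz n).measurable.comp (by fun_prop)).aestronglyMeasurable
  · rw [Real.norm_of_nonneg (negMean_nonneg ν n _)]
    refine (negMean_le ν hz hzm n _).trans (max_le_max ?_ le_rfl)
    linarith [hz t]

/-- Jensen's inequality for the convex negative part of a centred walk, obtained one step at a time.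
-/
theorem neg_le_negMean (hzm : Measurable z) (hz : ∀ t, 0 ≤ z t) (hzi : Integrable z ν)
    (hz1 : ∫ t, z t ∂ν = 1) (n : ℕ) : ∀ s, max (-s) 0 ≤ negMean ν z n s := by
  induction n with
  | zero => intro s; rw [negMean_zero]
  | succ n ih =>
    intro s
    apply max_le _ (negMean_nonneg ν _ _)
    rw [negMean_succ ν hzm hz]
    calc -s = ∫ t, -(s + (z t - 1)) ∂ν := by
          rw [integral_neg, integral_add (by fun_prop) (by fun_prop),
            integral_sub hzi (by fun_prop)]
          simp [hz1]
      _ ≤ _ := integral_mono (by fun_prop) (integrable_negMean_step ν hzm hz n s)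
          fun t => (le_max_left _ _).trans (ih _)

/-- The negative part of a martingale is a submartingale. -/
theorem negMean_le_succ (hzm : Measurable z) (hz : ∀ t, 0 ≤ z t) (hzi : Integrable z ν)
    (hz1 : ∫ t, z t ∂ν = 1) (n : ℕ) : ∀ s, negMean ν z n s ≤ negMean ν z (n + 1) s := by
  induction n with
  | zero => intro s; rw [negMean_zero]; exact neg_le_negMean ν hzm hz hzi hz1 1 s
  | succ n ih =>
    intro s
    rw [negMean_succ ν hzm hz n, negMean_succ ν hzm hz (n + 1)]
    exact integral_mono (integrable_negMean_step ν hzm hz n s)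
      (integrable_negMean_step ν hzm hz (n + 1) s) fun t => ih _

theorem hitProb_nonneg (n : ℕ) : ∀ a, 0 ≤ hitProb ν z n a := by
  induction n with
  | zero => intro a; unfold hitProb; split_ifs <;> simp
  | succ n ih =>
    intro a; unfold hitProb; split_ifs
    · simp
    · exact integral_nonneg fun t => ih _

/-- The two properties are proved together: monotonicity makes the next integrand measurable and
boundedness makes it integrable. -/
theorem hitProb_props (hzm : Measurable z) (n : ℕ) :
    (∀ a, hitProb ν z n a ≤ 1) ∧ Antitone (hitProb ν z n) := by
  induction n with
  | zero =>
    refine ⟨fun a => ?_, fun a a' h => ?_⟩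
    · unfold hitProb; split_ifs <;> simp
    · unfold hitProb; split_ifs <;> linarith
  | succ n ih =>
    have hint : ∀ a, Integrable (fun t => hitProb ν z n (a + (z t - 1))) ν := fun a =>
      Integrable.of_bound (C := 1)
        (ih.2.measurable.comp (by fun_prop)).aestronglyMeasurable
        (ae_of_all _ fun t => by
          rw [Real.norm_of_nonneg (hitProb_nonneg ν n _)]; exact ih.1 _)
    have hle : ∀ a, ∫ t, hitProb ν z n (a + (z t - 1)) ∂ν ≤ 1 := fun a => by
      calc _ ≤ ∫ t, (1 : ℝ) ∂ν := integral_mono (hint a) (integrable_const _) fun t => ih.1 _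
        _ = 1 := by simp
    refine ⟨fun a => ?_, fun a a' h => ?_⟩
    · unfold hitProb; split_ifs
      · exact le_rfl
      · exact hle a
    · unfold hitProb; split_ifs
      · exact le_rfl
      · linarith
      · exact hle a'
      · exact integral_mono (hint a') (hint a) fun t => ih.2 (by linarith)

theorem integrable_hitProb_step (hzm : Measurable z) (n : ℕ) (a : ℝ) :
    Integrable (fun t => hitProb ν z n (a + (z t - 1))) ν :=
  Integrable.of_bound (C := 1)
    ((hitProb_props ν hzm n).2.measurable.comp (by fun_prop)).aestronglyMeasurable
    (ae_of_all _ fun t => by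
      rw [Real.norm_of_nonneg (hitProb_nonneg ν n _)]; exact (hitProb_props ν hzm n).1 _)

/-- Doob's maximal inequality: the walk from s reaches level -a exactly when the walk from a + s
enters the half-line, and after that time the negative part can only grow in mean. -/
theorem hitProb_mul_le (hzm : Measurable z) (hz : ∀ t, 0 ≤ z t) (hzi : Integrable z ν)
    (hz1 : ∫ t, z t ∂ν = 1) (n : ℕ) (a : ℝ) :
    ∀ s, hitProb ν z n (a + s) * a ≤ negMean ν z n s := by
  induction n with
  | zero =>
    intro s
    rw [negMean_zero]; unfold hitProb
    split_ifs with h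
    · rw [one_mul]; exact le_max_of_le_left (by linarith)
    · simp
  | succ n ih =>
    intro s
    unfold hitProb
    split_ifs with h
    · rw [one_mul]
      exact le_trans (le_max_of_le_left (by linarith)) (neg_le_negMean ν hzm hz hzi hz1 (n + 1) s)
    · rw [negMean_succ ν hzm hz, ← integral_mul_const]
      refine integral_mono ((integrable_hitProb_step ν hzm n (a + s)).mul_const a)
        (integrable_negMean_step ν hzm hz n s) fun t => ?_
      simpa [add_assoc] using ih (s + (z t - 1))

/-- To become negative from a + b + 1 the walk must first go down by a. Steps are at least -1, so it
then still stands at b or above, and the rest of the path contributes at most the mean negative part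
from b. Allowing a ≥ -1 covers the overshoot in the induction, and the free N absorbs the elapsed
time. -/
theorem negMean_le_hitProb_mul (hzm : Measurable z) (hz : ∀ t, 0 ≤ z t) (hzi : Integrable z ν)
    (hz1 : ∫ t, z t ∂ν = 1) {b : ℝ} (hb : 0 ≤ b) (n : ℕ) :
    ∀ a, -1 ≤ a → ∀ N, n ≤ N → negMean ν z n (a + b + 1) ≤ hitProb ν z n a * negMean ν z N b := by
  have hmono : Monotone fun n => negMean ν z n b :=
    monotone_nat_of_le_succ fun n => negMean_le_succ ν hzm hz hzi hz1 n b
  have low : ∀ n N a, n ≤ N → -1 ≤ a → negMean ν z n (a + b + 1) ≤ 1 * negMean ν z N b := by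
    intro n N a hn ha
    rw [one_mul]
    exact (negMean_antitone ν hzm hz n (by linarith)).trans (hmono hn)
  induction n with
  | zero =>
    intro a ha N hN
    by_cases h : a ≤ 0
    · simpa [hitProb, h] using low 0 N a hN ha
    · simp only [hitProb, h, if_false, zero_mul, negMean_zero]
      push Not at h
      exact max_le (by linarith) le_rfl
  | succ n ih =>
    intro a ha N hN
    by_cases h : a ≤ 0
    · simpa [hitProb, h] using low (n + 1) N a hN ha
    · simp only [hitProb, h, if_false]
      rw [negMean_succ ν hzm hz, ← integral_mul_const]
      refine integral_mono (integrable_negMean_step ν hzm hz n _)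
        ((integrable_hitProb_step ν hzm n a).mul_const _) fun t => ?_
      have := ih (a + (z t - 1)) (by linarith [hz t]) N (by omega)
      refine le_trans (le_of_eq ?_) this
      ring_nf

/-- A centred sum of nonnegative i.i.d. variables of mean one has a negative part whose second
moment is controlled by the square of its mean. -/
theorem integral_sq_neg_walk_le (hzm : Measurable z) (hz : ∀ t, 0 ≤ z t) (hzi : Integrable z ν)
    (hz1 : ∫ t, z t ∂ν = 1) (n : ℕ) :
    ∫ x, (max (-(∑ i, (z (x i) - 1))) 0) ^ 2 ∂(Measure.pi fun _ : Fin n => ν) ≤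
      8 * (1 + negMean ν z n 0) ^ 2 := by
  set e := negMean ν z n 0 with he
  have he0 : 0 ≤ e := negMean_nonneg ν n 0
  set h : ℝ := 2 * e + 3 with hh
  -- The level 2(e + 1) is chosen so that the maximal inequality gives hitting probability at most e
  -- / (2(e + 1)) ≤ 1/2; the extra 1 in h = 2e + 3 pays for the overshoot.
  have hstep : ∀ b, 0 ≤ b → negMean ν z n (b + h) ≤ negMean ν z n b / 2 := by
    intro b hb
    have h1 := negMean_le_hitProb_mul ν hzm hz hzi hz1 hb n (2 * (e + 1)) (by linarith) n le_rfl
    have h2 := hitProb_mul_le ν hzm hz hzi hz1 n (2 * (e + 1)) 0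
    rw [add_zero, ← he] at h2
    have h3 : hitProb ν z n (2 * (e + 1)) ≤ 1 / 2 := by
      by_contra hc
      push Not at hc
      nlinarith
    have h4 := negMean_nonneg ν (z := z) n b
    have h5 : b + h = 2 * (e + 1) + b + 1 := by rw [hh]; ring
    rw [h5]
    nlinarith
  have hgeo : ∀ j : ℕ, negMean ν z n (j * h) ≤ e * (1 / 2) ^ j := by
    intro j
    induction j with
    | zero => simp [he]
    | succ j ih =>
      have := hstep (j * h) (by positivity)
      have e1 : ((j + 1 : ℕ) : ℝ) * h = j * h + h := by push_cast; ring
      rw [e1, pow_succ]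
      linarith
  let G : ℝ → ℝ := fun s =>
    ∫ x, (max (-(s + ∑ i, (z (x i) - 1))) 0) ^ 2 ∂(Measure.pi fun _ : Fin n => ν)
  have hGint : ∀ s, Integrable (fun x : Fin n → E => (max (-(s + ∑ i, (z (x i) - 1))) 0) ^ 2)
      (Measure.pi fun _ : Fin n => ν) := by
    intro s
    refine Integrable.of_bound (C := (max (n - s) 0) ^ 2) ?_ (ae_of_all _ fun x => ?_)
    · exact Measurable.aestronglyMeasurable (by fun_prop)
    · rw [Real.norm_of_nonneg (by positivity)]
      exact pow_le_pow_left₀ (le_max_right _ _) (neg_walk_le hz s x) 2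
  -- Pointwise, y² ≤ (y - h)₊² + 2hy for y ≥ 0. Iterating along multiples of h turns the geometric
  -- decay of the mean into a bound on the second moment.
  have hGstep : ∀ s, G s ≤ G (s + h) + 2 * h * negMean ν z n s := by
    intro s
    have : G (s + h) + 2 * h * negMean ν z n s = ∫ x,
        ((max (-(s + h + ∑ i, (z (x i) - 1))) 0) ^ 2 +
          2 * h * max (-(s + ∑ i, (z (x i) - 1))) 0) ∂(Measure.pi fun _ : Fin n => ν) := by
      rw [integral_add (hGint _) ((integrable_neg_walk ν hzm hz n s).const_mul _),
        integral_const_mul]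
      rfl
    rw [this]
    refine integral_mono (hGint s)
      ((hGint _).add ((integrable_neg_walk ν hzm hz n s).const_mul _)) fun x => ?_
    have hhpos : 0 ≤ h := by positivity
    generalize ∑ i, (z (x i) - 1) = d
    rcases le_total (s + d) 0 with h0 | h0
    · rw [max_eq_left (by linarith : (0 : ℝ) ≤ -(s + d))]
      rcases le_total (s + h + d) 0 with h1 | h1
      · rw [max_eq_left (by linarith : (0 : ℝ) ≤ -(s + h + d))]
        nlinarith
      · rw [max_eq_right (by linarith : -(s + h + d) ≤ (0 : ℝ))]
        nlinarith
    · rw [max_eq_right (by linarith : -(s + d) ≤ (0 : ℝ))]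
      rw [zero_pow two_ne_zero]
      positivity
  have hGsum : ∀ N : ℕ, G 0 ≤ G (N * h) + 2 * h * e * (2 - 2 * (1 / 2) ^ N) := by
    intro N
    induction N with
    | zero => simp
    | succ N ih =>
      have h1 := hGstep (N * h)
      have h2 := hgeo N
      have e1 : ((N + 1 : ℕ) : ℝ) * h = N * h + h := by push_cast; ring
      have hhpos : 0 ≤ h := by positivity
      rw [e1, pow_succ]
      have := mul_le_mul_of_nonneg_left h2 (by positivity : (0 : ℝ) ≤ 2 * h)
      nlinarith
  -- The recursion stops after n steps of size h ≥ 1, because the walk never falls below -n.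
  have hG0 : G (n * h) = 0 := by
    have : ∀ x : Fin n → E, (max (-(n * h + ∑ i, (z (x i) - 1))) 0) ^ 2 = 0 := by
      intro x
      have h1 := neg_walk_le hz (n * h) x
      have h2 : (n : ℝ) - n * h ≤ 0 := by
        have : (0 : ℝ) ≤ n := by positivity
        nlinarith
      rw [max_eq_right h2] at h1
      rw [le_antisymm h1 (le_max_right _ _)]
      simp
    simp only [G, this, integral_zero]
  have hfin := hGsum n
  rw [hG0, zero_add] at hfin
  have e0 : G 0 = ∫ x, (max (-(∑ i, (z (x i) - 1))) 0) ^ 2 ∂(Measure.pi fun _ : Fin n => ν) := by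
    simp [G]
  rw [← e0]
  have hp : (0 : ℝ) ≤ (1 / 2) ^ n := by positivity
  have : 0 ≤ 2 * h * e := by positivity
  calc G 0 ≤ 2 * h * e * (2 - 2 * (1 / 2) ^ n) := hfin
    _ ≤ 2 * h * e * 2 := by
        apply mul_le_mul_of_nonneg_left _ this
        linarith
    _ ≤ _ := by rw [hh]; nlinarith

end LowerTail

/-! ### Comparison of moments for weighted sums of i.i.d. variables. -/

section FourthMoment

variable {E : Type*} [MeasurableSpace E] {γ : Measure E} [IsProbabilityMeasure γ] {g : E → ℝ}

theorem memLp_weighted_sum {p : ℝ≥0∞} (hg : MemLp g p γ) {n : ℕ} (a : Fin n → ℝ) :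
    MemLp (fun w : Fin n → E => ∑ t, a t * g (w t)) p (Measure.pi fun _ : Fin n => γ) :=
  memLp_finsetSum _ fun t _ =>
    (hg.comp_measurePreserving (measurePreserving_eval (fun _ : Fin n => γ) t)).const_mul (a t)

theorem integrable_pow_of_memLp_four {Ω : Type*} [MeasurableSpace Ω] {P : Measure Ω}
    [IsFiniteMeasure P] {f : Ω → ℝ} (hf : MemLp f 4 P) {k : ℕ} (hk : k ≤ 4) :
    Integrable (fun ω => f ω ^ k) P := by
  rcases Nat.eq_zero_or_pos k with rfl | hk0
  · simp
  have h : MemLp f k P := hf.mono_exponent (by exact_mod_cast hk)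
  have h2 := h.integrable_norm_pow (by omega)
  refine h2.mono' (h.1.pow k) (ae_of_all _ fun ω => ?_)
  simp

theorem integral_weighted_sum (hg : MemLp g 4 γ) (hg0 : ∫ t, g t ∂γ = 0) {n : ℕ}
    (a : Fin n → ℝ) :
    ∫ w, ∑ t, a t * g (w t) ∂(Measure.pi fun _ : Fin n => γ) = 0 := by
  have hgi : Integrable g γ := hg.integrable (by norm_num)
  rw [integral_finsetSum]
  · refine Finset.sum_eq_zero fun t _ => ?_
    rw [integral_const_mul, integral_comp_eval (μ := fun _ : Fin n => γ) (i := t) (f := g)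
      hgi.1, hg0, mul_zero]
  · exact fun t _ => (integrable_comp_eval (μ := fun _ : Fin n => γ) (i := t) hgi).const_mul _

/-- Expand the power after isolating one term: the odd cross terms vanish because both factors are
centred, and the cross term 6 a₀² σ² Λ of the fourth power is absorbed into 2 K a₀² Λ since K ≥ 3σ².
-/
theorem moments_weighted_sum (hg : MemLp g 4 γ) (hg0 : ∫ t, g t ∂γ = 0) {K : ℝ}
    (hK1 : ∫ t, g t ^ 4 ∂γ ≤ K) (hK2 : 3 * (∫ t, g t ^ 2 ∂γ) ^ 2 ≤ K) (n : ℕ) :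
    ∀ a : Fin n → ℝ,
      ∫ w, (∑ t, a t * g (w t)) ^ 2 ∂(Measure.pi fun _ : Fin n => γ) =
        (∫ t, g t ^ 2 ∂γ) * ∑ t, a t ^ 2 ∧
      ∫ w, (∑ t, a t * g (w t)) ^ 4 ∂(Measure.pi fun _ : Fin n => γ) ≤
        K * (∑ t, a t ^ 2) ^ 2 := by
  set σ := ∫ t, g t ^ 2 ∂γ with hσ
  have hσ0 : 0 ≤ σ := integral_nonneg fun t => by positivity
  have hg4 : ∀ k ≤ 4, Integrable (fun t => g t ^ k) γ := fun k hk =>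
    integrable_pow_of_memLp_four hg hk
  induction n with
  | zero => intro a; simp
  | succ n ih =>
    intro a
    have hS := memLp_weighted_sum hg a
    obtain ⟨ih2, ih4⟩ := ih (fun t => a t.succ)
    have hT := memLp_weighted_sum hg (fun t : Fin n => a t.succ)
    have hT0 := integral_weighted_sum hg hg0 (fun t : Fin n => a t.succ)
    set T : (Fin n → E) → ℝ := fun w => ∑ t, a t.succ * g (w t) with hTdef
    replace hT0 : ∫ w, T w ∂(Measure.pi fun _ : Fin n => γ) = 0 := hT0
    have hTi : ∀ k ≤ 4, Integrable (fun w => T w ^ k) (Measure.pi fun _ : Fin n => γ) :=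
      fun k hk => integrable_pow_of_memLp_four hT hk
    have hT1 : Integrable T (Measure.pi fun _ : Fin n => γ) := by simpa using hTi 1 (by norm_num)
    have hT2 := hTi 2 (by norm_num)
    have hT3 := hTi 3 (by norm_num)
    have hT4 := hTi 4 (by norm_num)
    have hgi1 : Integrable g γ := by simpa using hg4 1 (by norm_num)
    have hg2 := hg4 2 (by norm_num)
    have hg3 := hg4 3 (by norm_num)
    have hg4' := hg4 4 (by norm_num)
    set Λ := ∑ t : Fin n, a t.succ ^ 2 with hΛ
    have hΛ0 : 0 ≤ Λ := Finset.sum_nonneg fun t _ => by positivity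
    replace ih2 : ∫ w, T w ^ 2 ∂(Measure.pi fun _ : Fin n => γ) = σ * Λ := ih2
    replace ih4 : ∫ w, T w ^ 4 ∂(Measure.pi fun _ : Fin n => γ) ≤ K * Λ ^ 2 := ih4
    constructor
    · rw [integral_pi_succ γ _ (integrable_pow_of_memLp_four hS (by norm_num))]
      have inner : ∀ t, ∫ x, (∑ i, a i * g ((Fin.cons t x : Fin (n + 1) → E) i)) ^ 2
          ∂(Measure.pi fun _ : Fin n => γ) = a 0 ^ 2 * g t ^ 2 + σ * Λ := by
        intro t
        have : ∀ x : Fin n → E, (∑ i, a i * g ((Fin.cons t x : Fin (n + 1) → E) i)) ^ 2 =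
            (a 0 ^ 2 * g t ^ 2 + 2 * (a 0 * g t) * T x) + T x ^ 2 := by
          intro x
          simp only [Fin.sum_univ_succ, Fin.cons_zero, Fin.cons_succ, hTdef]
          ring
        simp_rw [this]
        rw [integral_add (by fun_prop) hT2, integral_add (by fun_prop) (by fun_prop)]
        simp only [integral_const_mul, integral_const, probReal_univ, one_smul, hT0, ih2]
        ring
      simp_rw [inner]
      rw [integral_add (by fun_prop) (by fun_prop), integral_const_mul, Fin.sum_univ_succ]
      simp only [integral_const, probReal_univ, one_smul]
      rw [← hσ]; ring
    · rw [integral_pi_succ γ _ (integrable_pow_of_memLp_four hS (by norm_num))]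
      have inner : ∀ t, ∫ x, (∑ i, a i * g ((Fin.cons t x : Fin (n + 1) → E) i)) ^ 4
          ∂(Measure.pi fun _ : Fin n => γ) = a 0 ^ 4 * g t ^ 4 + 6 * a 0 ^ 2 * (σ * Λ) * g t ^ 2
            + 4 * a 0 * (∫ x, T x ^ 3 ∂(Measure.pi fun _ : Fin n => γ)) * g t
            + ∫ x, T x ^ 4 ∂(Measure.pi fun _ : Fin n => γ) := by
        intro t
        have : ∀ x : Fin n → E, (∑ i, a i * g ((Fin.cons t x : Fin (n + 1) → E) i)) ^ 4 =
            (((a 0 * g t) ^ 4 + 4 * (a 0 * g t) ^ 3 * T x) + 6 * (a 0 * g t) ^ 2 * T x ^ 2) +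
              4 * (a 0 * g t) * T x ^ 3 + T x ^ 4 := by
          intro x
          simp only [Fin.sum_univ_succ, Fin.cons_zero, Fin.cons_succ, hTdef]
          ring
        simp_rw [this]
        rw [integral_add (by fun_prop) hT4, integral_add (by fun_prop) (by fun_prop),
          integral_add (by fun_prop) (by fun_prop), integral_add (by fun_prop) (by fun_prop)]
        simp only [integral_const_mul, integral_const, probReal_univ, one_smul, hT0, ih2]
        ring
      simp_rw [inner]
      rw [integral_add (by fun_prop) (by fun_prop), integral_add (by fun_prop) (by fun_prop),
        integral_add (by fun_prop) (by fun_prop),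
        integral_const_mul, integral_const_mul, integral_const_mul, hg0, Fin.sum_univ_succ]
      simp only [integral_const, probReal_univ, one_smul]
      rw [← hσ, ← hΛ]
      have e1 : a 0 ^ 4 * ∫ t, g t ^ 4 ∂γ ≤ a 0 ^ 4 * K :=
        mul_le_mul_of_nonneg_left hK1 (by positivity)
      have e2 : a 0 ^ 2 * Λ * (3 * σ ^ 2) ≤ a 0 ^ 2 * Λ * K :=
        mul_le_mul_of_nonneg_left hK2 (by positivity)
      nlinarith

/-- Weighted sums of i.i.d. centred variables with a fourth moment have comparable first, second
and fourth moments, uniformly in the number of terms and in the weights. -/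
theorem exists_moment_bounds (hg : MemLp g 4 γ) (hg0 : ∫ t, g t ∂γ = 0)
    (hσ : 0 < ∫ t, g t ^ 2 ∂γ) :
    ∃ c : ℝ, 0 < c ∧ ∀ (n : ℕ) (a : Fin n → ℝ),
      ∫ w, (∑ t, a t * g (w t)) ^ 2 ∂(Measure.pi fun _ : Fin n => γ) =
        (∫ t, g t ^ 2 ∂γ) * ∑ t, a t ^ 2 ∧
      ∫ w, (∑ t, a t * g (w t)) ^ 4 ∂(Measure.pi fun _ : Fin n => γ) ≤
        c * (∑ t, a t ^ 2) ^ 2 ∧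
      √(∑ t, a t ^ 2) ≤ c * ∫ w, |∑ t, a t * g (w t)| ∂(Measure.pi fun _ : Fin n => γ) := by
  set σ := ∫ t, g t ^ 2 ∂γ with hσdef
  set K := max (∫ t, g t ^ 4 ∂γ) (3 * σ ^ 2) with hK
  have hKpos : 0 < K := lt_of_lt_of_le (by positivity) (le_max_right _ _)
  -- This value makes the fourth-moment remainder K Λ² / (ℓ² Λ) equal to half of the second moment σ
  -- Λ.
  set ℓ := √(2 * K / σ) with hℓ
  have hℓpos : 0 < ℓ := by positivity
  have hℓsq : ℓ ^ 2 = 2 * K / σ := Real.sq_sqrt (by positivity)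
  refine ⟨max K (2 / σ * ℓ), lt_max_of_lt_left hKpos, fun n a => ?_⟩
  obtain ⟨h2, h4⟩ := moments_weighted_sum hg hg0 (le_max_left _ (3 * σ ^ 2)) (le_max_right _ _) n a
  rw [← hK] at h4
  refine ⟨h2, h4.trans (mul_le_mul_of_nonneg_right (le_max_left _ _) (by positivity)), ?_⟩
  have hT := memLp_weighted_sum hg a
  set T : (Fin n → E) → ℝ := fun w => ∑ t, a t * g (w t) with hTdef
  set Λ := ∑ t, a t ^ 2 with hΛ
  have hΛ0 : 0 ≤ Λ := Finset.sum_nonneg fun t _ => by positivity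
  have hTi : ∀ k ≤ 4, Integrable (fun w => T w ^ k) (Measure.pi fun _ : Fin n => γ) :=
    fun k hk => integrable_pow_of_memLp_four hT hk
  have hT1 : Integrable T (Measure.pi fun _ : Fin n => γ) := by simpa using hTi 1 (by norm_num)
  have hE0 : 0 ≤ ∫ w, |T w| ∂(Measure.pi fun _ : Fin n => γ) :=
    integral_nonneg fun _ => abs_nonneg _
  rcases hΛ0.eq_or_lt with h0 | hpos
  · rw [← h0, Real.sqrt_zero]
    exact mul_nonneg (le_max_of_le_left hKpos.le) hE0
  set r := √Λ with hr
  have hrpos : 0 < r := by positivity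
  have hrsq : r ^ 2 = Λ := Real.sq_sqrt hΛ0
  -- Split at |y| = ℓ r: below it the first term dominates y², above it the second does.
  have hpt : ∀ y : ℝ, y ^ 2 ≤ ℓ * r * |y| + y ^ 4 / (ℓ * r) ^ 2 := by
    intro y
    have hlr : 0 < ℓ * r := by positivity
    generalize ℓ * r = m at hlr
    rcases le_total |y| m with h | h
    · have : 0 ≤ y ^ 4 / m ^ 2 := by positivity
      have : y ^ 2 = |y| * |y| := by rw [← sq, sq_abs]
      nlinarith [abs_nonneg y]
    · have h1 : 0 ≤ m * |y| := by positivity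
      have h2 : y ^ 2 ≤ y ^ 4 / m ^ 2 := by
        rw [le_div_iff₀ (by positivity)]
        have : m ^ 2 ≤ y ^ 2 := by rw [← sq_abs y]; exact pow_le_pow_left₀ hlr.le h 2
        nlinarith [sq_nonneg y]
      linarith
  have hint : σ * Λ ≤ ℓ * r * (∫ w, |T w| ∂(Measure.pi fun _ : Fin n => γ)) +
      (∫ w, T w ^ 4 ∂(Measure.pi fun _ : Fin n => γ)) / (ℓ * r) ^ 2 := by
    rw [← h2, ← integral_const_mul, ← integral_div, ← integral_add (by fun_prop)
      ((hTi 4 le_rfl).div_const _)]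
    exact integral_mono (hTi 2 (by norm_num))
      ((hT1.abs.const_mul _).add ((hTi 4 le_rfl).div_const _)) fun w => hpt (T w)
  have h5 : (∫ w, T w ^ 4 ∂(Measure.pi fun _ : Fin n => γ)) / (ℓ * r) ^ 2 ≤ σ / 2 * Λ := by
    rw [div_le_iff₀ (by positivity), mul_pow, hℓsq, hrsq]
    refine h4.trans (le_of_eq ?_)
    field_simp
  have h6 : σ / 2 * r ≤ ℓ * ∫ w, |T w| ∂(Measure.pi fun _ : Fin n => γ) := by
    have : r * (σ / 2 * r) ≤ r * (ℓ * ∫ w, |T w| ∂(Measure.pi fun _ : Fin n => γ)) := by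
      nlinarith
    exact le_of_mul_le_mul_left this hrpos
  calc r = 2 / σ * (σ / 2 * r) := by field_simp
    _ ≤ 2 / σ * (ℓ * ∫ w, |T w| ∂(Measure.pi fun _ : Fin n => γ)) := by gcongr
    _ = (2 / σ * ℓ) * ∫ w, |T w| ∂(Measure.pi fun _ : Fin n => γ) := by ring
    _ ≤ _ := mul_le_mul_of_nonneg_right (le_max_right _ _) hE0

end FourthMoment

/-! ### Moments of the standard Gaussian. -/

section Gaussian

theorem memLp_pow_gaussianReal (k : ℕ) (p : ℝ≥0∞) (hp : p ≠ ∞) :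
    MemLp (fun x : ℝ => x ^ k) p (gaussianReal 0 1) := by
  rcases Nat.eq_zero_or_pos k with rfl | hk
  · simpa using memLp_const (1 : ℝ)
  have h := memLp_id_gaussianReal' (μ := 0) (v := 1) (p * k) (ENNReal.mul_ne_top hp (by simp))
  have h2 := h.norm_rpow_div (k : ℝ≥0∞)
  rw [ENNReal.mul_div_cancel_right (by simp; omega) (by simp)] at h2
  refine (memLp_norm_iff (by fun_prop)).1 ?_
  simpa using h2

theorem integral_sq_gaussianReal : ∫ x, x ^ 2 ∂(gaussianReal 0 1) = 1 := by
  have h := variance_fun_id_gaussianReal (μ := 0) (v := 1)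
  rw [variance_eq_integral (by fun_prop)] at h
  simpa [integral_id_gaussianReal] using h

theorem integral_sq_sub_one_gaussianReal_pos :
    0 < ∫ x, (x ^ 2 - 1) ^ 2 ∂(gaussianReal 0 1) := by
  have hi : Integrable (fun x : ℝ => (x ^ 2 - 1) ^ 2) (gaussianReal 0 1) := by
    have := ((memLp_pow_gaussianReal 2 4 (by simp)).sub (memLp_const (1 : ℝ)))
    exact integrable_pow_of_memLp_four this (by norm_num)
  rw [integral_pos_iff_support_of_nonneg (fun x => by positivity) hi]
  rw [pos_iff_ne_zero]
  intro h0
  have h1 : gaussianReal 0 1 ({1, -1} : Set ℝ)ᶜ = 0 := by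
    refine measure_mono_null (fun x hx => ?_) h0
    simp only [Set.mem_compl_iff, Set.mem_insert_iff, Set.mem_singleton_iff] at hx
    simp only [Function.mem_support, ne_eq]
    intro h
    have : (x - 1) * (x + 1) = 0 := by
      have := pow_eq_zero_iff (two_ne_zero) |>.1 h
      linarith
    rcases mul_eq_zero.1 this with h | h
    · exact hx (Or.inl (by linarith))
    · exact hx (Or.inr (by linarith))
  have := nullSingletonClass_gaussianReal (μ := 0) (v := 1) one_ne_zero
  have h2 : gaussianReal 0 1 ({1, -1} : Set ℝ) = 0 :=
    (Set.toFinite ({1, -1} : Set ℝ)).measure_zero _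
  have h3 := measure_univ (μ := gaussianReal 0 1)
  have h4 := measure_union_le (μ := gaussianReal 0 1) ({1, -1} : Set ℝ) ({1, -1} : Set ℝ)ᶜ
  rw [Set.union_compl_self, h3, h1, h2] at h4
  simp at h4

end Gaussian

/-! ### Truncated exponential moments of a centred variable. -/

section Truncation

variable {Ω : Type*} [MeasurableSpace Ω] {P : Measure Ω} [IsProbabilityMeasure P] {J : Ω → ℝ}

theorem integrable_exp_neg_max (hJ : AEMeasurable J P) (T : ℝ) :
    Integrable (fun ω => Real.exp (-max (J ω) (-T))) P := by
  refine Integrable.of_bound (C := Real.exp T) ?_ (ae_of_all _ fun ω => ?_)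
  · exact AEMeasurable.aestronglyMeasurable (by fun_prop)
  · rw [Real.norm_of_nonneg (Real.exp_nonneg _)]
    exact Real.exp_le_exp.2 (by linarith [le_max_right (J ω) (-T)])

/-- If the negative part of a centred variable has a second moment controlled by its mean, then
a truncated exponential moment is bounded below. -/
theorem le_integral_exp_neg_max {C : ℝ} (hC : 1 ≤ C) (hJ : Integrable J P) (hJ0 : ∫ ω, J ω ∂P ≤ 0)
    (hN2 : Integrable (fun ω => (max (-J ω) 0) ^ 2) P)
    (hbd : ∫ ω, (max (-J ω) 0) ^ 2 ∂P ≤ C * (1 + ∫ ω, max (-J ω) 0 ∂P) ^ 2) :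
    3 / 4 ≤ ∫ ω, Real.exp (-max (J ω) (-(C * (96 * C + 1) ^ 2))) ∂P := by
  set T := C * (96 * C + 1) ^ 2 with hT
  have hTC : 48 * C ≤ T := by nlinarith [sq_nonneg C]
  have hTpos : 0 < T := by linarith
  have hexp := integrable_exp_neg_max (P := P) hJ.aemeasurable T
  set m := ∫ ω, max (-J ω) 0 ∂P with hm
  have hN : Integrable (fun ω => max (-J ω) 0) P := hJ.neg.pos_part
  have hm0 : 0 ≤ m := integral_nonneg fun _ => le_max_right _ _
  by_cases hcase : ∫ ω, (max (-J ω) 0) ^ 2 ∂P ≤ T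
  -- Use e^(-u) ≥ 1 - u. Truncation raises J by at most N - T ≤ N²/(4T), where N is the negative
  -- part, and E N² ≤ T makes this cost at most 1/4.
  · have hpt : ∀ ω, 1 - (J ω + (max (-J ω) 0) ^ 2 / (4 * T)) ≤
        Real.exp (-max (J ω) (-T)) := by
      intro ω
      have h1 := Real.add_one_le_exp (-max (J ω) (-T))
      have h2 : max (J ω) (-T) ≤ J ω + (max (-J ω) 0) ^ 2 / (4 * T) := by
        have h4 : 0 ≤ (max (-J ω) 0) ^ 2 / (4 * T) := by positivity
        apply max_le (by linarith)
        rcases le_total (J ω) 0 with h | h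
        · rw [max_eq_left (by linarith : (0 : ℝ) ≤ -J ω)]
          have : -J ω - T ≤ (-J ω) ^ 2 / (4 * T) := by
            rw [le_div_iff₀ (by positivity)]
            nlinarith [sq_nonneg (-J ω - 2 * T)]
          linarith
        · linarith
      linarith
    have h3 : ∫ ω, (1 - (J ω + (max (-J ω) 0) ^ 2 / (4 * T))) ∂P ≤
        ∫ ω, Real.exp (-max (J ω) (-T)) ∂P :=
      integral_mono ((integrable_const _).sub (hJ.add (hN2.div_const _))) hexp hpt
    rw [integral_sub (by fun_prop) (by fun_prop), integral_add (by fun_prop) (by fun_prop),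
      integral_div] at h3
    simp only [integral_const, probReal_univ, one_smul] at h3
    have h5 : (∫ ω, (max (-J ω) 0) ^ 2 ∂P) / (4 * T) ≤ 1 / 4 := by
      rw [div_le_iff₀ (by positivity)]; linarith
    linarith
  · push Not at hcase
    have hm1 : 96 * C < m := by
      have : T < C * (1 + m) ^ 2 := hcase.trans_le hbd
      rw [hT] at this
      have h2 : (96 * C + 1) ^ 2 < (1 + m) ^ 2 := lt_of_mul_lt_mul_left this (by linarith)
      have := lt_of_pow_lt_pow_left₀ 2 (by linarith) h2
      linarith
    have hmpos : 0 < m := by linarith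
    have hbd' : ∫ ω, (max (-J ω) 0) ^ 2 ∂P ≤ 4 * C * m ^ 2 := by
      refine hbd.trans ?_
      have : (1 + m) ^ 2 ≤ 4 * m ^ 2 := by nlinarith
      nlinarith
    -- A Paley–Zygmund argument over three ranges of N: below m/2; up to 16Cm, where the exponential
    -- is at least 48C; and above 16Cm, where the quadratic term dominates. After integration the
    -- outer ranges use at most 3m/4, so the exponential must supply the remaining m/4.
    have hpt : ∀ ω, max (-J ω) 0 ≤ m / 2 + m / 3 * Real.exp (-max (J ω) (-T)) +
        (max (-J ω) 0) ^ 2 / (16 * C * m) := by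
      intro ω
      have hx := Real.exp_nonneg (-max (J ω) (-T))
      have h0 : 0 ≤ (max (-J ω) 0) ^ 2 / (16 * C * m) := by positivity
      by_cases h : max (-J ω) 0 ≤ m / 2
      · have : 0 ≤ m / 3 * Real.exp (-max (J ω) (-T)) := by positivity
        linarith
      · push Not at h
        have hJneg : J ω < -(m / 2) := by
          rcases lt_max_iff.1 h with h | h <;> linarith
        have hmax : max (-J ω) 0 = -J ω := max_eq_left (by linarith)
        have h1 : 48 * C ≤ Real.exp (-max (J ω) (-T)) := by
          have h2 : max (J ω) (-T) ≤ -(48 * C) := max_le (by linarith) (by linarith)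
          linarith [Real.add_one_le_exp (-max (J ω) (-T))]
        rw [hmax]
        have h3 : -J ω ≤ 16 * C * m + (-J ω) ^ 2 / (16 * C * m) := by
          have hpos : 0 < 16 * C * m := by positivity
          rcases le_total (-J ω) (16 * C * m) with h | h
          · have : 0 ≤ (-J ω) ^ 2 / (16 * C * m) := by positivity
            linarith
          · have : -J ω ≤ (-J ω) ^ 2 / (16 * C * m) := by
              rw [le_div_iff₀ hpos]; nlinarith
            linarith
        nlinarith
    have h3 : m ≤ ∫ ω, (m / 2 + m / 3 * Real.exp (-max (J ω) (-T)) +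
        (max (-J ω) 0) ^ 2 / (16 * C * m)) ∂P :=
      integral_mono hN (((integrable_const _).add (hexp.const_mul _)).add (hN2.div_const _)) hpt
    rw [integral_add (by fun_prop) (by fun_prop), integral_add (by fun_prop) (by fun_prop)] at h3
    simp only [integral_div, integral_const_mul, integral_const, probReal_univ, one_smul] at h3
    have h5 : (∫ ω, (max (-J ω) 0) ^ 2 ∂P) / (16 * C * m) ≤ m / 4 := by
      rw [div_le_iff₀ (by positivity)]; nlinarith
    have h6 : m * (1 / 4) ≤ m * ((∫ ω, Real.exp (-max (J ω) (-T)) ∂P) / 3) := by linarith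
    have := le_of_mul_le_mul_left h6 hmpos
    linarith

end Truncation

/-! ### The log-likelihood ratio and its negative part. -/

section Density

/-- The exponent of the density of `x + w` with respect to `N(0, (1 + v) I)`, up to the
normalizing constant, when `w` is standard Gaussian noise. -/
def logRatio {n : ℕ} (v : ℝ) (x w : Fin n → ℝ) : ℝ :=
  (∑ t, x t ^ 2 + 2 * ∑ t, x t * w t - v * ∑ t, w t ^ 2) / (2 * (1 + v))

theorem measurable_logRatio {n : ℕ} (v : ℝ) :
    Measurable fun q : (Fin n → ℝ) × (Fin n → ℝ) => logRatio v q.1 q.2 := by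
  unfold logRatio; fun_prop

theorem measurePreserving_neg_noise (n : ℕ) :
    MeasurePreserving (fun w : Fin n → ℝ => -w) (noiseLaw n) (noiseLaw n) := by
  have := measurePreserving_pi (fun _ : Fin n => gaussianReal 0 1)
    (fun _ : Fin n => gaussianReal 0 1)
    (f := fun _ x => -x)
    (fun _ => ⟨measurable_neg, by simpa using gaussianReal_map_neg (μ := 0) (v := 1)⟩)
  exact this

instance isProbabilityMeasure_noiseLaw (n : ℕ) : IsProbabilityMeasure (noiseLaw n) := by
  unfold noiseLaw; infer_instance

variable (ν : Measure ℝ) [IsProbabilityMeasure ν]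

theorem integrable_sum_sq (hν : Integrable (fun x => x ^ 2) ν) (n : ℕ) :
    Integrable (fun x : Fin n → ℝ => ∑ t, x t ^ 2) (Measure.pi fun _ : Fin n => ν) :=
  integrable_finsetSum _ fun t _ => integrable_comp_eval (μ := fun _ : Fin n => ν) (i := t) hν

theorem integral_sum_sq (hν : Integrable (fun x => x ^ 2) ν) (n : ℕ) :
    ∫ x : Fin n → ℝ, ∑ t, x t ^ 2 ∂(Measure.pi fun _ : Fin n => ν) = n * ∫ x, x ^ 2 ∂ν := by
  rw [integral_finsetSum _ fun t _ =>
    integrable_comp_eval (μ := fun _ : Fin n => ν) (i := t) hν]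
  have : ∀ t : Fin n, ∫ x : Fin n → ℝ, x t ^ 2 ∂(Measure.pi fun _ : Fin n => ν) = ∫ x, x ^ 2 ∂ν :=
    fun t => integral_comp_eval (μ := fun _ : Fin n => ν) (i := t) (f := fun x => x ^ 2) hν.1
  simp [this]

theorem integrable_sq_gaussianReal : Integrable (fun x : ℝ => x ^ 2) (gaussianReal 0 1) :=
  (memLp_pow_gaussianReal 2 1 (by simp)).integrable le_rfl

/-- Here α stands for E|A|, ρ for √(nv), s for √n and m for the mean negative part of the ratio.
Every contribution is at most a constant times ((1 + v)(1 + m))², and the factor (1 + v)² cancels,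
which makes the constant free of v. -/
theorem moment_arithmetic {v m α ρ s c₁ c₂ σ : ℝ} (hv : 0 < v) (hm : 0 ≤ m) (hα : 0 ≤ α)
    (hσ : 0 ≤ σ) (hαm : α ≤ 4 * (1 + v) * m) 
    (hρm : ρ ^ 2 ≤ ρ * (c₁ * (2 * (1 + v) * m)) + 4 * (1 + v) * m)
    (hs : 0 ≤ s) (hsm : v * s ≤ c₂ * (4 * (1 + v) * m)) :
    3 / (4 * (1 + v) ^ 2) * (8 * (v + α / 2) ^ 2 + v ^ 2 * (σ * s ^ 2) + 4 * ρ ^ 2) ≤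
      3 / 4 * (32 + 4 * (4 * c₁ ^ 2 + 8) + 16 * c₂ ^ 2 * σ) * (1 + m) ^ 2 := by
  set U := (1 + v) * (1 + m) with hU
  set u := (1 + v) * m with hu
  have hU1 : 1 ≤ U := by nlinarith [mul_nonneg hv.le hm]
  have hu0 : 0 ≤ u := by positivity
  have huU : u ≤ U := by rw [hu, hU]; nlinarith
  have hsq : u ^ 2 ≤ U ^ 2 := pow_le_pow_left₀ hu0 huU 2
  have hUsq : U ≤ U ^ 2 := by nlinarith
  have k1 : 8 * (v + α / 2) ^ 2 ≤ 32 * U ^ 2 := by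
    have h1 : v + α / 2 ≤ 2 * U := by rw [hU]; linarith
    have := pow_le_pow_left₀ (by positivity) h1 2
    linarith
  have k2 : ρ ^ 2 ≤ (4 * c₁ ^ 2 + 8) * U ^ 2 := by
    have h1 : ρ ^ 2 ≤ 4 * (c₁ ^ 2 * u ^ 2) + 8 * u := by
      have h2 : ρ ^ 2 ≤ ρ * (2 * c₁ * u) + 4 * u := by rw [hu]; linarith
      linarith [sq_nonneg (ρ - 2 * c₁ * u)]
    have h4 := mul_le_mul_of_nonneg_left hsq (sq_nonneg c₁)
    linarith
  have k3 : v ^ 2 * (σ * s ^ 2) ≤ 16 * c₂ ^ 2 * σ * U ^ 2 := by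
    have h0 : v * s ≤ 4 * c₂ * u := by rw [hu]; linarith
    have h1 := pow_le_pow_left₀ (by positivity) h0 2
    have h2 := mul_le_mul_of_nonneg_left h1 hσ
    have h4 := mul_le_mul_of_nonneg_left hsq (by positivity : 0 ≤ 16 * c₂ ^ 2 * σ)
    linarith
  rw [div_mul_eq_mul_div, div_le_iff₀ (by positivity)]
  have hUU : U ^ 2 = (1 + v) ^ 2 * (1 + m) ^ 2 := by rw [hU]; ring
  calc _ ≤ 3 * (32 * U ^ 2 + 16 * c₂ ^ 2 * σ * U ^ 2 + 4 * ((4 * c₁ ^ 2 + 8) * U ^ 2)) := by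
        linarith
    _ = _ := by rw [hUU]; ring

set_option maxHeartbeats 600000 in
/-- A truncated exponential moment of the log-likelihood ratio is bounded below, uniformly in the
number of coordinates and in the law of the signal. -/
theorem exists_le_integral_exp_neg_logRatio :
    ∃ T : ℝ, ∀ (n : ℕ) (v : ℝ) (ν : Measure ℝ) [IsProbabilityMeasure ν], 0 < v →
      Integrable (fun x => x ^ 2) ν → ∫ x, x ^ 2 ∂ν = v →
      3 / 4 ≤ ∫ q : (Fin n → ℝ) × (Fin n → ℝ), Real.exp (-max (logRatio v q.1 q.2) (-T))
        ∂((Measure.pi fun _ : Fin n => ν).prod (noiseLaw n)) := by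
  have hid : MemLp (fun x : ℝ => x) 4 (gaussianReal 0 1) := by
    simpa using memLp_pow_gaussianReal 1 4 (by simp)
  obtain ⟨c₁, hc₁, hlin⟩ := exists_moment_bounds hid integral_id_gaussianReal
    (by rw [integral_sq_gaussianReal]; exact one_pos)
  have hsq : MemLp (fun x : ℝ => x ^ 2 - 1) 4 (gaussianReal 0 1) :=
    (memLp_pow_gaussianReal 2 4 (by simp)).sub (memLp_const (1 : ℝ))
  have hsq0 : ∫ x, (x ^ 2 - 1) ∂(gaussianReal 0 1) = 0 := by
    rw [integral_sub integrable_sq_gaussianReal (integrable_const _), integral_sq_gaussianReal]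
    simp
  obtain ⟨c₂, hc₂, hquad⟩ := exists_moment_bounds hsq hsq0 integral_sq_sub_one_gaussianReal_pos
  set σ := ∫ x, (x ^ 2 - 1) ^ 2 ∂(gaussianReal 0 1) with hσ
  have hσ0 : 0 < σ := integral_sq_sub_one_gaussianReal_pos
  set C : ℝ := 3 / 4 * (32 + 4 * (4 * c₁ ^ 2 + 8) + 16 * c₂ ^ 2 * σ) with hC
  have hC1 : 1 ≤ C := by rw [hC]; have : 0 ≤ c₂ ^ 2 * σ := by positivity
                         nlinarith [sq_nonneg c₁]
  refine ⟨C * (96 * C + 1) ^ 2, fun n v ν _ hv hν hνv => ?_⟩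
  set Px := Measure.pi fun _ : Fin n => ν with hPx
  set P := Px.prod (noiseLaw n) with hP
  have hΓ2 : Integrable (fun w : Fin n → ℝ => ∑ t, w t ^ 2) (noiseLaw n) :=
    integrable_sum_sq _ integrable_sq_gaussianReal n
  have hx2 : Integrable (fun x : Fin n → ℝ => ∑ t, x t ^ 2) Px := integrable_sum_sq ν hν n
  -- the three parts of the log-likelihood ratio
  set A : (Fin n → ℝ) → ℝ := fun x => ∑ t, x t ^ 2 - n * v with hA
  set B : (Fin n → ℝ) × (Fin n → ℝ) → ℝ := fun q => 2 * ∑ t, q.1 t * q.2 t with hB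
  set Γ : (Fin n → ℝ) → ℝ := fun w => -v * ∑ t, 1 * (w t ^ 2 - 1) with hΓ
  have hAi : Integrable A Px := hx2.sub (integrable_const _)
  have hA0 : ∫ x, A x ∂Px = 0 := by
    rw [hA, integral_sub hx2 (integrable_const _), integral_sum_sq ν hν, hνv]; simp
  have hΓi : Integrable Γ (noiseLaw n) :=
    ((memLp_weighted_sum hsq _).integrable (by norm_num)).const_mul _
  have hΓ0 : ∫ w, Γ w ∂(noiseLaw n) = 0 := by
    rw [hΓ, integral_const_mul]
    have := integral_weighted_sum hsq hsq0 (fun _ : Fin n => (1 : ℝ))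
    unfold noiseLaw
    rw [this, mul_zero]
  have hA' : Integrable (fun q : (Fin n → ℝ) × (Fin n → ℝ) => A q.1) P := hAi.comp_fst _
  have hΓ' : Integrable (fun q : (Fin n → ℝ) × (Fin n → ℝ) => Γ q.2) P := hΓi.comp_snd _
  have hBi : Integrable B P := by
    refine ((hx2.comp_fst (noiseLaw n)).add (hΓ2.comp_snd Px)).mono'
      (Measurable.aestronglyMeasurable (by fun_prop)) (ae_of_all _ fun q => ?_)
    simp only [hB, Real.norm_eq_abs, Pi.add_apply, Finset.mul_sum, ← Finset.sum_add_distrib]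
    refine (Finset.abs_sum_le_sum_abs _ _).trans (Finset.sum_le_sum fun t _ => ?_)
    rw [abs_le]
    constructor <;> linarith [sq_nonneg (q.1 t + q.2 t), sq_nonneg (q.1 t - q.2 t)]
  have hSi : Integrable (fun q : (Fin n → ℝ) × (Fin n → ℝ) => A q.1 + Γ q.2) P := hA'.add hΓ'
  have hJ : ∀ q : (Fin n → ℝ) × (Fin n → ℝ),
      logRatio v q.1 q.2 = (A q.1 + Γ q.2 + B q) / (2 * (1 + v)) := by
    intro q
    simp only [logRatio, hA, hB, hΓ, one_mul, Finset.sum_sub_distrib]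
    simp only [Finset.sum_const, Finset.card_univ, Fintype.card_fin, nsmul_eq_mul, mul_one]
    ring
  have hJi : Integrable (fun q : (Fin n → ℝ) × (Fin n → ℝ) => logRatio v q.1 q.2) P := by
    simp_rw [hJ]
    exact ((hA'.add hΓ').add hBi).div_const _
  -- reflection of the noise
  have hrefl : MeasurePreserving (fun q : (Fin n → ℝ) × (Fin n → ℝ) => (q.1, -q.2)) P P :=
    (MeasurePreserving.id Px).prod (measurePreserving_neg_noise n)
  have hembed : MeasurableEmbedding (fun q : (Fin n → ℝ) × (Fin n → ℝ) => (q.1, -q.2)) :=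
    MeasurableEmbedding.id.prodMap (MeasurableEquiv.neg (Fin n → ℝ)).measurableEmbedding
  have hBneg : ∀ q : (Fin n → ℝ) × (Fin n → ℝ), B (q.1, -q.2) = -B q := by
    intro q; simp [hB]
  have hΓneg : ∀ w : Fin n → ℝ, Γ (-w) = Γ w := by intro w; simp [hΓ]
  have hB0 : ∫ q, B q ∂P = 0 := by
    have := hrefl.integral_comp hembed B
    simp_rw [hBneg] at this
    rw [integral_neg] at this
    linarith
  have hJ0 : ∫ q : (Fin n → ℝ) × (Fin n → ℝ), logRatio v q.1 q.2 ∂P = 0 := by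
    simp_rw [hJ]
    rw [integral_div, integral_add hSi hBi, integral_add hA' hΓ', hB0,
      integral_fun_fst (fun x => A x), integral_fun_snd (fun w => Γ w), hA0, hΓ0]
    simp
  set N : (Fin n → ℝ) × (Fin n → ℝ) → ℝ := fun q => max (-logRatio v q.1 q.2) 0 with hN
  have hNi : Integrable N P := hJi.neg.pos_part
  set m := ∫ q, N q ∂P with hm
  have hm0 : 0 ≤ m := integral_nonneg fun _ => le_max_right _ _
  have h1v : 0 < 1 + v := by linarith
  have habs : ∫ q, |A q.1 + Γ q.2 + B q| ∂P = 4 * (1 + v) * m := by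
    have h1 : ∀ q : (Fin n → ℝ) × (Fin n → ℝ), |A q.1 + Γ q.2 + B q| =
        2 * (1 + v) * (2 * N q + logRatio v q.1 q.2) := by
      intro q
      have h2 : A q.1 + Γ q.2 + B q = 2 * (1 + v) * logRatio v q.1 q.2 := by
        rw [hJ q]; field_simp
      rw [h2, abs_mul, abs_of_pos (by positivity : 0 < 2 * (1 + v))]
      congr 1
      simp only [hN]
      rcases le_total (logRatio v q.1 q.2) 0 with h | h
      · rw [abs_of_nonpos h, max_eq_left (by linarith)]; ring
      · rw [abs_of_nonneg h, max_eq_right (by linarith)]; ring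
    simp_rw [h1]
    rw [integral_const_mul, integral_add (by fun_prop) hJi, integral_const_mul, hJ0]
    ring
  have habs' : ∫ q, |A q.1 + Γ q.2 - B q| ∂P = 4 * (1 + v) * m := by
    rw [← habs, ← hrefl.integral_comp hembed]
    refine integral_congr_ae (ae_of_all _ fun q => ?_)
    simp only [hBneg, hΓneg, sub_neg_eq_add]
  have hplus : Integrable (fun q : (Fin n → ℝ) × (Fin n → ℝ) => |A q.1 + Γ q.2 + B q|) P :=
    (hSi.add hBi).abs
  have hminus : Integrable (fun q : (Fin n → ℝ) × (Fin n → ℝ) => |A q.1 + Γ q.2 - B q|) P :=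
    (hSi.sub hBi).abs
  -- B is odd and A + Γ is even in the noise, so they are half the difference and half the sum of
  -- the numerator and its reflection, which have the same first absolute moment.
  have hBm : ∫ q, |B q| ∂P ≤ 4 * (1 + v) * m := by
    have h1 : ∫ q, 2 * |B q| ∂P ≤ ∫ q, (|A q.1 + Γ q.2 + B q| + |A q.1 + Γ q.2 - B q|) ∂P := by
      refine integral_mono (hBi.abs.const_mul _) (hplus.add hminus) fun q => ?_
      have := abs_sub (A q.1 + Γ q.2 + B q) (A q.1 + Γ q.2 - B q)
      have h2 : A q.1 + Γ q.2 + B q - (A q.1 + Γ q.2 - B q) = 2 * B q := by ring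
      rw [h2, abs_mul, abs_two] at this
      exact this
    rw [integral_const_mul, integral_add hplus hminus, habs, habs'] at h1
    linarith
  have hSm : ∫ q, |A q.1 + Γ q.2| ∂P ≤ 4 * (1 + v) * m := by
    have h1 : ∫ q, 2 * |A q.1 + Γ q.2| ∂P ≤
        ∫ q, (|A q.1 + Γ q.2 + B q| + |A q.1 + Γ q.2 - B q|) ∂P := by
      refine integral_mono (hSi.abs.const_mul _) (hplus.add hminus) fun q => ?_
      have := abs_add_le (A q.1 + Γ q.2 + B q) (A q.1 + Γ q.2 - B q)
      have h2 : A q.1 + Γ q.2 + B q + (A q.1 + Γ q.2 - B q) = 2 * (A q.1 + Γ q.2) := by ring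
      rw [h2, abs_mul, abs_two] at this
      exact this
    rw [integral_const_mul, integral_add hplus hminus, habs, habs'] at h1
    linarith
  -- A and Γ are independent and centred, so averaging out one of them can only decrease the first
  -- absolute moment.
  have hAm : ∫ x, |A x| ∂Px ≤ 4 * (1 + v) * m := by
    refine le_trans ?_ hSm
    rw [integral_prod _ hSi.abs]
    refine integral_mono hAi.abs hSi.abs.integral_prod_left fun x => ?_
    have h1 := abs_integral_le_integral_abs (μ := noiseLaw n) (f := fun w => A x + Γ w)
    rw [integral_add (by fun_prop) hΓi, hΓ0] at h1
    simpa using h1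
  have hΓm : ∫ w, |Γ w| ∂(noiseLaw n) ≤ 4 * (1 + v) * m := by
    refine le_trans ?_ hSm
    rw [integral_prod_symm _ hSi.abs]
    refine integral_mono hΓi.abs hSi.abs.integral_prod_right fun w => ?_
    have h1 := abs_integral_le_integral_abs (μ := Px) (f := fun x => A x + Γ w)
    rw [integral_add hAi (by fun_prop), hA0] at h1
    simpa using h1
  -- second moments
  have hΓsq : ∫ w, Γ w ^ 2 ∂(noiseLaw n) = v ^ 2 * (σ * n) := by
    have h1 := (hquad n fun _ => 1).1
    simp only [hΓ, mul_pow, neg_sq]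
    rw [integral_const_mul]
    unfold noiseLaw
    rw [h1]; simp
  have hΓsqi : Integrable (fun w => Γ w ^ 2) (noiseLaw n) := by
    simp only [hΓ, mul_pow]
    exact (integrable_pow_of_memLp_four (memLp_weighted_sum hsq _) (by norm_num)).const_mul _
  have hBsqi : Integrable (fun q => B q ^ 2) P := by
    refine ((hx2.mul_prod hΓ2).const_mul 4).mono'
      (Measurable.aestronglyMeasurable (by fun_prop)) (ae_of_all _ fun q => ?_)
    rw [Real.norm_of_nonneg (by positivity)]
    simp only [hB, mul_pow]
    have := Finset.sum_mul_sq_le_sq_mul_sq Finset.univ q.1 q.2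
    linarith
  have hBsq : ∫ q, B q ^ 2 ∂P = 4 * (n * v) := by
    rw [integral_prod _ hBsqi]
    have h1 : ∀ x : Fin n → ℝ, ∫ w, B (x, w) ^ 2 ∂(noiseLaw n) = 4 * ∑ t, x t ^ 2 := by
      intro x
      simp only [hB, mul_pow]
      rw [integral_const_mul]
      have := (hlin n x).1
      unfold noiseLaw
      rw [this, integral_sq_gaussianReal]; ring
    simp_rw [h1]
    rw [integral_const_mul, integral_sum_sq ν hν, hνv]
  have hz1 : ∫ t, t ^ 2 / v ∂ν = 1 := by rw [integral_div, hνv]; field_simp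
  have hwalk : ∀ x : Fin n → ℝ, ∑ i, (x i ^ 2 / v - 1) = A x / v := by
    intro x
    simp only [hA, Finset.sum_sub_distrib, ← Finset.sum_div]
    simp only [Finset.sum_const, Finset.card_univ, Fintype.card_fin, nsmul_eq_mul, mul_one]
    field_simp
  -- The normalized squares t²/v are nonnegative of mean one, so the walk bound needs nothing beyond
  -- the second moment of ν.
  have hAneg := integral_sq_neg_walk_le ν (z := fun t => t ^ 2 / v) (by fun_prop)
    (fun t => by positivity) (hν.div_const v) hz1 n
  have he : negMean ν (fun t => t ^ 2 / v) n 0 = (∫ x, |A x| ∂Px) / (2 * v) := by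
    unfold negMean
    simp only [hwalk, zero_add]
    have h1 : ∀ x : Fin n → ℝ, max (-(A x / v)) 0 = (|A x| - A x) / (2 * v) := by
      intro x
      rcases le_total (A x) 0 with h | h
      · rw [abs_of_nonpos h, max_eq_left (by
            rw [neg_nonneg]; exact div_nonpos_of_nonpos_of_nonneg h hv.le)]
        field_simp; ring
      · rw [abs_of_nonneg h, max_eq_right (by rw [neg_nonpos]; positivity)]
        simp
    simp_rw [h1]
    rw [integral_div, integral_sub hAi.abs hAi, hA0, sub_zero]
  have hAsqi : Integrable (fun x => (max (-A x) 0) ^ 2) Px := by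
    refine Integrable.of_bound (C := (n * v) ^ 2)
      (Measurable.aestronglyMeasurable (by fun_prop)) (ae_of_all _ fun x => ?_)
    rw [Real.norm_of_nonneg (by positivity)]
    refine pow_le_pow_left₀ (le_max_right _ _) (max_le ?_ (by positivity)) 2
    have : 0 ≤ ∑ t, x t ^ 2 := Finset.sum_nonneg fun t _ => by positivity
    simp only [hA]; linarith
  have hAsq : ∫ x, (max (-A x) 0) ^ 2 ∂Px ≤ 8 * (v + (∫ x, |A x| ∂Px) / 2) ^ 2 := by
    rw [he] at hAneg
    simp only [hwalk] at hAneg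
    have h1 : ∀ x : Fin n → ℝ, (max (-A x) 0) ^ 2 = v ^ 2 * (max (-(A x / v)) 0) ^ 2 := by
      intro x
      rw [← mul_pow, mul_max_of_nonneg _ _ hv.le]
      congr 2
      · field_simp
      · simp
    simp_rw [h1]
    rw [integral_const_mul]
    calc _ ≤ v ^ 2 * (8 * (1 + (∫ x, |A x| ∂Px) / (2 * v)) ^ 2) :=
          mul_le_mul_of_nonneg_left hAneg (by positivity)
      _ = _ := by field_simp
  have hri : Integrable (fun x : Fin n → ℝ => √(∑ t, x t ^ 2)) Px := by
    refine ((integrable_const 1).add hx2).mono'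
      (Measurable.aestronglyMeasurable (by fun_prop)) (ae_of_all _ fun x => ?_)
    have h0 : 0 ≤ ∑ t, x t ^ 2 := Finset.sum_nonneg fun t _ => by positivity
    rw [Real.norm_of_nonneg (Real.sqrt_nonneg _)]
    simp only [Pi.add_apply]
    linarith [Real.sq_sqrt h0, sq_nonneg (√(∑ t, x t ^ 2) - 1), Real.sqrt_nonneg (∑ t, x t ^ 2)]
  have hrm : ∫ x : Fin n → ℝ, √(∑ t, x t ^ 2) ∂Px ≤ c₁ * (2 * (1 + v) * m) := by
    have h1 : ∫ x : Fin n → ℝ, √(∑ t, x t ^ 2) ∂Px ≤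
        ∫ x, c₁ / 2 * (∫ w, |B (x, w)| ∂(noiseLaw n)) ∂Px := by
      refine integral_mono hri (hBi.abs.integral_prod_left.const_mul _) fun x => ?_
      have h2 := (hlin n x).2.2
      refine h2.trans (le_of_eq ?_)
      simp only [hB, abs_mul, abs_two]
      rw [integral_const_mul]
      unfold noiseLaw
      ring
    rw [integral_const_mul, ← integral_prod _ hBi.abs] at h1
    have := mul_le_mul_of_nonneg_left hBm (by positivity : 0 ≤ c₁ / 2)
    linarith
  set ρ := √(n * v) with hρ
  have hρ0 : 0 ≤ ρ := Real.sqrt_nonneg _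
  have hρsq : ρ ^ 2 = n * v := Real.sq_sqrt (by positivity)
  -- Pointwise ρ² ≤ ρ r + |r² - ρ²| with r = |x|. This bounds the size of B, whose second moment is
  -- 4ρ², through E|x| and E|A|, both already controlled by m.
  have hρm : ρ ^ 2 ≤ ρ * (c₁ * (2 * (1 + v) * m)) + 4 * (1 + v) * m := by
    have h1 : ∫ _, ρ ^ 2 ∂Px ≤ ∫ x, (ρ * √(∑ t, x t ^ 2) + |A x|) ∂Px := by
      refine integral_mono (integrable_const _) ((hri.const_mul _).add hAi.abs) fun x => ?_
      have h0 : 0 ≤ ∑ t, x t ^ 2 := Finset.sum_nonneg fun t _ => by positivity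
      have hs := Real.sq_sqrt h0
      have hs0 := Real.sqrt_nonneg (∑ t, x t ^ 2)
      simp only [hA]
      rw [← hρsq]
      generalize √(∑ t, x t ^ 2) = r at *
      rw [← hs]
      rcases le_total ρ r with h | h
      · linarith [abs_nonneg (r ^ 2 - ρ ^ 2), mul_le_mul_of_nonneg_left h hρ0]
      · linarith [neg_abs_le (r ^ 2 - ρ ^ 2), mul_le_mul_of_nonneg_left h hs0]
    rw [integral_add (hri.const_mul _) hAi.abs, integral_const_mul] at h1
    simp only [integral_const, probReal_univ, one_smul] at h1
    have := mul_le_mul_of_nonneg_left hrm hρ0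
    linarith
  have hnm : v * √n ≤ c₂ * (4 * (1 + v) * m) := by
    have h1 := (hquad n fun _ => 1).2.2
    simp only [one_pow, Finset.sum_const, Finset.card_univ, Fintype.card_fin, nsmul_eq_mul,
      mul_one] at h1
    have h2 : ∫ w, |Γ w| ∂(noiseLaw n) =
        v * ∫ w, |∑ t, 1 * (w t ^ 2 - 1)| ∂(Measure.pi fun _ : Fin n => gaussianReal 0 1) := by
      simp only [hΓ, abs_mul, abs_neg, abs_of_pos hv]
      rw [integral_const_mul]
      rfl
    calc v * √n ≤ v * (c₂ * _) := mul_le_mul_of_nonneg_left h1 hv.le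
      _ = c₂ * ∫ w, |Γ w| ∂(noiseLaw n) := by rw [h2]; ring
      _ ≤ _ := mul_le_mul_of_nonneg_left hΓm hc₂.le
  have hNpt : ∀ q, N q ^ 2 ≤
      3 / (4 * (1 + v) ^ 2) * ((max (-A q.1) 0) ^ 2 + Γ q.2 ^ 2 + B q ^ 2) := by
    intro q
    have h1 : 2 * (1 + v) * N q ≤ max (-A q.1) 0 + |Γ q.2| + |B q| := by
      simp only [hN]
      rw [hJ q, mul_max_of_nonneg _ _ (by positivity : 0 ≤ 2 * (1 + v)), mul_zero]
      apply max_le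
      · rw [mul_neg, mul_div_cancel₀ _ (by positivity)]
        linarith [le_max_left (-A q.1) 0, neg_abs_le (Γ q.2), neg_abs_le (B q)]
      · have := le_max_right (-A q.1) 0
        positivity
    have h0 : 0 ≤ N q := le_max_right _ _
    have h2 := pow_le_pow_left₀ (by positivity) h1 2
    have h3 : (max (-A q.1) 0 + |Γ q.2| + |B q|) ^ 2 ≤
        3 * ((max (-A q.1) 0) ^ 2 + Γ q.2 ^ 2 + B q ^ 2) := by
      rw [← sq_abs (Γ q.2), ← sq_abs (B q)]
      generalize max (-A q.1) 0 = a
      generalize |Γ q.2| = b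
      generalize |B q| = c
      linarith [sq_nonneg (a - b), sq_nonneg (a - c), sq_nonneg (b - c)]
    rw [div_mul_eq_mul_div, le_div_iff₀ (by positivity)]
    linarith
  have hA2 : Integrable (fun q : (Fin n → ℝ) × (Fin n → ℝ) => (max (-A q.1) 0) ^ 2) P :=
    hAsqi.comp_fst _
  have hΓ2' : Integrable (fun q : (Fin n → ℝ) × (Fin n → ℝ) => Γ q.2 ^ 2) P := hΓsqi.comp_snd _
  have hAΓ : Integrable
      (fun q : (Fin n → ℝ) × (Fin n → ℝ) => (max (-A q.1) 0) ^ 2 + Γ q.2 ^ 2) P := hA2.add hΓ2'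
  have hsumi : Integrable (fun q : (Fin n → ℝ) × (Fin n → ℝ) =>
      3 / (4 * (1 + v) ^ 2) * ((max (-A q.1) 0) ^ 2 + Γ q.2 ^ 2 + B q ^ 2)) P :=
    (hAΓ.add hBsqi).const_mul _
  have hNsqi : Integrable (fun q => N q ^ 2) P := by
    refine hsumi.mono' ((hNi.1.pow 2)) (ae_of_all _ fun q => ?_)
    rw [Real.norm_of_nonneg (by positivity)]
    exact hNpt q
  refine le_integral_exp_neg_max hC1 hJi hJ0.le hNsqi ?_
  have hfin := integral_mono hNsqi hsumi hNpt
  rw [integral_const_mul, integral_add hAΓ hBsqi, integral_add hA2 hΓ2',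
    integral_fun_fst (fun x => (max (-A x) 0) ^ 2), integral_fun_snd (fun w => Γ w ^ 2), hBsq,
    hΓsq] at hfin
  simp only [probReal_univ, one_smul] at hfin
  refine hfin.trans ?_
  change _ ≤ C * (1 + m) ^ 2
  set α := ∫ x, |A x| ∂Px with hα
  have hα0 : 0 ≤ α := integral_nonneg fun _ => abs_nonneg _
  have hn0 : √(n : ℝ) ^ 2 = n := Real.sq_sqrt (by positivity)
  calc _ ≤ 3 / (4 * (1 + v) ^ 2) *
        (8 * (v + α / 2) ^ 2 + v ^ 2 * (σ * √(n : ℝ) ^ 2) + 4 * ρ ^ 2) := by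
          rw [hn0, hρsq]
          gcongr
    _ ≤ _ := moment_arithmetic hv hm0 hα0 hσ0.le hAm hρm (Real.sqrt_nonneg _) hnm

end Density

/-! ### Change of measure from shifted noise to a wider Gaussian. -/

section ChangeOfMeasure

theorem measurable_observe {n p : ℕ} (β : Fin p → ℝ) :
    Measurable fun z : (Fin n → Fin p → ℝ) × (Fin n → ℝ) => observe z.1 β z.2 := by
  unfold observe Matrix.mulVec dotProduct
  fun_prop

/-- The law `N(0, (1 + v) Iₙ)`. -/
def wideLaw (n : ℕ) (v : ℝ) : Measure (Fin n → ℝ) :=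
  Measure.pi fun _ : Fin n => gaussianReal 0 (Real.toNNReal (1 + v))

instance isProbabilityMeasure_wideLaw (n : ℕ) (v : ℝ) : IsProbabilityMeasure (wideLaw n v) := by
  unfold wideLaw; infer_instance

theorem lintegral_pi_prod {n : ℕ} {γ : Measure ℝ} [IsProbabilityMeasure γ] {f : Fin n → ℝ → ℝ≥0∞}
    (hf : ∀ t, Measurable (f t)) :
    ∫⁻ w, ∏ t, f t (w t) ∂(Measure.pi fun _ : Fin n => γ) = ∏ t, ∫⁻ w, f t w ∂γ := by
  have h := lintegral_prod_eq_prod_lintegral_of_indepFun (μ := Measure.pi fun _ : Fin n => γ)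
    Finset.univ (fun t w => f t (w t)) (iIndepFun_pi fun t => (hf t).aemeasurable)
    (fun t => by fun_prop)
  rw [h]
  exact Finset.prod_congr rfl fun t _ =>
    (measurePreserving_eval (fun _ : Fin n => γ) t).lintegral_comp (hf t)

/-- Completing the square in one coordinate. -/
theorem gaussianPDFReal_mul_exp {v : ℝ} (hv : 0 < v) (x w : ℝ) :
    gaussianPDFReal 0 1 w * (√(1 + v)⁻¹ *
      Real.exp (-((x ^ 2 + 2 * (x * w) - v * w ^ 2) / (2 * (1 + v))))) =
      gaussianPDFReal 0 (Real.toNNReal (1 + v)) (x + w) := by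
  have h1 : 0 < 1 + v := by linarith
  simp only [gaussianPDFReal, NNReal.coe_one, mul_one, sub_zero, Real.coe_toNNReal _ h1.le]
  rw [Real.sqrt_mul (by positivity) (1 + v), Real.sqrt_inv, mul_inv]
  have : Real.exp (-w ^ 2 / 2) * Real.exp (-((x ^ 2 + 2 * (x * w) - v * w ^ 2) / (2 * (1 + v)))) =
      Real.exp (-(x + w) ^ 2 / (2 * (1 + v))) := by
    rw [← Real.exp_add]
    congr 1
    field_simp
    ring
  rw [← this]; ring

theorem lintegral_shift_gaussianReal {v : ℝ} (hv : 0 < v) (x : ℝ) {f : ℝ → ℝ≥0∞}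
    (hf : Measurable f) :
    ∫⁻ w, f (x + w) * ENNReal.ofReal (√(1 + v)⁻¹ *
      Real.exp (-((x ^ 2 + 2 * (x * w) - v * w ^ 2) / (2 * (1 + v))))) ∂(gaussianReal 0 1) =
      ∫⁻ y, f y ∂(gaussianReal 0 (Real.toNNReal (1 + v))) := by
  have h1 : Real.toNNReal (1 + v) ≠ 0 := by
    simp only [ne_eq, Real.toNNReal_eq_zero]; linarith
  rw [gaussianReal_of_var_ne_zero _ one_ne_zero, gaussianReal_of_var_ne_zero _ h1,
    lintegral_withDensity_eq_lintegral_mul _ (measurable_gaussianPDF _ _) (by fun_prop),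
    lintegral_withDensity_eq_lintegral_mul _ (measurable_gaussianPDF _ _) hf,
    ← lintegral_add_left_eq_self (gaussianPDF 0 (Real.toNNReal (1 + v)) * f) x]
  refine lintegral_congr fun w => ?_
  simp only [Pi.mul_apply, gaussianPDF]
  rw [← gaussianPDFReal_mul_exp hv x w, ENNReal.ofReal_mul (gaussianPDFReal_nonneg _ _ _)]
  ring

/-- The weight exp(-J) is, up to (1 + v)^(n/2), the density of N(0, (1 + v) I) relative to the law
of x + w. The right-hand side no longer involves x, which is what allows different signals to be
compared. -/
theorem lintegral_shift_noiseLaw {n : ℕ} {v : ℝ} (hv : 0 < v) (x : Fin n → ℝ)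
    {h : (Fin n → ℝ) → ℝ≥0∞} (hh : Measurable h) :
    ∫⁻ w, h (x + w) * ENNReal.ofReal (Real.exp (-logRatio v x w)) ∂(noiseLaw n) =
      ENNReal.ofReal (√(1 + v) ^ n) * ∫⁻ y, h y ∂(wideLaw n v) := by
  have h1 : 0 < 1 + v := by linarith
  let r : Fin n → ℝ → ℝ≥0∞ := fun t w => ENNReal.ofReal (√(1 + v)⁻¹ *
      Real.exp (-((x t ^ 2 + 2 * (x t * w) - v * w ^ 2) / (2 * (1 + v)))))
  have hr : ∀ t, Measurable (r t) := fun t => by fun_prop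
  have hprod : ∀ w : Fin n → ℝ, ENNReal.ofReal (Real.exp (-logRatio v x w)) =
      ENNReal.ofReal (√(1 + v) ^ n) * ∏ t, r t (w t) := by
    intro w
    simp only [r]
    rw [← ENNReal.ofReal_prod_of_nonneg (fun t _ => by positivity),
      ← ENNReal.ofReal_mul (by positivity), Finset.prod_mul_distrib, ← Real.exp_sum]
    simp only [Finset.prod_const, Finset.card_univ, Fintype.card_fin]
    rw [Real.sqrt_inv, ← mul_assoc, ← mul_pow, mul_inv_cancel₀ (by positivity), one_pow, one_mul]
    congr 2
    rw [Finset.sum_neg_distrib, ← Finset.sum_div, logRatio, Finset.sum_sub_distrib,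
      Finset.sum_add_distrib, ← Finset.mul_sum, ← Finset.mul_sum]
  have hkey : ((noiseLaw n).withDensity fun w => ∏ t, r t (w t)).map (fun w => x + w) =
      wideLaw n v := by
    unfold wideLaw
    symm
    refine Measure.pi_eq fun s hs => ?_
    rw [Measure.map_apply (by fun_prop) (MeasurableSet.univ_pi hs),
      withDensity_apply _ ((MeasurableSet.univ_pi hs).preimage (by fun_prop)),
      ← lintegral_indicator ((MeasurableSet.univ_pi hs).preimage (by fun_prop))]
    have e : ∀ w : Fin n → ℝ, ((fun w => x + w) ⁻¹' Set.univ.pi s).indicator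
        (fun w => ∏ t, r t (w t)) w =
        ∏ t, ((s t).indicator 1 (x t + w t) * r t (w t)) := by
      intro w
      by_cases hw : ∀ t, x t + w t ∈ s t
      · rw [Set.indicator_of_mem (by simpa using hw)]
        refine Finset.prod_congr rfl fun t _ => ?_
        rw [Set.indicator_of_mem (hw t)]; simp
      · rw [Set.indicator_of_notMem (by simpa using hw)]
        push Not at hw
        obtain ⟨t, ht⟩ := hw
        symm
        apply Finset.prod_eq_zero (Finset.mem_univ t)
        rw [Set.indicator_of_notMem ht, zero_mul]
    simp_rw [e]
    unfold noiseLaw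
    rw [lintegral_pi_prod (f := fun t w => (s t).indicator 1 (x t + w) * r t w)
      (fun t => ((measurable_one.indicator (hs t)).comp (by fun_prop)).mul (hr t))]
    refine Finset.prod_congr rfl fun t _ => ?_
    rw [lintegral_shift_gaussianReal hv (x t) (measurable_one.indicator (hs t)),
      lintegral_indicator_one (hs t)]
  have hrm : Measurable fun w : Fin n → ℝ => ∏ t, r t (w t) :=
    Finset.measurable_prod _ fun t _ => (hr t).comp (measurable_pi_apply t)
  rw [← hkey, lintegral_map hh (by fun_prop),
    lintegral_withDensity_eq_lintegral_mul _ hrm (by fun_prop),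
    ← lintegral_const_mul _ (by fun_prop)]
  refine lintegral_congr fun w => ?_
  rw [hprod]
  simp only [Pi.mul_apply]
  ring

end ChangeOfMeasure

/-! ### The law of the matrix applied to a fixed vector. -/

section Projection

variable {p : ℕ} (μ : Measure ℝ) [IsProbabilityMeasure μ]

/-- The law of one coordinate of `X u`. -/
def rowLaw (u : Fin p → ℝ) : Measure ℝ :=
  (Measure.pi fun _ : Fin p => μ).map fun x => ∑ j, x j * u j

instance isProbabilityMeasure_rowLaw (u : Fin p → ℝ) : IsProbabilityMeasure (rowLaw μ u) :=
  Measure.isProbabilityMeasure_map (Measurable.aemeasurable (by fun_prop))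

/-- Variances of independent centred terms add up, so the second moment depends on u only through
its norm. Hence signals on a common sphere share one value of v. -/
theorem integrable_sq_rowLaw (hL2 : MemLp (fun x : ℝ => x) 2 μ) (hmean : ∫ x, x ∂μ = 0)
    (hvar : variance (fun x : ℝ => x) μ = 1) (u : Fin p → ℝ) :
    Integrable (fun x => x ^ 2) (rowLaw μ u) ∧ ∫ x, x ^ 2 ∂(rowLaw μ u) = ∑ j, u j ^ 2 := by
  have hm : ∀ j, MemLp (fun x : ℝ => x * u j) 2 μ := fun j => hL2.mul_const (u j)
  have hs : MemLp (fun x : Fin p → ℝ => ∑ j, x j * u j) 2 (Measure.pi fun _ : Fin p => μ) :=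
    memLp_finsetSum _ fun j _ =>
      (hm j).comp_measurePreserving (measurePreserving_eval (fun _ : Fin p => μ) j)
  have hmeas : AEMeasurable (fun x : Fin p → ℝ => ∑ j, x j * u j)
    (Measure.pi fun _ : Fin p => μ) := Measurable.aemeasurable (by fun_prop)
  constructor
  · unfold rowLaw
    rw [integrable_map_measure (by fun_prop) hmeas]
    exact hs.integrable_sq
  · unfold rowLaw
    rw [integral_map hmeas (by fun_prop)]
    have h1 := variance_sum_pi (μ := fun _ : Fin p => μ) hm
    have h2 : ∀ j, variance (fun x : ℝ => x * u j) μ = u j ^ 2 := by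
      intro j
      have := variance_mul_const (u j) (fun x : ℝ => x) μ
      rw [hvar] at this
      simpa using this
    have h3 : ∫ x : Fin p → ℝ, ∑ j, x j * u j ∂(Measure.pi fun _ : Fin p => μ) = 0 := by
      have hi : Integrable (fun x : ℝ => x) μ := hL2.integrable (by norm_num)
      rw [integral_finsetSum]
      · refine Finset.sum_eq_zero fun j _ => ?_
        rw [integral_mul_const, integral_comp_eval (μ := fun _ : Fin p => μ) (i := j)
          (f := fun x : ℝ => x) hi.1, hmean, zero_mul]
      · exact fun j _ =>
          (integrable_comp_eval (μ := fun _ : Fin p => μ) (i := j) hi).mul_const _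
    have h4 : (∑ j, fun x : Fin p → ℝ => x j * u j) = fun x => ∑ j, x j * u j := by
      ext x; simp
    rw [h4, variance_of_integral_eq_zero hmeas h3] at h1
    simp_rw [h2] at h1
    exact h1

theorem measurePreserving_mulVec (n : ℕ) (u : Fin p → ℝ) :
    MeasurePreserving (fun X : Fin n → Fin p → ℝ => (Matrix.of X).mulVec u) (matrixLaw μ n p)
      (Measure.pi fun _ : Fin n => rowLaw μ u) :=
  measurePreserving_pi (fun _ : Fin n => Measure.pi fun _ : Fin p => μ)
    (fun _ : Fin n => rowLaw μ u) (f := fun _ x => ∑ j, x j * u j) fun _ => ⟨by fun_prop, rfl⟩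

instance isProbabilityMeasure_matrixLaw (n p : ℕ) : IsProbabilityMeasure (matrixLaw μ n p) := by
  unfold matrixLaw; infer_instance

instance isProbabilityMeasure_jointLaw (n p : ℕ) : IsProbabilityMeasure (jointLaw μ n p) := by
  unfold jointLaw; infer_instance

end Projection

/-! ### Lower bound on the error for signals on a sphere. -/

section Converse

variable {n p : ℕ} (μ : Measure ℝ) [IsProbabilityMeasure μ]

theorem measurable_mulVec (u : Fin p → ℝ) :
    Measurable fun X : Fin n → Fin p → ℝ => (Matrix.of X).mulVec u := by
  unfold Matrix.mulVec dotProduct; fun_prop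

/-- The log-likelihood ratio of the signal displaced by `u`, as a function of the matrix and of
the noise. -/
def signalRatio (v : ℝ) (u : Fin p → ℝ) (z : (Fin n → Fin p → ℝ) × (Fin n → ℝ)) : ℝ :=
  logRatio v ((Matrix.of z.1).mulVec u) z.2

theorem measurable_signalRatio (v : ℝ) (u : Fin p → ℝ) :
    Measurable fun z : (Fin n → Fin p → ℝ) × (Fin n → ℝ) => signalRatio v u z := by
  have h : Measurable fun z : (Fin n → Fin p → ℝ) × (Fin n → ℝ) =>
      ((Matrix.of z.1).mulVec u, z.2) :=
    ((measurable_mulVec u).comp measurable_fst).prodMk measurable_snd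
  have h2 := (measurable_logRatio (n := n) v).comp h
  simpa only [signalRatio, Function.comp_def] using h2

/-- The event that the decoder outputs the support of `β`. -/
def decodeSet (g : Decoder n p) (β : Fin p → ℝ) : Set ((Fin n → Fin p → ℝ) × (Fin n → ℝ)) :=
  {z | g.estimate z.1 z.2 = supp β}

theorem measurableSet_decodeSet (g : Decoder n p) (β : Fin p → ℝ) :
    MeasurableSet (decodeSet g β) := g.measurable_estimate _

/-- The event that the decoder recovers the support of `β` when the signal is `β`. -/
def successSet (g : Decoder n p) (β : Fin p → ℝ) : Set ((Fin n → Fin p → ℝ) × (Fin n → ℝ)) :=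
  {z | (z.1, observe z.1 β z.2) ∈ decodeSet g β}

theorem measurableSet_successSet (g : Decoder n p) (β : Fin p → ℝ) :
    MeasurableSet (successSet g β) :=
  (measurableSet_decodeSet g β).preimage (measurable_fst.prodMk (measurable_observe β))

theorem errorProb_eq (g : Decoder n p) (β : Fin p → ℝ) :
    errorProb μ g β = jointLaw μ n p (successSet g β)ᶜ := rfl

theorem ofReal_le_lintegral_signalRatio {T v lam : ℝ} (hlam : 0 ≤ lam)
    (hT : ∀ (ν : Measure ℝ) [IsProbabilityMeasure ν], Integrable (fun x => x ^ 2) ν →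
      ∫ x, x ^ 2 ∂ν = v →
      3 / 4 ≤ ∫ q : (Fin n → ℝ) × (Fin n → ℝ), Real.exp (-max (logRatio v q.1 q.2) (-T))
        ∂((Measure.pi fun _ : Fin n => ν).prod (noiseLaw n)))
    (hL2 : MemLp (fun x : ℝ => x) 2 μ) (hmean : ∫ x, x ∂μ = 0)
    (hvar : variance (fun x : ℝ => x) μ = 1) (u : Fin p → ℝ) (hu : ∑ j, u j ^ 2 = v) :
    ENNReal.ofReal (lam * (3 / 4)) ≤
      ∫⁻ z, ENNReal.ofReal (lam * Real.exp (-max (signalRatio v u z) (-T))) ∂(jointLaw μ n p) := by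
  obtain ⟨hi, hv'⟩ := integrable_sq_rowLaw μ hL2 hmean hvar u
  have h2 := hT (rowLaw μ u) hi (by rw [hv', hu])
  have hmp : MeasurePreserving
      (fun z : (Fin n → Fin p → ℝ) × (Fin n → ℝ) => ((Matrix.of z.1).mulVec u, z.2))
      (jointLaw μ n p) ((Measure.pi fun _ : Fin n => rowLaw μ u).prod (noiseLaw n)) :=
    (measurePreserving_mulVec μ n u).prod (MeasurePreserving.id _)
  have h3 : ∫ z, Real.exp (-max (signalRatio v u z) (-T)) ∂(jointLaw μ n p) =
      ∫ q : (Fin n → ℝ) × (Fin n → ℝ), Real.exp (-max (logRatio v q.1 q.2) (-T))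
      ∂((Measure.pi fun _ : Fin n => rowLaw μ u).prod (noiseLaw n)) := by
    rw [← hmp.map_eq, integral_map hmp.aemeasurable]
    · rfl
    · exact (Real.measurable_exp.comp
        ((measurable_logRatio v).max measurable_const).neg).aestronglyMeasurable
  rw [← ofReal_integral_eq_lintegral_ofReal
    ((integrable_exp_neg_max (measurable_signalRatio v u).aemeasurable _).const_mul _)
    (ae_of_all _ fun z => by positivity), integral_const_mul, h3]
  exact ENNReal.ofReal_le_ofReal (mul_le_mul_of_nonneg_left h2 hlam)

theorem measurable_successSet_mul (g : Decoder n p) (β : Fin p → ℝ) (v : ℝ) (u : Fin p → ℝ) :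
    Measurable fun z =>
      (successSet g β).indicator (1 : (Fin n → Fin p → ℝ) × (Fin n → ℝ) → ℝ≥0∞) z *
      ENNReal.ofReal (Real.exp (-signalRatio v u z)) :=
  (measurable_one.indicator (measurableSet_successSet g β)).mul
    (ENNReal.measurable_ofReal.comp (Real.measurable_exp.comp (measurable_signalRatio v u).neg))

/-- On success the truncation is simply dropped. On failure the integrand is at most 1, since the
truncation level -T cancels the prefactor e^(-T). -/
theorem lintegral_le_errorProb_add (g : Decoder n p) (β : Fin p → ℝ) (v T : ℝ) (u : Fin p → ℝ) :
    ∫⁻ z, ENNReal.ofReal (Real.exp (-T) * Real.exp (-max (signalRatio v u z) (-T)))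
        ∂(jointLaw μ n p) ≤ errorProb μ g β +
      ENNReal.ofReal (Real.exp (-T)) * ∫⁻ z, (successSet g β).indicator 1 z *
        ENNReal.ofReal (Real.exp (-signalRatio v u z)) ∂(jointLaw μ n p) := by
  have hA := measurableSet_successSet g β
  rw [errorProb_eq, ← lintegral_indicator_one hA.compl,
    ← lintegral_const_mul _ (measurable_successSet_mul g β v u),
    ← lintegral_add_left (measurable_one.indicator hA.compl)]
  refine lintegral_mono fun z => ?_
  by_cases hz : z ∈ successSet g β
  · rw [Set.indicator_of_notMem (by simpa using hz), Set.indicator_of_mem hz]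
    simp only [Pi.one_apply, one_mul, zero_add]
    rw [← ENNReal.ofReal_mul (Real.exp_nonneg _)]
    refine ENNReal.ofReal_le_ofReal (mul_le_mul_of_nonneg_left ?_ (Real.exp_nonneg _))
    exact Real.exp_le_exp.2 (neg_le_neg (le_max_left _ _))
  · rw [Set.indicator_of_mem (by simpa using hz), Set.indicator_of_notMem hz]
    simp only [Pi.one_apply, zero_mul, mul_zero, add_zero]
    rw [ENNReal.ofReal_le_one, ← Real.exp_add]
    apply Real.exp_le_one_iff.2
    linarith [le_max_right (signalRatio v u z) (-T)]

/-- Conditionally on X, the change of measure replaces the law of Y - X c₀ by N(0, (1 + v) I), so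
only the decoding region still depends on β. -/
theorem lintegral_successSet_eq {v : ℝ} (hv : 0 < v) (g : Decoder n p) (β c₀ : Fin p → ℝ) :
    ∫⁻ z, (successSet g β).indicator 1 z * ENNReal.ofReal (Real.exp (-signalRatio v (β - c₀) z))
        ∂(jointLaw μ n p) = ∫⁻ X, ENNReal.ofReal (√(1 + v) ^ n) *
          ∫⁻ y, (decodeSet g β).indicator 1 (X, (Matrix.of X).mulVec c₀ + y) ∂(wideLaw n v)
          ∂(matrixLaw μ n p) := by
  unfold jointLaw
  rw [lintegral_prod _ (measurable_successSet_mul g β v _).aemeasurable]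
  refine lintegral_congr fun X => ?_
  rw [← lintegral_shift_noiseLaw hv ((Matrix.of X).mulVec (β - c₀))
    (h := fun y => (decodeSet g β).indicator 1 (X, (Matrix.of X).mulVec c₀ + y))
    ((measurable_one.indicator (measurableSet_decodeSet g β)).comp (by fun_prop))]
  refine lintegral_congr fun w => ?_
  have : (Matrix.of X).mulVec c₀ + ((Matrix.of X).mulVec (β - c₀) + w) = observe X β w := by
    rw [Matrix.mulVec_sub, observe]; abel
  rw [this]
  rfl

/-- Distinct supports have disjoint decoding regions, and their probabilities are now taken under
one common law, so they sum to at most 1. -/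
theorem sum_lintegral_successSet_le {v : ℝ} (hv : 0 < v) (g : Decoder n p) {ι : Type} [Fintype ι]
    (c : ι → Fin p → ℝ) (c₀ : Fin p → ℝ) (hinj : Function.Injective fun s => supp (c s)) :
    ∑ s, ∫⁻ z, (successSet g (c s)).indicator 1 z *
        ENNReal.ofReal (Real.exp (-signalRatio v (c s - c₀) z)) ∂(jointLaw μ n p) ≤
      ENNReal.ofReal (√(1 + v) ^ n) := by
  simp_rw [lintegral_successSet_eq μ hv]
  have hmD : ∀ s, Measurable fun q : (Fin n → Fin p → ℝ) × (Fin n → ℝ) =>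
      (decodeSet g (c s)).indicator (1 : (Fin n → Fin p → ℝ) × (Fin n → ℝ) → ℝ≥0∞)
        (q.1, (Matrix.of q.1).mulVec c₀ + q.2) :=
    fun s => (measurable_one.indicator (measurableSet_decodeSet g (c s))).comp
      (measurable_fst.prodMk (((measurable_mulVec c₀).comp measurable_fst).add measurable_snd))
  rw [← lintegral_finsetSum _ fun s _ => ((hmD s).lintegral_prod_right').const_mul _]
  calc _ ≤ ∫⁻ _, ENNReal.ofReal (√(1 + v) ^ n) ∂(matrixLaw μ n p) := by
        refine lintegral_mono fun X => ?_
        rw [← Finset.mul_sum]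
        refine mul_le_of_le_one_right' ?_
        have hmX : ∀ s, Measurable fun y : Fin n → ℝ => (decodeSet g (c s)).indicator
            (1 : (Fin n → Fin p → ℝ) × (Fin n → ℝ) → ℝ≥0∞) (X, (Matrix.of X).mulVec c₀ + y) :=
          fun s => (hmD s).comp measurable_prodMk_left
        rw [← lintegral_finsetSum _ fun s _ => hmX s]
        calc _ ≤ ∫⁻ _, 1 ∂(wideLaw n v) := by
              refine lintegral_mono fun y => ?_
              by_cases hex : ∃ s, (X, (Matrix.of X).mulVec c₀ + y) ∈ decodeSet g (c s)
              · obtain ⟨s, hs⟩ := hex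
                rw [Finset.sum_eq_single s]
                · exact Set.indicator_le_self' (fun _ _ => zero_le) _
                · intro s' _ hne
                  refine Set.indicator_of_notMem (fun hs' => hne (hinj ?_)) _
                  exact hs'.symm.trans hs
                · simp
              · push Not at hex
                rw [Finset.sum_eq_zero fun s _ => Set.indicator_of_notMem (hex s) _]
                exact zero_le
          _ = 1 := by simp
    _ = _ := by simp

/-- If a finite family of signals with distinct supports lies on a sphere of squared radius `v`
about some centre and has at least `2 (1 + v) ^ (n / 2)` members, then its average probability of
error is bounded below by a universal constant. -/
theorem exists_le_sum_errorProb :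
    ∃ ε : ℝ≥0∞, 0 < ε ∧ ∀ (μ : Measure ℝ) [IsProbabilityMeasure μ],
      MemLp (fun x : ℝ => x) 2 μ → ∫ x, x ∂μ = 0 → variance (fun x : ℝ => x) μ = 1 →
      ∀ (n p : ℕ) (g : Decoder n p) (ι : Type) [Fintype ι] (c : ι → Fin p → ℝ) (c₀ : Fin p → ℝ)
        (v : ℝ), 0 < v → Function.Injective (fun s => supp (c s)) →
      (∀ s, ∑ j, (c s j - c₀ j) ^ 2 = v) → 2 * √(1 + v) ^ n ≤ Fintype.card ι →
      Fintype.card ι * ε ≤ ∑ s, errorProb μ g (c s) := by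
  obtain ⟨T, hT⟩ := exists_le_integral_exp_neg_logRatio
  refine ⟨ENNReal.ofReal (Real.exp (-T) / 4), by simp [Real.exp_pos], ?_⟩
  intro μ _ hL2 hmean hvar n p g ι _ c c₀ v hv hinj hsq hcard
  have hlam0 : 0 < Real.exp (-T) := Real.exp_pos _
  have hsplit := fun s => (ofReal_le_lintegral_signalRatio (n := n) μ hlam0.le
    (fun ν _ => hT n v ν hv) hL2 hmean hvar (c s - c₀) (hsq s)).trans
    (lintegral_le_errorProb_add μ g (c s) v T (c s - c₀))
  have hsum := Finset.sum_le_sum fun (s : ι) (_ : s ∈ Finset.univ) => hsplit s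
  rw [Finset.sum_const, Finset.sum_add_distrib, ← Finset.mul_sum] at hsum
  have hsum2 := hsum.trans (add_le_add le_rfl
    (mul_le_mul_right (sum_lintegral_successSet_le μ hv g c c₀ hinj) (ENNReal.ofReal _)))
  rw [← ENNReal.ofReal_mul hlam0.le] at hsum2
  generalize Real.exp (-T) = lam at *
  -- The hypothesis on the cardinality makes the success term at most half of lam times the number
  -- of signals; with 3/4 on the other side, lam/4 per signal is left for the errors.
  have h5 : ENNReal.ofReal (lam * √(1 + v) ^ n) ≤
      ENNReal.ofReal (Fintype.card ι * (lam * (1 / 2))) := by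
    apply ENNReal.ofReal_le_ofReal
    linarith [mul_le_mul_of_nonneg_left hcard hlam0.le]
  have hsum3 := hsum2.trans (add_le_add le_rfl h5)
  have h6 : (Finset.univ : Finset ι).card • ENNReal.ofReal (lam * (3 / 4)) =
      Fintype.card ι * ENNReal.ofReal (lam / 4) +
        ENNReal.ofReal (Fintype.card ι * (lam * (1 / 2))) := by
    rw [nsmul_eq_mul, Finset.card_univ, ← ENNReal.ofReal_natCast,
      ← ENNReal.ofReal_mul (by positivity), ← ENNReal.ofReal_mul (by positivity),
      ← ENNReal.ofReal_add (by positivity) (by positivity)]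
    congr 1; ring
  rw [h6] at hsum3
  exact (ENNReal.add_le_add_iff_right ENNReal.ofReal_ne_top).1 hsum3

end Converse

/-! ### Worst-case errors and averaging over supports. -/

section WorstCase

variable {n p : ℕ} (μ : Measure ℝ) [IsProbabilityMeasure μ]

/-- The probability of error for the support `S`, for the worst signal of the class. -/
def worstError (βmin : ℝ) (g : Decoder n p) (S : Finset (Fin p)) : ℝ≥0∞ :=
  ⨆ (β : Fin p → ℝ) (_ : supp β = S ∧ β ∈ signalClass p βmin), errorProb μ g β

theorem errorProb_le_one (g : Decoder n p) (β : Fin p → ℝ) : errorProb μ g β ≤ 1 := prob_le_one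

theorem errorProb_le_worstError {βmin : ℝ} (g : Decoder n p) {S : Finset (Fin p)}
    {β : Fin p → ℝ} (hS : supp β = S) (hβ : β ∈ signalClass p βmin) :
    errorProb μ g β ≤ worstError μ βmin g S :=
  le_iSup₂_of_le β ⟨hS, hβ⟩ le_rfl

/-- The signal with support `S` all of whose nonzero entries equal `a`. -/
def flatSignal (a : ℝ) (S : Finset (Fin p)) : Fin p → ℝ := fun i => if i ∈ S then a else 0

theorem supp_flatSignal {a : ℝ} (ha : 0 < a) (S : Finset (Fin p)) : supp (flatSignal a S) = S := by
  ext i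
  simp [supp, flatSignal, ha.ne']

theorem flatSignal_mem {a : ℝ} (ha : 0 < a) (S : Finset (Fin p)) :
    flatSignal a S ∈ signalClass p a := by
  intro i hi
  rw [supp_flatSignal ha] at hi
  simp [flatSignal, hi, abs_of_pos ha]

/-- The signals for different supports are chosen independently of each other, so the supremum
passes inside the average: take a signal within η of the worst for each support. -/
theorem sum_worstError_le_classError {k : ℕ} {βmin : ℝ} (hβ : 0 < βmin) (g : Decoder n p) :
    ((p.choose k : ℕ) : ℝ≥0∞)⁻¹ *
        ∑ S ∈ Finset.powersetCard k (Finset.univ : Finset (Fin p)), worstError μ βmin g S ≤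
      classError μ k βmin g := by
  refine ENNReal.le_of_forall_pos_le_add fun η hη _ => ?_
  have hex : ∀ S : Finset (Fin p), ∃ β : Fin p → ℝ, (supp β = S ∧ β ∈ signalClass p βmin) ∧
      worstError μ βmin g S ≤ errorProb μ g β + η := by
    intro S
    by_contra hcon
    push Not at hcon
    have h0 := hcon _ ⟨supp_flatSignal hβ S, flatSignal_mem hβ S⟩
    -- If no signal came within η, the supremum would be at most itself minus η. Finiteness and the
    -- strict inequality `h0` for the flat signal make this impossible.
    have hle : worstError μ βmin g S ≤ worstError μ βmin g S - η := by
      conv_lhs => rw [worstError]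
      refine iSup₂_le fun β h => ?_
      exact ENNReal.le_sub_of_add_le_right ENNReal.coe_ne_top (hcon β h).le
    have hfin : worstError μ βmin g S ≠ ∞ :=
      ((iSup₂_le fun β _ => errorProb_le_one μ g β).trans_lt ENNReal.one_lt_top).ne
    have hpos : worstError μ βmin g S ≠ 0 := (lt_of_le_of_lt zero_le h0).ne'
    exact absurd hle (not_le.2 (ENNReal.sub_lt_self hfin hpos (by exact_mod_cast hη.ne')))
  choose β hβ1 hβ2 using hex
  have hle : avgError μ k g β ≤ classError μ k βmin g :=
    le_iSup₂_of_le β (fun S _ => hβ1 S) le_rfl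
  refine le_trans ?_ (add_le_add_left hle _)
  unfold avgError
  calc _ ≤ ((p.choose k : ℕ) : ℝ≥0∞)⁻¹ *
        ∑ S ∈ Finset.powersetCard k (Finset.univ : Finset (Fin p)),
          (errorProb μ g (β S) + η) := by gcongr with S; exact hβ2 S
    _ = ((p.choose k : ℕ) : ℝ≥0∞)⁻¹ * ∑ S ∈ Finset.powersetCard k (Finset.univ : Finset (Fin p)),
          errorProb μ g (β S) + ((p.choose k : ℕ) : ℝ≥0∞)⁻¹ * (p.choose k : ℕ) * η := by
        rw [Finset.sum_add_distrib, mul_add, Finset.sum_const, Finset.card_powersetCard]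
        simp [mul_assoc]
    _ ≤ _ := by
        gcongr
        exact mul_le_of_le_one_left' (ENNReal.inv_mul_le_one _)

/-- Double counting of pairs (T, j) with j outside T against pairs (S, j) with j in S. -/
theorem sum_powersetCard_insert {k : ℕ} (e : Finset (Fin p) → ℝ≥0∞) :
    ∑ T ∈ Finset.powersetCard k (Finset.univ : Finset (Fin p)), ∑ j ∈ Tᶜ, e (insert j T) =
      ∑ S ∈ Finset.powersetCard (k + 1) (Finset.univ : Finset (Fin p)), ∑ _j ∈ S, e S := by
  rw [Finset.sum_sigma', Finset.sum_sigma']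
  refine Finset.sum_bij' (fun x _ => ⟨insert x.2 x.1, x.2⟩) (fun x _ => ⟨x.1.erase x.2, x.2⟩)
    ?_ ?_ ?_ ?_ ?_
  · rintro ⟨T, j⟩ h
    simp only [Finset.mem_sigma, Finset.mem_powersetCard, Finset.subset_univ, true_and,
      Finset.mem_compl] at h ⊢
    exact ⟨by rw [Finset.card_insert_of_notMem h.2, h.1], Finset.mem_insert_self _ _⟩
  · rintro ⟨S, j⟩ h
    simp only [Finset.mem_sigma, Finset.mem_powersetCard, Finset.subset_univ, true_and,
      Finset.mem_compl] at h ⊢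
    exact ⟨by rw [Finset.card_erase_of_mem h.2, h.1]; rfl, Finset.notMem_erase _ _⟩
  · rintro ⟨T, j⟩ h
    simp only [Finset.mem_sigma, Finset.mem_compl] at h
    simp [Finset.erase_insert h.2]
  · rintro ⟨S, j⟩ h
    simp only [Finset.mem_sigma] at h
    simp [Finset.insert_erase h.2]
  · rintro ⟨T, j⟩ _
    rfl

/-- A bound averaged over the last index, for each fixed choice of the other k, gives a bound
averaged over all supports, because (k + 1) C(p, k + 1) = C(p, k)(p - k). -/
theorem le_average_of_le_sum_insert {k : ℕ} (hkp : k < p) {ε : ℝ≥0∞} (e : Finset (Fin p) → ℝ≥0∞)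
    (h : ∀ T : Finset (Fin p), T.card = k → ((p - k : ℕ) : ℝ≥0∞) * ε ≤ ∑ j ∈ Tᶜ, e (insert j T)) :
    ε ≤ ((p.choose (k + 1) : ℕ) : ℝ≥0∞)⁻¹ *
      ∑ S ∈ Finset.powersetCard (k + 1) (Finset.univ : Finset (Fin p)), e S := by
  have h1 : ((p.choose k : ℕ) : ℝ≥0∞) * (((p - k : ℕ) : ℝ≥0∞) * ε) ≤
      ((k + 1 : ℕ) : ℝ≥0∞) *
        ∑ S ∈ Finset.powersetCard (k + 1) (Finset.univ : Finset (Fin p)), e S := by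
    calc _ = ∑ T ∈ Finset.powersetCard k (Finset.univ : Finset (Fin p)),
          ((p - k : ℕ) : ℝ≥0∞) * ε := by
          rw [Finset.sum_const, Finset.card_powersetCard]; simp
      _ ≤ ∑ T ∈ Finset.powersetCard k (Finset.univ : Finset (Fin p)), ∑ j ∈ Tᶜ, e (insert j T) :=
          Finset.sum_le_sum fun T hT => h T (Finset.mem_powersetCard.1 hT).2
      _ = _ := by
          rw [sum_powersetCard_insert, Finset.mul_sum]
          refine Finset.sum_congr rfl fun S hS => ?_
          rw [Finset.sum_const, (Finset.mem_powersetCard.1 hS).2, nsmul_eq_mul]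
  rw [← mul_assoc, ← Nat.cast_mul, ← Nat.choose_succ_right_eq, Nat.cast_mul, mul_assoc] at h1
  have hc : ((p.choose (k + 1) : ℕ) : ℝ≥0∞) ≠ 0 := by
    exact_mod_cast (Nat.choose_pos (by omega)).ne'
  have hc' : ((p.choose (k + 1) : ℕ) : ℝ≥0∞) ≠ ∞ := ENNReal.natCast_ne_top _
  rw [mul_comm ((p.choose (k + 1) : ℕ) : ℝ≥0∞)⁻¹, ← div_eq_mul_inv,
    ENNReal.le_div_iff_mul_le (Or.inl hc) (Or.inl hc')]
  have hk0 : ((k + 1 : ℕ) : ℝ≥0∞) ≠ 0 := by exact_mod_cast Nat.succ_ne_zero k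
  have h2 : ((k + 1 : ℕ) : ℝ≥0∞) * (ε * (p.choose (k + 1) : ℕ)) ≤ ((k + 1 : ℕ) : ℝ≥0∞) *
        ∑ S ∈ Finset.powersetCard (k + 1) (Finset.univ : Finset (Fin p)), e S := by
    refine le_trans (le_of_eq ?_) h1
    ring
  exact (ENNReal.mul_le_mul_iff_right hk0 (ENNReal.natCast_ne_top _)).1 h2

end WorstCase

/-! ### The two information thresholds. -/

section Thresholds

/-- The term -1 in the threshold is a factor b in M ≥ b (1 + v)^(n/2), and b ≥ 2. -/
theorem two_mul_sqrt_pow_le {b M v : ℝ} (hb : 2 ≤ b) (hM : 0 < M) (hv : 0 < v) {n : ℕ}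
    (h : (n : ℝ) ≤ (Real.logb b M - 1) / (1 / 2 * Real.logb b (1 + v))) :
    2 * √(1 + v) ^ n ≤ M := by
  have hb1 : 1 < b := by linarith
  have hlog : 0 < Real.logb b (1 + v) := Real.logb_pos hb1 (by linarith)
  rw [le_div_iff₀ (by positivity)] at h
  have h1 : Real.logb b (b * √(1 + v) ^ n) ≤ Real.logb b M := by
    rw [Real.logb_mul (by positivity) (by positivity), Real.logb_self_eq_one hb1,
      Real.logb_pow, Real.logb, Real.log_sqrt (by positivity), div_right_comm]
    rw [Real.logb] at h ⊢
    rw [Real.logb] at h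
    linarith
  have h2 := (Real.logb_le_logb hb1 (by positivity) hM).1 h1
  refine le_trans ?_ h2
  gcongr

/-- If the number of observations does not exceed one of the two information thresholds, then the
error over the class is bounded below by a universal constant. -/
theorem exists_le_classError_of_le_threshold :
    ∃ ε : ℝ≥0∞, 0 < ε ∧ ∀ (μ : Measure ℝ) [IsProbabilityMeasure μ],
      MemLp (fun x : ℝ => x) 2 μ → ∫ x, x ∂μ = 0 → variance (fun x : ℝ => x) μ = 1 →
      ∀ (b : ℝ) (n p k : ℕ) (βmin : ℝ) (g : Decoder n p), 2 ≤ b → 1 ≤ k → k < p → 0 < βmin →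
        (n : ℝ) ≤ f₁ b p k βmin ∨ (n : ℝ) ≤ f₂ b p k βmin → ε ≤ classError μ k βmin g := by
  obtain ⟨ε, hε, hmain⟩ := exists_le_sum_errorProb
  refine ⟨ε, hε, ?_⟩
  intro μ _ hL2 hmean hvar b n p k βmin g hb hk hkp hβ hn
  have hp0 : (0 : ℝ) < p := by exact_mod_cast (by omega : 0 < p)
  have hkp' : (k : ℝ) < p := by exact_mod_cast hkp
  have hk0 : (0 : ℝ) < k := by exact_mod_cast hk
  refine le_trans ?_ (sum_worstError_le_classError μ hβ g)
  rcases hn with hn | hn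
  · have hchoose : 0 < p.choose k := Nat.choose_pos hkp.le
    have hv : 0 < (k : ℝ) * βmin ^ 2 * (1 - (k : ℝ) / (p : ℝ)) := by
      have : (k : ℝ) / p < 1 := (div_lt_one hp0).2 hkp'
      have : 0 < 1 - (k : ℝ) / p := by linarith
      positivity
    have hM := two_mul_sqrt_pow_le hb (by exact_mod_cast hchoose) hv hn
    have hcard : Fintype.card ↥(Finset.powersetCard k (Finset.univ : Finset (Fin p))) =
        p.choose k := by rw [Fintype.card_coe, Finset.card_powersetCard, Finset.card_fin]
    -- The centre is the average of the flat signals with k nonzero entries, so they all lie at the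
    -- same distance from it.
    have h := hmain μ hL2 hmean hvar n p g
      ↥(Finset.powersetCard k (Finset.univ : Finset (Fin p)))
      (fun S => flatSignal βmin S.1) (fun _ => βmin * (k / p)) _ hv
      (fun S S' hSS => Subtype.ext (by simpa [supp_flatSignal hβ] using hSS)) ?_
      (by rw [hcard]; exact hM)
    · rw [hcard] at h
      rw [mul_comm, ← div_eq_mul_inv, ENNReal.le_div_iff_mul_le
        (Or.inl (by exact_mod_cast hchoose.ne')) (Or.inl (ENNReal.natCast_ne_top _)), mul_comm]
      refine h.trans ?_
      rw [Finset.sum_coe_sort (Finset.powersetCard k Finset.univ)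
        (fun S => errorProb μ g (flatSignal βmin S))]
      exact Finset.sum_le_sum fun S _ =>
        errorProb_le_worstError μ g (supp_flatSignal hβ S) (flatSignal_mem hβ S)
    · rintro ⟨S, hS⟩
      have hSc : S.card = k := (Finset.mem_powersetCard.1 hS).2
      have e1 : ∀ j, (flatSignal βmin S j - βmin * (k / p)) ^ 2 = (βmin * (k / p)) ^ 2 +
          if j ∈ S then βmin ^ 2 * (1 - 2 * (k / p)) else 0 := by
        intro j
        unfold flatSignal
        split_ifs <;> ring
      simp_rw [e1]
      rw [Finset.sum_add_distrib, Finset.sum_ite_mem, Finset.univ_inter]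
      simp only [Finset.sum_const, Finset.card_univ, Fintype.card_fin, hSc, nsmul_eq_mul]
      field_simp
      ring
  · obtain ⟨m, rfl⟩ : ∃ m, k = m + 1 := ⟨k - 1, by omega⟩
    refine le_average_of_le_sum_insert (by omega) _ fun T hT => ?_
    have hq : ((p - m : ℕ) : ℝ) = (p : ℝ) - ((m + 1 : ℕ) : ℝ) + 1 := by
      rw [Nat.cast_sub (by omega)]; push_cast; ring
    have hq2 : (2 : ℝ) ≤ ((p - m : ℕ) : ℝ) := by exact_mod_cast (by omega : 2 ≤ p - m)
    unfold f₂ at hn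
    rw [← hq] at hn
    set q : ℕ := p - m with hqdef
    have hq0 : (0 : ℝ) < q := by linarith
    have hv : 0 < βmin ^ 2 * (1 - 1 / (q : ℝ)) := by
      have : 1 / (q : ℝ) < 1 := (div_lt_one hq0).2 (by linarith)
      have : 0 < 1 - 1 / (q : ℝ) := by linarith
      positivity
    have hM := two_mul_sqrt_pow_le hb hq0 hv hn
    have hTc : Tᶜ.card = q := by rw [Finset.card_compl, Fintype.card_fin, hT]
    have hcard : Fintype.card ↥Tᶜ = q := by
      rw [Fintype.card_coe, hTc]
    -- With T known, only the position of the last spike among q = p - k + 1 indices is unknown; the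
    -- centre is again the average of the family.
    have h := hmain μ hL2 hmean hvar n p g ↥Tᶜ
      (fun j => flatSignal βmin (insert j.1 T))
      (fun i => if i ∈ T then βmin else βmin * (1 / q)) _ hv ?_ ?_
      (by rw [hcard]; exact hM)
    · rw [hcard] at h
      refine h.trans ?_
      rw [Finset.sum_coe_sort Tᶜ (fun j => errorProb μ g (flatSignal βmin (insert j T)))]
      exact Finset.sum_le_sum fun j _ =>
        errorProb_le_worstError μ g (supp_flatSignal hβ _) (flatSignal_mem hβ _)
    · rintro ⟨i, hi⟩ ⟨j, hj⟩ hij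
      simp only [supp_flatSignal hβ] at hij
      rw [Finset.mem_compl] at hi hj
      have : i ∈ insert j T := hij ▸ Finset.mem_insert_self i T
      rcases Finset.mem_insert.1 this with h | h
      · exact Subtype.ext h
      · exact absurd h hi
    · rintro ⟨j, hj⟩
      have hjT : j ∉ T := Finset.mem_compl.1 hj
      have e1 : ∀ i, (flatSignal βmin (insert j T) i -
          if i ∈ T then βmin else βmin * (1 / q)) ^ 2 =
          (if i ∈ Tᶜ then (βmin * (1 / q)) ^ 2 else 0) +
          if i = j then βmin ^ 2 * (1 - 2 * (1 / q)) else 0 := by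
        intro i
        unfold flatSignal
        by_cases hi : i ∈ T
        · have : i ≠ j := fun h => hjT (h ▸ hi)
          simp [hi, this]
        · by_cases hij : i = j
          · subst hij; simp [hi]; ring
          · simp [hi, hij]
      simp_rw [e1]
      rw [Finset.sum_add_distrib, Finset.sum_ite_mem, Finset.univ_inter,
        Finset.sum_ite_eq' Finset.univ j]
      simp only [Finset.sum_const, hTc, nsmul_eq_mul, Finset.mem_univ, if_true]
      field_simp
      ring

end Thresholds

/-! ### Subarrays of i.i.d. arrays. -/

section Arrays

/-- The law of an array of i.i.d. entries of law `μ`, with arbitrary finite index sets. -/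
def arrayLaw (μ : Measure ℝ) (R C : Type*) [Fintype R] [Fintype C] : Measure (R → C → ℝ) :=
  Measure.pi fun _ : R => Measure.pi fun _ : C => μ

variable (μ : Measure ℝ) [IsProbabilityMeasure μ]

instance isProbabilityMeasure_arrayLaw (R C : Type*) [Fintype R] [Fintype C] :
    IsProbabilityMeasure (arrayLaw μ R C) := by
  unfold arrayLaw; infer_instance

theorem measurePreserving_precomp {I I' : Type*} [Fintype I] [Fintype I'] {e : I' → I}
    (he : Function.Injective e) :
    MeasurePreserving (fun (x : I → ℝ) i => x (e i)) (Measure.pi fun _ : I => μ)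
      (Measure.pi fun _ : I' => μ) := by
  refine ⟨by fun_prop, ?_⟩
  have h := (iIndepFun_pi (μ := fun _ : I => μ) (X := fun _ x => x)
    fun _ => aemeasurable_id).precomp he
  rw [iIndepFun_iff_map_fun_eq_pi_map fun i => (measurable_pi_apply _).aemeasurable] at h
  rw [h]
  congr 1
  ext1 i
  exact (measurePreserving_eval (fun _ : I => μ) (e i)).map_eq

theorem measurePreserving_curry (R C : Type*) [Fintype R] [Fintype C] :
    MeasurePreserving (MeasurableEquiv.curry R C ℝ) (Measure.pi fun _ : R × C => μ)
      (arrayLaw μ R C) := by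
  refine ⟨MeasurableEquiv.measurable _, ?_⟩
  have h := Measure.infinitePi_map_curry (fun (_ : R) (_ : C) => μ)
  simp only [Measure.infinitePi_eq_pi] at h
  exact h

/-- Selecting distinct entries of an i.i.d. array gives an i.i.d. array. -/
theorem measurePreserving_entries {R C R' C' : Type*} [Fintype R] [Fintype C] [Fintype R']
    [Fintype C'] {e : R' × C' → R × C} (he : Function.Injective e) :
    MeasurePreserving (fun (X : R → C → ℝ) r c => X (e (r, c)).1 (e (r, c)).2)
      (arrayLaw μ R C) (arrayLaw μ R' C') := by
  have h1 := (measurePreserving_curry μ R C).symm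
  have h2 := measurePreserving_precomp μ he
  exact (measurePreserving_curry μ R' C').comp (h2.comp h1)

end Arrays

/-! ### Measurability of projections of closed sets. -/

section Measurability

theorem isSigmaCompact_measurableSet {Z : Type*} [TopologicalSpace Z] [T2Space Z]
    [MeasurableSpace Z] [BorelSpace Z] {s : Set Z} (hs : IsSigmaCompact s) : MeasurableSet s := by
  obtain ⟨K, hK, rfl⟩ := hs
  exact MeasurableSet.iUnion fun n => (hK n).measurableSet

/-- A closed subset of a σ-compact space is σ-compact, and so is its continuous image. Conditions
such as x ≠ 0 are brought to closed form by an auxiliary variable τ with τ x = 1. -/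
theorem measurableSet_exists_of_isClosed {Z E : Type*} [TopologicalSpace Z] [T2Space Z]
    [MeasurableSpace Z] [BorelSpace Z] [TopologicalSpace E] [SigmaCompactSpace (Z × E)]
    {C : Set (Z × E)} (hC : IsClosed C) : MeasurableSet {z | ∃ x, (z, x) ∈ C} := by
  have h := (isSigmaCompact_univ.of_isClosed_subset hC (Set.subset_univ C)).image continuous_fst
  convert isSigmaCompact_measurableSet h using 1
  ext z
  simp

end Measurability

/-! ### Row spans and supports of kernel vectors. -/

section LinearAlgebra

variable {R C : Type*} [Fintype R] [Fintype C]

/-- The row vector `c` is a linear combination of the rows of `A`. -/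
def InRowSpan (A : R → C → ℝ) (c : C → ℝ) : Prop := ∃ y : R → ℝ, ∀ j, ∑ i, y i * A i j = c j

/-- The vector `κ` is orthogonal to the rows of `A`. -/
def InKer (A : R → C → ℝ) (κ : C → ℝ) : Prop := ∀ i, ∑ j, A i j * κ j = 0

/-- The coordinates on which some vector orthogonal to the rows of `A` does not vanish. -/
def kerSupport (A : R → C → ℝ) : Finset C :=
  open scoped Classical in Finset.univ.filter fun j => ∃ κ, InKer A κ ∧ κ j ≠ 0

/-- The set of nonzero coordinates. -/
def nonzeros (κ : C → ℝ) : Finset C :=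
  open scoped Classical in Finset.univ.filter fun j => κ j ≠ 0

theorem mem_nonzeros {κ : C → ℝ} {j : C} : j ∈ nonzeros κ ↔ κ j ≠ 0 := by
  simp [nonzeros]

theorem mem_kerSupport {A : R → C → ℝ} {j : C} :
    j ∈ kerSupport A ↔ ∃ κ, InKer A κ ∧ κ j ≠ 0 := by
  simp [kerSupport]

theorem inRowSpan_of_forall_inKer {A : R → C → ℝ} {c : C → ℝ}
    (h : ∀ κ, InKer A κ → ∑ j, c j * κ j = 0) : InRowSpan A c := by
  classical
  let L : (C → ℝ) → ((C → ℝ) →ₗ[ℝ] ℝ) := fun a => Fintype.linearCombination ℝ a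
  have hL : ∀ a κ, L a κ = ∑ j, a j * κ j := by
    intro a κ
    simp [L, Fintype.linearCombination_apply, mul_comm]
  have hmem : L c ∈ Submodule.span ℝ (Set.range fun i => L (A i)) := by
    apply mem_span_of_iInf_ker_le_ker
    intro κ hκ
    simp only [Submodule.mem_iInf, LinearMap.mem_ker, hL] at hκ ⊢
    exact h κ hκ
  rw [Submodule.mem_span_range_iff_exists_fun] at hmem
  obtain ⟨y, hy⟩ := hmem
  refine ⟨y, fun j => ?_⟩
  have := congrArg (fun f => f (Pi.single j 1)) hy
  simpa [hL, Pi.single_apply] using this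

/-- A generic kernel vector has the largest support: take one with the most nonzero entries, and if
a coordinate were missing, add a multiple of another kernel vector. -/
theorem exists_inKer_nonzeros_eq (A : R → C → ℝ) :
    ∃ κ, InKer A κ ∧ nonzeros κ = kerSupport A := by
  classical
  have hsub : ∀ κ, InKer A κ → nonzeros κ ⊆ kerSupport A := fun κ hκ j hj =>
    mem_kerSupport.2 ⟨κ, hκ, mem_nonzeros.1 hj⟩
  obtain ⟨κ, hκ, hmax⟩ : ∃ κ, InKer A κ ∧ ∀ κ', InKer A κ' →
      (nonzeros κ').card ≤ (nonzeros κ).card := by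
    have hne : (Set.range fun κ : {κ // InKer A κ} => (nonzeros κ.1).card).Nonempty :=
      ⟨_, ⟨0, fun i => by simp⟩, rfl⟩
    have hfin : BddAbove (Set.range fun κ : {κ // InKer A κ} => (nonzeros κ.1).card) :=
      ⟨Fintype.card C, by rintro _ ⟨κ, rfl⟩; exact Finset.card_le_univ _⟩
    obtain ⟨⟨κ, hκ⟩, h⟩ := Nat.sSup_mem hne hfin
    exact ⟨κ, hκ, fun κ' hκ' => (le_csSup hfin ⟨⟨κ', hκ'⟩, rfl⟩).trans (le_of_eq h.symm)⟩
  refine ⟨κ, hκ, (hsub κ hκ).antisymm fun j hj => ?_⟩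
  by_contra hjn
  obtain ⟨κ', hκ', hj'⟩ := mem_kerSupport.1 hj
  -- The multiple avoids 0 and the finitely many values that would cancel an existing nonzero entry.
  obtain ⟨t, ht⟩ := Infinite.exists_notMem_finset
    (insert 0 (Finset.univ.image fun i => -κ i / κ' i))
  simp only [Finset.mem_insert, Finset.mem_image, Finset.mem_univ, true_and, not_or,
    not_exists] at ht
  have hk : InKer A (κ + t • κ') := by
    intro i
    have h1 := hκ i
    have h2 := hκ' i
    simp only [Pi.add_apply, Pi.smul_apply, smul_eq_mul, mul_add, Finset.sum_add_distrib, h1]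
    have : ∀ j, A i j * (t * κ' j) = t * (A i j * κ' j) := fun j => by ring
    simp_rw [this, ← Finset.mul_sum, h2]
    simp
  have hss : insert j (nonzeros κ) ⊆ nonzeros (κ + t • κ') := by
    intro i hi
    rw [mem_nonzeros]
    simp only [Pi.add_apply, Pi.smul_apply, smul_eq_mul]
    rcases Finset.mem_insert.1 hi with rfl | hi
    · have : κ i = 0 := by simpa [mem_nonzeros] using hjn
      rw [this, zero_add]
      exact mul_ne_zero ht.1 hj'
    · rw [mem_nonzeros] at hi
      intro h0
      by_cases hz : κ' i = 0
      · rw [hz, mul_zero, add_zero] at h0; exact hi h0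
      · exact ht.2 i (by field_simp; linarith)
  have h1 := Finset.card_le_card hss
  rw [Finset.card_insert_of_notMem hjn] at h1
  have := hmax _ hk
  omega

/-- On vectors supported in `U`, orthogonality to all the rows follows from orthogonality to some
`#U` of them. -/
theorem exists_small_rows (A : R → C → ℝ) (U : Finset C) :
    ∃ I : Finset R, I.card ≤ U.card ∧ ∀ κ : C → ℝ, nonzeros κ ⊆ U →
      (∀ i ∈ I, ∑ j, A i j * κ j = 0) → InKer A κ := by
  classical
  obtain ⟨K, a, ha, hspan, hli⟩ := exists_linearIndependent' ℝ fun i (j : U) => A i j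
  have : Fintype K := Fintype.ofInjective a ha
  refine ⟨Finset.univ.image a, ?_, fun κ hκ h i => ?_⟩
  · refine Finset.card_image_le.trans ?_
    have := hli.fintype_card_le_finrank
    simpa using this
  · have hred : ∀ i, ∑ j, A i j * κ j = ∑ j : U, A i j * κ j := by
      intro i
      rw [Finset.sum_coe_sort U (fun j => A i j * κ j)]
      symm
      refine Finset.sum_subset (Finset.subset_univ _) fun j _ hj => ?_
      have : κ j = 0 := by
        by_contra h0
        exact hj (hκ (mem_nonzeros.2 h0))
      rw [this, mul_zero]
    rw [hred]
    have hmem : (fun j : U => A i j) ∈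
        Submodule.span ℝ (Set.range ((fun i (j : U) => A i j) ∘ a)) :=
      hspan ▸ Submodule.subset_span ⟨i, rfl⟩
    suffices key : ∀ x ∈ Submodule.span ℝ (Set.range ((fun i (j : U) => A i j) ∘ a)),
        ∑ j : U, x j * κ j = 0 from key _ hmem
    intro x hx
    induction hx using Submodule.span_induction with
    | mem x hx =>
      obtain ⟨k, rfl⟩ := hx
      have := h (a k) (Finset.mem_image_of_mem a (Finset.mem_univ k))
      rw [hred] at this
      exact this
    | zero => simp
    | add x y _ _ hx hy =>
      simp only [Pi.add_apply, add_mul, Finset.sum_add_distrib, hx, hy, add_zero]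
    | smul t x _ hx =>
      simp only [Pi.smul_apply, smul_eq_mul, mul_assoc, ← Finset.mul_sum, hx, mul_zero]

end LinearAlgebra

/-! ### Counting small subsets. -/

section Counting

/-- Chernoff's method: weighting each subset by (1/50) to its size gives total mass (51/50)^|C|, and
each counted subset weighs at least (1/50)^t. -/
theorem card_small_subsets_le (C : Type*) [Fintype C] [DecidableEq C] (t : ℕ) :
    (((Finset.univ : Finset (Finset C)).filter fun U => U.card ≤ t).card : ℝ) ≤
      (51 / 50) ^ Fintype.card C * 50 ^ t := by
  have h := Fintype.sum_pow_mul_eq_add_pow C (1 / 50 : ℝ) 1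
  have h1 : (((Finset.univ : Finset (Finset C)).filter fun U => U.card ≤ t).card : ℝ) *
      (1 / 50) ^ t ≤ (51 / 50) ^ Fintype.card C := by
    calc _ = ∑ U ∈ (Finset.univ : Finset (Finset C)).filter (fun U => U.card ≤ t),
          (1 / 50 : ℝ) ^ t := by rw [Finset.sum_const, nsmul_eq_mul]
      _ ≤ ∑ U ∈ (Finset.univ : Finset (Finset C)).filter (fun U => U.card ≤ t),
          (1 / 50 : ℝ) ^ U.card := Finset.sum_le_sum fun U hU =>
            pow_le_pow_of_le_one (by norm_num) (by norm_num) (Finset.mem_filter.1 hU).2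
      _ ≤ ∑ U : Finset C, (1 / 50 : ℝ) ^ U.card :=
          Finset.sum_le_sum_of_subset_of_nonneg (Finset.filter_subset _ _)
            fun _ _ _ => by positivity
      _ = _ := by simp only [one_pow, mul_one] at h; rw [h]; norm_num
  rw [one_div, inv_pow, ← div_eq_mul_inv, div_le_iff₀ (by positivity)] at h1
  exact h1

end Counting

/-! ### Atoms of linear forms in i.i.d. variables. -/

section SmallBall

variable (μ : Measure ℝ) [IsProbabilityMeasure μ]

/-- A linear form in i.i.d. variables whose atoms have mass at most `1 - ε` has atoms whose mass
decreases to `1 / 2` with the number of nonzero coefficients. -/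
theorem measureReal_linearForm_eq_le {ε : ℝ} (hε : ε ≤ 1 / 2)
    (hatom : ∀ a, μ.real {a} ≤ 1 - ε) (m : ℕ) : ∀ (κ : Fin m → ℝ) (x : ℝ),
      (Measure.pi fun _ : Fin m => μ).real {c | ∑ j, c j * κ j = x} ≤
        1 / 2 + (1 - 2 * ε) ^ (∑ j, if κ j ≠ 0 then 1 else 0) / 2 := by
  induction m with
  | zero =>
    intro κ x
    refine measureReal_le_one.trans ?_
    simp; norm_num
  | succ m ih =>
    intro κ x
    set P := Measure.pi fun _ : Fin m => μ with hP
    set q : ℝ → ℝ := fun y => P.real {c | ∑ j, c j * κ j.succ = y} with hq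
    set s := ∑ j : Fin m, if κ j.succ ≠ 0 then 1 else 0 with hs
    have hqb : ∀ y, q y ≤ 1 / 2 + (1 - 2 * ε) ^ s / 2 := fun y => ih (fun j => κ j.succ) y
    have hr0 : 0 ≤ 1 - 2 * ε := by linarith
    have hmeas : ∀ y, MeasurableSet {c : Fin m → ℝ | ∑ j, c j * κ j.succ = y} := fun y =>
      measurableSet_eq_fun (by fun_prop) measurable_const
    have hqm : Measurable fun t => P {c | ∑ j, c j * κ j.succ = x - t * κ 0} := by
      have hset : MeasurableSet {z : ℝ × (Fin m → ℝ) | ∑ j, z.2 j * κ j.succ = x - z.1 * κ 0} :=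
        measurableSet_eq_fun (by fun_prop) (by fun_prop)
      exact measurable_measure_prodMk_left hset
    have hfub : (Measure.pi fun _ : Fin (m + 1) => μ) {c | ∑ j, c j * κ j = x} =
        ∫⁻ t, P {c | ∑ j, c j * κ j.succ = x - t * κ 0} ∂μ := by
      have hset : MeasurableSet {c : Fin (m + 1) → ℝ | ∑ j, c j * κ j = x} :=
        measurableSet_eq_fun (by fun_prop) measurable_const
      rw [← (measurePreserving_cons μ m).measure_preimage hset.nullMeasurableSet,
        Measure.prod_apply ((measurePreserving_cons μ m).measurable hset)]
      refine lintegral_congr fun t => ?_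
      congr 1
      ext c
      simp only [Set.mem_preimage, Set.mem_ofPred_eq, Fin.sum_univ_succ, Fin.cons_zero,
        Fin.cons_succ]
      constructor <;> intro h <;> linarith
    have hreal : (Measure.pi fun _ : Fin (m + 1) => μ).real {c | ∑ j, c j * κ j = x} =
        ∫ t, q (x - t * κ 0) ∂μ := by
      rw [Measure.real, hfub, integral_eq_lintegral_of_nonneg_ae
          (ae_of_all _ fun t => by positivity)]
      · congr 1
        refine lintegral_congr fun t => ?_
        simp [q, Measure.real]
      · exact hqm.ennreal_toReal.aestronglyMeasurable
    have hqi : Integrable (fun t => q (x - t * κ 0)) μ := by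
      refine Integrable.of_bound (C := 1) hqm.ennreal_toReal.aestronglyMeasurable
        (ae_of_all _ fun t => ?_)
      rw [Real.norm_of_nonneg (by positivity)]
      exact measureReal_le_one
    rw [hreal, Fin.sum_univ_succ, ← hs]
    by_cases h0 : κ 0 = 0
    · simp only [h0, mul_zero, sub_zero, integral_const, probReal_univ, one_smul]
      simpa using hqb x
    · simp only [ne_eq, h0, not_false_eq_true, if_true]
      -- A bound of 1/2 survives adding an independent term. Otherwise one value y₀ has mass q > 1/2
      -- and every other has mass at most 1 - q, so the new mass is at most (1 - q) + (1 - ε)(2q -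
      -- 1) = (1 - 2ε)q + ε, which contracts the excess over 1/2 by 1 - 2ε.
      by_cases hhalf : ∀ y, q y ≤ 1 / 2
      · calc _ ≤ ∫ _, (1 / 2 : ℝ) ∂μ := integral_mono hqi (integrable_const _) fun t => hhalf _
          _ = 1 / 2 := by simp
          _ ≤ _ := by have : 0 ≤ (1 - 2 * ε) ^ (1 + s) := by positivity
                      linarith
      · push Not at hhalf
        obtain ⟨y₀, hy₀⟩ := hhalf
        have hother : ∀ y, y ≠ y₀ → q y ≤ 1 - q y₀ := by
          intro y hy
          have hdis : Disjoint {c : Fin m → ℝ | ∑ j, c j * κ j.succ = y}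
              {c : Fin m → ℝ | ∑ j, c j * κ j.succ = y₀} :=
            Set.disjoint_left.2 fun c (h1 : _ = y) (h2 : _ = y₀) => hy (h1.symm.trans h2)
          have h1 := measureReal_union (μ := P) hdis (hmeas y₀)
          have h2 := measureReal_le_one (μ := P)
            (s := {c : Fin m → ℝ | ∑ j, c j * κ j.succ = y} ∪
              {c : Fin m → ℝ | ∑ j, c j * κ j.succ = y₀})
          rw [h1] at h2
          simp only [hq]
          linarith
        set t₀ := (x - y₀) / κ 0 with ht₀
        have hpt : ∀ t, q (x - t * κ 0) ≤
            (1 - q y₀) + ({t₀} : Set ℝ).indicator (fun _ => 2 * q y₀ - 1) t := by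
          intro t
          by_cases ht : t = t₀
          · have : x - t * κ 0 = y₀ := by rw [ht, ht₀]; field_simp; ring
            rw [Set.indicator_of_mem (by simpa using ht), this]
            linarith
          · rw [Set.indicator_of_notMem (by simpa using ht), add_zero]
            refine hother _ fun h => ht ?_
            rw [ht₀, eq_div_iff h0]; linarith
        have h1 : ∫ t, q (x - t * κ 0) ∂μ ≤ (1 - q y₀) + μ.real {t₀} * (2 * q y₀ - 1) := by
          refine (integral_mono hqi ((integrable_const _).add
            ((integrable_const _).indicator (measurableSet_singleton t₀))) hpt).trans (le_of_eq ?_)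
          simp only [Pi.add_apply]
          rw [integral_add (integrable_const _)
            ((integrable_const _).indicator (measurableSet_singleton t₀)),
            integral_indicator_const _ (measurableSet_singleton t₀)]
          simp
        have h2 := mul_le_mul_of_nonneg_right (hatom t₀) (by linarith : 0 ≤ 2 * q y₀ - 1)
        have h3 := mul_le_mul_of_nonneg_right (hqb y₀) hr0
        rw [add_comm 1 s, pow_succ]
        linarith

theorem measure_linearForm_eq_zero_le {ε : ℝ} (hε0 : 0 ≤ ε) (hε : ε ≤ 1 / 2)
    (hatom : ∀ a, μ.real {a} ≤ 1 - ε) {s m : ℕ} (hs : (1 - 2 * ε) ^ s ≤ 1 / 2) (κ : Fin m → ℝ)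
    (hκ : s ≤ (nonzeros κ).card) :
    (Measure.pi fun _ : Fin m => μ) {c | ∑ j, c j * κ j = 0} ≤ ENNReal.ofReal (3 / 4) := by
  have h := measureReal_linearForm_eq_le μ hε hatom m κ 0
  have hcard : (nonzeros κ).card = ∑ j, if κ j ≠ 0 then 1 else 0 := by
    rw [nonzeros, Finset.card_filter]
  rw [← hcard] at h
  have h2 : (1 - 2 * ε) ^ (nonzeros κ).card ≤ (1 - 2 * ε) ^ s :=
    pow_le_pow_of_le_one (by linarith) (by linarith) hκ
  rw [← ENNReal.ofReal_toReal (measure_ne_top (Measure.pi fun _ : Fin m => μ) _)]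
  exact ENNReal.ofReal_le_ofReal (by rw [Measure.real] at h; linarith)

end SmallBall

/-! ### Random arrays rarely have kernel vectors of moderate support. -/

section KernelVectors

variable (μ : Measure ℝ) [IsProbabilityMeasure μ]

theorem measurableSet_exists_nonzeros_eq {n m : ℕ} (U : Finset (Fin m)) (I : Finset (Fin n)) :
    MeasurableSet {A : Fin n → Fin m → ℝ |
      ∃ κ, nonzeros κ = U ∧ ∀ i ∈ I, ∑ j, A i j * κ j = 0} := by
  have hC : IsClosed {q : (Fin n → Fin m → ℝ) × ((Fin m → ℝ) × (Fin m → ℝ)) |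
      ((∀ j ∈ U, q.2.2 j * q.2.1 j = 1) ∧ ∀ j ∈ Uᶜ, q.2.1 j = 0) ∧
        ∀ i ∈ I, ∑ j, q.1 i j * q.2.1 j = 0} := by
    simp only [Set.ofPred_and, Set.ofPred_forall]
    refine ((isClosed_biInter fun j _ => ?_).inter (isClosed_biInter fun j _ => ?_)).inter
      (isClosed_biInter fun i _ => ?_)
    all_goals exact isClosed_eq (by fun_prop) (by fun_prop)
  convert measurableSet_exists_of_isClosed hC using 1
  ext A
  simp only [Set.mem_ofPred_eq, Prod.exists]
  constructor
  · rintro ⟨κ, hU, hI⟩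
    refine ⟨κ, fun j => (κ j)⁻¹, ⟨fun j hj => ?_, fun j hj => ?_⟩, hI⟩
    · exact inv_mul_cancel₀ (mem_nonzeros.1 (hU ▸ hj))
    · by_contra h
      exact Finset.mem_compl.1 hj (hU ▸ mem_nonzeros.2 h)
  · rintro ⟨κ, τ, ⟨h1, h2⟩, hI⟩
    refine ⟨κ, ?_, hI⟩
    ext j
    rw [mem_nonzeros]
    constructor
    · intro h
      by_contra hj
      exact h (h2 j (Finset.mem_compl.2 hj))
    · intro hj h0
      have := h1 j hj
      rw [h0, mul_zero] at this
      exact zero_ne_one this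

theorem measurableSet_forall_inKer {n m : ℕ} (U : Finset (Fin m)) (I : Finset (Fin n)) :
    MeasurableSet {A : Fin n → Fin m → ℝ |
      ∀ κ, nonzeros κ ⊆ U → (∀ i ∈ I, ∑ j, A i j * κ j = 0) → InKer A κ} := by
  have hC : IsClosed {q : (Fin n → Fin m → ℝ) × ((Fin m → ℝ) × (Fin n → ℝ)) |
      ((∀ j ∈ Uᶜ, q.2.1 j = 0) ∧ ∀ i ∈ I, ∑ j, q.1 i j * q.2.1 j = 0) ∧
        ∑ i, q.2.2 i * ∑ j, q.1 i j * q.2.1 j = 1} := by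
    simp only [Set.ofPred_and, Set.ofPred_forall]
    refine ((isClosed_biInter fun j _ => ?_).inter (isClosed_biInter fun i _ => ?_)).inter ?_
    all_goals exact isClosed_eq (by fun_prop) (by fun_prop)
  refine MeasurableSet.of_compl ?_
  convert measurableSet_exists_of_isClosed hC using 1
  ext A
  simp only [Set.mem_compl_iff, Set.mem_ofPred_eq, Prod.exists]
  constructor
  · intro h
    push Not at h
    obtain ⟨κ, hU, hI, hker⟩ := h
    unfold InKer at hker
    push Not at hker
    obtain ⟨i, hi⟩ := hker
    refine ⟨κ, Pi.single i (∑ j, A i j * κ j)⁻¹, ⟨fun j hj => ?_, hI⟩, ?_⟩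
    · by_contra h
      exact Finset.mem_compl.1 hj (hU (mem_nonzeros.2 h))
    · rw [Finset.sum_eq_single i (fun i' _ h => by simp [h]) (by simp)]
      simp [inv_mul_cancel₀ hi]
  · rintro ⟨κ, τ, ⟨h1, h2⟩, h3⟩ h
    have hker := h κ (fun j hj => by
      by_contra hn
      exact mem_nonzeros.1 hj (h1 j (Finset.mem_compl.2 hn))) h2
    rw [Finset.sum_eq_zero fun i _ => by rw [hker i, mul_zero]] at h3
    exact zero_ne_one h3

/-- Condition on the rows in I. They fix one vector κ with support U, which the second event forces
to be orthogonal to the other n - |I| rows; these are independent of κ. -/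
theorem measure_kernel_pair_le {n m : ℕ} (U : Finset (Fin m)) (I : Finset (Fin n)) {η : ℝ≥0∞}
    (hη : ∀ κ : Fin m → ℝ, nonzeros κ = U →
      (Measure.pi fun _ : Fin m => μ) {c | ∑ j, c j * κ j = 0} ≤ η) :
    arrayLaw μ (Fin n) (Fin m) ({A | ∃ κ, nonzeros κ = U ∧ ∀ i ∈ I, ∑ j, A i j * κ j = 0} ∩
      {A | ∀ κ, nonzeros κ ⊆ U → (∀ i ∈ I, ∑ j, A i j * κ j = 0) → InKer A κ}) ≤
      η ^ (n - I.card) := by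
  classical
  set S := {A : Fin n → Fin m → ℝ | ∃ κ, nonzeros κ = U ∧ ∀ i ∈ I, ∑ j, A i j * κ j = 0} ∩
      {A | ∀ κ, nonzeros κ ⊆ U → (∀ i ∈ I, ∑ j, A i j * κ j = 0) → InKer A κ} with hS
  have hSm : MeasurableSet S :=
    (measurableSet_exists_nonzeros_eq U I).inter (measurableSet_forall_inKer U I)
  have hmp := (measurePreserving_piEquivPiSubtypeProd
    (fun _ : Fin n => Measure.pi fun _ : Fin m => μ) (fun i => i ∈ I)).symm
  set e := MeasurableEquiv.piEquivPiSubtypeProd (fun _ : Fin n => Fin m → ℝ) (fun i => i ∈ I)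
    with he
  have hsymm : ∀ q i, e.symm q i = if h : i ∈ I then q.1 ⟨i, h⟩ else q.2 ⟨i, h⟩ :=
    fun q i => rfl
  unfold arrayLaw
  rw [← hmp.measure_preimage hSm.nullMeasurableSet, Measure.prod_apply (hmp.measurable hSm)]
  have hsec : ∀ x, (Measure.pi fun _ : {i // i ∉ I} => Measure.pi fun _ : Fin m => μ)
      (Prod.mk x ⁻¹' (e.symm ⁻¹' S)) ≤ η ^ (n - I.card) := by
    intro x
    rcases (Prod.mk x ⁻¹' (e.symm ⁻¹' S)).eq_empty_or_nonempty with hemp | ⟨y₀, hy₀⟩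
    · rw [hemp]; simp
    -- κ is taken from a single point of the section, yet serves the whole section, since the
    -- condition defining it involves only the rows in I.
    obtain ⟨κ, hκU, hκI⟩ := hy₀.1
    have hsub : Prod.mk x ⁻¹' (e.symm ⁻¹' S) ⊆
        Set.univ.pi fun _ : {i // i ∉ I} => {c : Fin m → ℝ | ∑ j, c j * κ j = 0} := by
      intro y hy i _
      have h1 : ∀ i ∈ I, ∑ j, e.symm (x, y) i j * κ j = 0 := by
        intro i hi
        have := hκI i hi
        simp only [hsymm, hi, dif_pos] at this ⊢
        exact this
      have h2 := hy.2 κ hκU.subset h1 i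
      simp only [hsymm, i.2, dif_neg, not_false_eq_true] at h2
      exact h2
    refine (measure_mono hsub).trans ?_
    rw [Measure.pi_pi]
    refine (Finset.prod_le_prod' fun i _ => hη κ hκU).trans (le_of_eq ?_)
    rw [Finset.prod_const, Finset.card_univ, Fintype.card_subtype_compl, Fintype.card_fin]
    simp
  refine (lintegral_mono hsec).trans ?_
  simp

/-- With high probability a random array with about as many rows as columns has no kernel
vector whose number of nonzero entries is between `s` and `t`. -/
theorem measure_exists_inKer_le {n m s t : ℕ} {η : ℝ} (hη0 : 0 ≤ η) (hη1 : η ≤ 1)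
    (hη : ∀ κ : Fin m → ℝ, s ≤ (nonzeros κ).card →
      (Measure.pi fun _ : Fin m => μ) {c | ∑ j, c j * κ j = 0} ≤ ENNReal.ofReal η) :
    arrayLaw μ (Fin n) (Fin m)
      {A | ∃ κ, InKer A κ ∧ s ≤ (nonzeros κ).card ∧ (nonzeros κ).card ≤ t} ≤
      ENNReal.ofReal (((51 / 50) ^ m * 50 ^ t) * ((51 / 50) ^ n * 50 ^ t) * η ^ (n - t)) := by
  classical
  set 𝒰 := (Finset.univ : Finset (Finset (Fin m))).filter fun U => U.card ≤ t with h𝒰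
  set ℐ := (Finset.univ : Finset (Finset (Fin n))).filter fun I => I.card ≤ t with hℐ
  let G : Finset (Fin m) × Finset (Fin n) → Set (Fin n → Fin m → ℝ) := fun q =>
    if s ≤ q.1.card then
      {A | ∃ κ, nonzeros κ = q.1 ∧ ∀ i ∈ q.2, ∑ j, A i j * κ j = 0} ∩
      {A | ∀ κ, nonzeros κ ⊆ q.1 → (∀ i ∈ q.2, ∑ j, A i j * κ j = 0) → InKer A κ}
    else ∅
  have hcover : {A : Fin n → Fin m → ℝ |
      ∃ κ, InKer A κ ∧ s ≤ (nonzeros κ).card ∧ (nonzeros κ).card ≤ t} ⊆ ⋃ q ∈ 𝒰 ×ˢ ℐ, G q := by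
    rintro A ⟨κ, hκ, hs, ht⟩
    obtain ⟨I, hI, hall⟩ := exists_small_rows A (nonzeros κ)
    refine Set.mem_biUnion (x := (nonzeros κ, I)) ?_ ?_
    · simp [h𝒰, hℐ, ht, hI.trans ht]
    · simp only [G, hs, if_true]
      exact ⟨⟨κ, rfl, fun i _ => hκ i⟩, hall⟩
  have hG : ∀ q ∈ 𝒰 ×ˢ ℐ, arrayLaw μ (Fin n) (Fin m) (G q) ≤ ENNReal.ofReal (η ^ (n - t)) := by
    rintro ⟨U, I⟩ hq
    have hIt : I.card ≤ t := by
      simp only [h𝒰, hℐ, Finset.mem_product, Finset.mem_filter] at hq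
      exact hq.2.2
    by_cases hs : s ≤ U.card
    · simp only [G, hs, if_true]
      refine (measure_kernel_pair_le μ U I fun κ hκ => hη κ (hκ ▸ hs)).trans ?_
      rw [← ENNReal.ofReal_pow hη0]
      exact ENNReal.ofReal_le_ofReal (pow_le_pow_of_le_one hη0 hη1 (by omega))
    · simp [G, hs]
  calc _ ≤ ∑ q ∈ 𝒰 ×ˢ ℐ, arrayLaw μ (Fin n) (Fin m) (G q) :=
        (measure_mono hcover).trans (measure_biUnion_finset_le _ _)
    _ ≤ ∑ q ∈ 𝒰 ×ˢ ℐ, ENNReal.ofReal (η ^ (n - t)) := Finset.sum_le_sum hG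
    _ = ENNReal.ofReal ((𝒰.card * ℐ.card) * η ^ (n - t)) := by
        rw [Finset.sum_const, Finset.card_product, nsmul_eq_mul, ENNReal.ofReal_mul (by positivity),
          ← Nat.cast_mul, ENNReal.ofReal_natCast]
    _ ≤ _ := by
        have h1 := card_small_subsets_le (Fin m) t
        have h2 := card_small_subsets_le (Fin n) t
        rw [Fintype.card_fin] at h1 h2
        refine ENNReal.ofReal_le_ofReal ?_
        gcongr

theorem measure_const_on_eq {m : ℕ} (a : ℝ) (U : Finset (Fin m)) :
    (Measure.pi fun _ : Fin m => μ) {c | ∀ j ∈ U, c j = a} = μ {a} ^ U.card := by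
  classical
  have h : {c : Fin m → ℝ | ∀ j ∈ U, c j = a} =
      Set.univ.pi fun j => if j ∈ U then {a} else Set.univ := by
    ext c
    simp only [Set.mem_ofPred_eq, Set.mem_univ_pi]
    refine forall_congr' fun j => ?_
    split_ifs with hj <;> simp [hj]
  rw [h, Measure.pi_pi]
  have h2 : ∀ j : Fin m, μ (if j ∈ U then {a} else Set.univ) = if j ∈ U then μ {a} else 1 := by
    intro j; split_ifs <;> simp
  simp_rw [h2]
  rw [Finset.prod_ite_mem, Finset.univ_inter, Finset.prod_const]

/-- With high probability, for every small set of columns some row is constant, equal to a given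
value, on these columns. -/
theorem measure_exists_no_const_row_le {n m s t : ℕ} {a : ℝ} (hst : s ≤ t)
    (h : ∀ U : Finset (Fin m), U.card < s → 1 / 2 ≤ μ {a} ^ U.card) :
    arrayLaw μ (Fin n) (Fin m)
      {A | ∃ U : Finset (Fin m), U.card < s ∧ ∀ i, ¬ ∀ j ∈ U, A i j = a} ≤
      ENNReal.ofReal (((51 / 50) ^ m * 50 ^ t) * (1 / 2) ^ n) := by
  classical
  set 𝒰 := (Finset.univ : Finset (Finset (Fin m))).filter fun U => U.card ≤ t with h𝒰
  let G : Finset (Fin m) → Set (Fin n → Fin m → ℝ) := fun U =>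
    if U.card < s then Set.univ.pi fun _ => {c | ∀ j ∈ U, c j = a}ᶜ else ∅
  have hcover : {A : Fin n → Fin m → ℝ |
      ∃ U : Finset (Fin m), U.card < s ∧ ∀ i, ¬ ∀ j ∈ U, A i j = a} ⊆ ⋃ U ∈ 𝒰, G U := by
    rintro A ⟨U, hU, hA⟩
    refine Set.mem_biUnion (x := U) (by simp [h𝒰]; omega) ?_
    simp only [G, hU, if_true]
    exact fun i _ => hA i
  have hG : ∀ U ∈ 𝒰, arrayLaw μ (Fin n) (Fin m) (G U) ≤ ENNReal.ofReal ((1 / 2) ^ n) := by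
    intro U _
    by_cases hU : U.card < s
    · simp only [G, hU, if_true]
      unfold arrayLaw
      have hms : MeasurableSet {c : Fin m → ℝ | ∀ j ∈ U, c j = a} := by
        simp only [Set.ofPred_forall]
        exact Finset.measurableSet_biInter _ fun j _ =>
          measurableSet_eq_fun (by fun_prop) measurable_const
      rw [Measure.pi_pi, Finset.prod_const, Finset.card_univ, Fintype.card_fin,
        prob_compl_eq_one_sub hms, measure_const_on_eq, ENNReal.ofReal_pow (by norm_num)]
      gcongr
      have h2 : ENNReal.ofReal (1 / 2) = 1 / 2 := by
        rw [ENNReal.ofReal_div_of_pos (by norm_num)]; simp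
      rw [h2]
      refine tsub_le_iff_right.2 ?_
      calc (1 : ℝ≥0∞) = 1 / 2 + 1 / 2 := (ENNReal.add_halves 1).symm
        _ ≤ _ := by gcongr; exact h U hU
    · simp [G, hU]
  calc _ ≤ ∑ U ∈ 𝒰, arrayLaw μ (Fin n) (Fin m) (G U) :=
        (measure_mono hcover).trans (measure_biUnion_finset_le _ _)
    _ ≤ ∑ U ∈ 𝒰, ENNReal.ofReal ((1 / 2) ^ n) := Finset.sum_le_sum hG
    _ = ENNReal.ofReal (𝒰.card * (1 / 2) ^ n) := by
        rw [Finset.sum_const, nsmul_eq_mul, ENNReal.ofReal_mul (by positivity),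
          ENNReal.ofReal_natCast]
    _ ≤ _ := by
        have h1 := card_small_subsets_le (Fin m) t
        rw [Fintype.card_fin] at h1
        refine ENNReal.ofReal_le_ofReal ?_
        gcongr

end KernelVectors

/-! ### Probability that a random vector lies in the span of n others. -/

section Span

variable (μ : Measure ℝ) [IsProbabilityMeasure μ]

/-- The probability that a random vector is a linear combination of the rows of an independent
random square array. -/
def spanProb (n : ℕ) : ℝ≥0∞ :=
  ((arrayLaw μ (Fin n) (Fin n)).prod (Measure.pi fun _ : Fin n => μ)) {q | InRowSpan q.1 q.2}

theorem measurableSet_inRowSpan (n m : ℕ) :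
    MeasurableSet {q : (Fin n → Fin m → ℝ) × (Fin m → ℝ) | InRowSpan q.1 q.2} := by
  have hC : IsClosed {z : ((Fin n → Fin m → ℝ) × (Fin m → ℝ)) × (Fin n → ℝ) |
      ∀ j, ∑ i, z.2 i * z.1.1 i j = z.1.2 j} := by
    simp only [Set.ofPred_forall]
    exact isClosed_iInter fun j => isClosed_eq (by fun_prop) (by fun_prop)
  exact measurableSet_exists_of_isClosed hC

theorem spanProb_le_one (n : ℕ) : spanProb μ n ≤ 1 := prob_le_one

/-- Dropping the last column preserves linear relations between rows. -/
theorem measure_inRowSpan_succ_le (n : ℕ) :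
    ((arrayLaw μ (Fin n) (Fin (n + 1))).prod (Measure.pi fun _ : Fin (n + 1) => μ))
      {q | InRowSpan q.1 q.2} ≤ spanProb μ n := by
  have h1 := measurePreserving_entries μ (R := Fin n) (C := Fin (n + 1)) (R' := Fin n)
    (C' := Fin n) (e := fun x => (x.1, x.2.castSucc)) (by
      rintro ⟨a, b⟩ ⟨c, d⟩ h
      simpa using h)
  have h2 := measurePreserving_precomp μ (Fin.castSucc_injective n)
  have h := h1.prod h2
  unfold spanProb
  rw [← h.measure_preimage (measurableSet_inRowSpan n n).nullMeasurableSet]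
  refine measure_mono ?_
  rintro ⟨B, c⟩ ⟨y, hy⟩
  exact ⟨y, fun j => hy j.castSucc⟩

theorem measurableSet_mem_kerSupport {n m : ℕ} (j : Fin m) :
    MeasurableSet {B : Fin n → Fin m → ℝ | j ∈ kerSupport B} := by
  have hC : IsClosed {z : (Fin n → Fin m → ℝ) × ((Fin m → ℝ) × ℝ) |
      (∀ i, ∑ l, z.1 i l * z.2.1 l = 0) ∧ z.2.2 * z.2.1 j = 1} := by
    rw [Set.ofPred_and]
    refine IsClosed.inter ?_ (isClosed_eq (by fun_prop) (by fun_prop))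
    simp only [Set.ofPred_forall]
    exact isClosed_iInter fun j => isClosed_eq (by fun_prop) (by fun_prop)
  convert measurableSet_exists_of_isClosed hC using 1
  ext B
  simp only [Set.mem_ofPred_eq, mem_kerSupport, Prod.exists]
  constructor
  · rintro ⟨κ, hκ, hj⟩
    exact ⟨κ, (κ j)⁻¹, hκ, inv_mul_cancel₀ hj⟩
  · rintro ⟨κ, τ, hκ, h⟩
    exact ⟨κ, hκ, right_ne_zero_of_mul (h ▸ one_ne_zero)⟩

/-- A kernel vector that does not vanish at j expresses column j through the other n columns, which
after transposition form an independent square array. -/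
theorem measure_mem_kerSupport_le (n : ℕ) (j : Fin (n + 1)) :
    arrayLaw μ (Fin n) (Fin (n + 1)) {B | j ∈ kerSupport B} ≤ spanProb μ n := by
  have h1 := measurePreserving_entries μ (R := Fin n) (C := Fin (n + 1)) (R' := Fin (n + 1))
    (C' := Fin n) (e := fun x => (x.2, x.1)) (by
      rintro ⟨a, b⟩ ⟨c, d⟩ h
      simpa [and_comm] using h)
  have h2 := measurePreserving_piFinSuccAbove
    (fun _ : Fin (n + 1) => Measure.pi fun _ : Fin n => μ) j
  have h := (Measure.measurePreserving_swap (μ := Measure.pi fun _ : Fin n => μ)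
    (ν := arrayLaw μ (Fin n) (Fin n))).comp (h2.comp h1)
  unfold spanProb
  rw [← h.measure_preimage (measurableSet_inRowSpan n n).nullMeasurableSet]
  refine measure_mono ?_
  intro B (hB : j ∈ kerSupport B)
  obtain ⟨κ, hκ, hj⟩ := mem_kerSupport.1 hB
  refine ⟨fun i => -κ (j.succAbove i) / κ j, fun l => ?_⟩
  have := hκ l
  rw [Fin.sum_univ_succAbove _ j] at this
  change ∑ i, -κ (j.succAbove i) / κ j * B l (j.succAbove i) = B l j
  have h3 : ∀ i, -κ (j.succAbove i) / κ j * B l (j.succAbove i) =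
      -(κ j)⁻¹ * (B l (j.succAbove i) * κ (j.succAbove i)) := fun i => by ring
  simp_rw [h3, ← Finset.mul_sum]
  rw [eq_neg_of_add_eq_zero_right this]
  field_simp

/-- Markov's inequality for the size of the kernel support, whose mean is at most (n + 1) times the
span probability. -/
theorem measure_lt_card_kerSupport_le (n t : ℕ) (ht : n + 1 ≤ 200 * (t + 1)) :
    arrayLaw μ (Fin n) (Fin (n + 1)) {B | t < (kerSupport B).card} ≤ 200 * spanProb μ n := by
  classical
  set f : (Fin n → Fin (n + 1) → ℝ) → ℝ≥0∞ := fun B =>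
    ∑ j, {B : Fin n → Fin (n + 1) → ℝ | j ∈ kerSupport B}.indicator 1 B with hf
  have hfc : ∀ B, f B = (kerSupport B).card := by
    intro B
    simp only [hf, Set.indicator_apply, Set.mem_ofPred_eq, Pi.one_apply]
    rw [Finset.sum_ite_mem, Finset.univ_inter]
    simp
  have hfm : Measurable f := Finset.measurable_sum _ fun j _ =>
    measurable_one.indicator (measurableSet_mem_kerSupport j)
  have h1 := mul_meas_ge_le_lintegral (μ := arrayLaw μ (Fin n) (Fin (n + 1)))
    hfm ((t + 1 : ℕ) : ℝ≥0∞)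
  have h2 : ∫⁻ B, f B ∂(arrayLaw μ (Fin n) (Fin (n + 1))) ≤
      ((n + 1 : ℕ) : ℝ≥0∞) * spanProb μ n := by
    simp only [hf]
    rw [lintegral_finsetSum _ fun j _ =>
      measurable_one.indicator (measurableSet_mem_kerSupport j)]
    simp_rw [lintegral_indicator_one (measurableSet_mem_kerSupport _)]
    refine (Finset.sum_le_sum fun j _ => measure_mem_kerSupport_le μ n j).trans (le_of_eq ?_)
    simp
  have h3 : {B : Fin n → Fin (n + 1) → ℝ | t < (kerSupport B).card} =
      {B | ((t + 1 : ℕ) : ℝ≥0∞) ≤ f B} := by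
    ext B
    simp only [Set.mem_ofPred_eq, hfc, Nat.cast_le]
    exact Iff.rfl
  rw [h3]
  have h4 : ((t + 1 : ℕ) : ℝ≥0∞) *
      arrayLaw μ (Fin n) (Fin (n + 1)) {B | ((t + 1 : ℕ) : ℝ≥0∞) ≤ f B} ≤
      ((t + 1 : ℕ) : ℝ≥0∞) * (200 * spanProb μ n) := by
    refine (h1.trans h2).trans ?_
    rw [← mul_assoc]
    gcongr
    calc ((n + 1 : ℕ) : ℝ≥0∞) ≤ ((200 * (t + 1) : ℕ) : ℝ≥0∞) := by exact_mod_cast ht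
      _ = _ := by push_cast; ring
  exact (ENNReal.mul_le_mul_iff_right (by exact_mod_cast Nat.succ_ne_zero t)
    (ENNReal.natCast_ne_top _)).1 h4

/-- Pairing with a kernel vector only sees the kernel support, where c agrees with a row of B; so c
annihilates the kernel and lies in the row span. -/
theorem inRowSpan_of_const_on_kerSupport {R C : Type*} [Fintype R] [Fintype C] {B : R → C → ℝ}
    {c : C → ℝ} {a : ℝ} {i : R} (hB : ∀ j ∈ kerSupport B, B i j = a)
    (hc : ∀ j ∈ kerSupport B, c j = a) : InRowSpan B c := by
  refine inRowSpan_of_forall_inKer fun κ hκ => ?_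
  rw [← hκ i]
  refine Finset.sum_congr rfl fun j _ => ?_
  by_cases hj : κ j = 0
  · simp [hj]
  · have := mem_kerSupport.2 ⟨κ, hκ, hj⟩
    rw [hB j this, hc j this]

/-- With t ≤ n/200 the entropy factors cost at most (21/20)^n, and (51/50)² (3/4)(21/20) < 5/6. -/
theorem small_subset_bound {n t : ℕ} (hn : 200 ≤ n) (ht : 200 * t ≤ n) :
    ((51 / 50) ^ (n + 1) * 50 ^ t) * ((51 / 50) ^ n * 50 ^ t) * (3 / 4) ^ (n - t) ≤
      (1 / 8 : ℝ) := by
  have h1 : ((2500 : ℝ) * (4 / 3)) ^ t ≤ (21 / 20) ^ n := by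
    calc _ ≤ ((21 / 20 : ℝ) ^ 200) ^ t := by gcongr; norm_num
      _ = (21 / 20) ^ (200 * t) := by rw [pow_mul]
      _ ≤ _ := pow_le_pow_right₀ (by norm_num) ht
  have h2 : (3 / 4 : ℝ) ^ (n - t) = (3 / 4) ^ n * (4 / 3) ^ t := by
    have h : (3 / 4 : ℝ) ^ n = (3 / 4) ^ (n - t) * (3 / 4) ^ t := by
      rw [← pow_add]; congr 1; omega
    rw [h, mul_assoc, ← mul_pow]; norm_num
  have h3 : ((5 / 6 : ℝ)) ^ n ≤ (5 / 6) ^ 20 :=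
    pow_le_pow_of_le_one (by norm_num) (by norm_num) (by omega)
  calc _ = (51 / 50) * ((51 / 50 : ℝ) ^ n * (51 / 50) ^ n * (3 / 4) ^ n) *
        ((2500 : ℝ) * (4 / 3)) ^ t := by
        rw [h2, pow_succ, mul_pow, show (2500 : ℝ) = 50 * 50 by norm_num, mul_pow]; ring
    _ ≤ (51 / 50) * ((51 / 50 : ℝ) ^ n * (51 / 50) ^ n * (3 / 4) ^ n) * (21 / 20) ^ n := by gcongr
    _ = (51 / 50) * ((51 / 50 : ℝ) * (51 / 50) * (3 / 4) * (21 / 20)) ^ n := by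
        simp only [mul_pow]; ring
    _ ≤ (51 / 50) * (5 / 6) ^ n := by gcongr; norm_num
    _ ≤ (51 / 50) * (5 / 6) ^ 20 := by gcongr
    _ ≤ 1 / 8 := by norm_num

/-- Outside rare events the kernel support has fewer than s elements and some row equals a on it. A
new row equal to a there lies in the row span, which has conditional probability at least 1/2. Large
kernel supports cost 200 span probabilities, conditional probability at least 1/2 costs 2, and the
other two events cost 1/8 each. -/
theorem one_le_spanProb_add {n s t : ℕ} {a : ℝ} (hn : 200 ≤ n) (ht : 200 * t ≤ n)
    (ht' : n + 1 ≤ 200 * (t + 1)) (hst : s ≤ t)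
    (hη : ∀ κ : Fin (n + 1) → ℝ, s ≤ (nonzeros κ).card →
      (Measure.pi fun _ : Fin (n + 1) => μ) {c | ∑ j, c j * κ j = 0} ≤ ENNReal.ofReal (3 / 4))
    (ha : ∀ r : ℕ, r < s → 1 / 2 ≤ μ {a} ^ r) :
    1 ≤ 202 * spanProb μ n + ENNReal.ofReal (1 / 4) := by
  set P := arrayLaw μ (Fin n) (Fin (n + 1)) with hP
  set Q : Measure (Fin (n + 1) → ℝ) := Measure.pi fun _ => μ with hQ
  set E₁ := {A : Fin n → Fin (n + 1) → ℝ |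
    ∃ κ, InKer A κ ∧ s ≤ (nonzeros κ).card ∧ (nonzeros κ).card ≤ t} with hE₁
  set E₂ := {B : Fin n → Fin (n + 1) → ℝ | t < (kerSupport B).card} with hE₂
  set E₃ := {A : Fin n → Fin (n + 1) → ℝ |
    ∃ U : Finset (Fin (n + 1)), U.card < s ∧ ∀ i, ¬ ∀ j ∈ U, A i j = a} with hE₃
  set S := {q : (Fin n → Fin (n + 1) → ℝ) × (Fin (n + 1) → ℝ) | InRowSpan q.1 q.2} with hS
  have hSm : MeasurableSet S := measurableSet_inRowSpan n (n + 1)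
  set H := {B | (1 / 2 : ℝ≥0∞) ≤ Q (Prod.mk B ⁻¹' S)} with hH
  have h1 : P E₁ ≤ ENNReal.ofReal (1 / 8) :=
    (measure_exists_inKer_le μ (by norm_num) (by norm_num) hη).trans
      (ENNReal.ofReal_le_ofReal (small_subset_bound hn ht))
  have h2 : P E₂ ≤ 200 * spanProb μ n := measure_lt_card_kerSupport_le μ n t ht'
  have h3 : P E₃ ≤ ENNReal.ofReal (1 / 8) := by
    refine (measure_exists_no_const_row_le μ hst fun U hU => ha _ hU).trans
      (ENNReal.ofReal_le_ofReal (le_trans ?_ (small_subset_bound hn ht)))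
    have h4 : (1 / 2 : ℝ) ^ n ≤ (3 / 4) ^ (n - t) := by
      calc (1 / 2 : ℝ) ^ n ≤ (3 / 4) ^ n := pow_le_pow_left₀ (by norm_num) (by norm_num) n
        _ ≤ _ := pow_le_pow_of_le_one (by norm_num) (by norm_num) (Nat.sub_le _ _)
    have h5 : (1 : ℝ) ≤ (51 / 50) ^ n * 50 ^ t := by
      have := one_le_pow₀ (M₀ := ℝ) (a := 51 / 50) (by norm_num) (n := n)
      have := one_le_pow₀ (M₀ := ℝ) (a := 50) (by norm_num) (n := t)
      nlinarith
    exact mul_le_mul (le_mul_of_one_le_right (by positivity) h5) h4 (by positivity)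
      (by positivity)
  have h4 : P H ≤ 2 * spanProb μ n := by
    have hm := mul_meas_ge_le_lintegral (μ := P) (measurable_measure_prodMk_left (ν := Q) hSm)
      (1 / 2)
    rw [← Measure.prod_apply hSm] at hm
    have := hm.trans (measure_inRowSpan_succ_le μ n)
    calc P H = 2 * (1 / 2 * P H) := by
          rw [← mul_assoc, one_div, ENNReal.mul_inv_cancel (by norm_num) (by norm_num), one_mul]
      _ ≤ _ := by gcongr
  have hcover : (Set.univ : Set (Fin n → Fin (n + 1) → ℝ)) ⊆ E₁ ∪ E₂ ∪ E₃ ∪ H := by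
    intro B _
    by_contra hB
    simp only [Set.mem_union, not_or] at hB
    obtain ⟨⟨⟨hB1, hB2⟩, hB3⟩, hB4⟩ := hB
    obtain ⟨κ, hκ, hκU⟩ := exists_inKer_nonzeros_eq B
    have hcard : (kerSupport B).card < s := by
      by_contra hcon
      push Not at hcon
      exact hB1 ⟨κ, hκ, hκU ▸ hcon, hκU ▸ not_lt.1 hB2⟩
    have hrow : ∃ i, ∀ j ∈ kerSupport B, B i j = a := by
      by_contra hcon
      push Not at hcon
      exact hB3 ⟨_, hcard, fun i h => by obtain ⟨j, hj, hne⟩ := hcon i; exact hne (h j hj)⟩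
    obtain ⟨i, hi⟩ := hrow
    apply hB4
    refine (ha _ hcard).trans ?_
    rw [← measure_const_on_eq μ a (kerSupport B)]
    exact measure_mono fun c hc => inRowSpan_of_const_on_kerSupport hi hc
  calc (1 : ℝ≥0∞) = P Set.univ := measure_univ.symm
    _ ≤ P (E₁ ∪ E₂ ∪ E₃ ∪ H) := measure_mono hcover
    _ ≤ P E₁ + P E₂ + P E₃ + P H :=
        (measure_union_le _ _).trans (add_le_add_left ((measure_union_le _ _).trans
          (add_le_add_left (measure_union_le _ _) _)) _)
    _ ≤ ENNReal.ofReal (1 / 8) + 200 * spanProb μ n + ENNReal.ofReal (1 / 8) +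
        2 * spanProb μ n := by gcongr
    _ = 202 * spanProb μ n + (ENNReal.ofReal (1 / 8) + ENNReal.ofReal (1 / 8)) := by ring
    _ = _ := by rw [← ENNReal.ofReal_add (by norm_num) (by norm_num)]; norm_num

theorem le_spanProb_of_one_le {n : ℕ} (h : 1 ≤ 202 * spanProb μ n + ENNReal.ofReal (1 / 4)) :
    ENNReal.ofReal (Real.exp (-800)) ≤ spanProb μ n := by
  have hfin : spanProb μ n ≠ ∞ := ((spanProb_le_one μ n).trans_lt ENNReal.one_lt_top).ne
  have h1 := ENNReal.toReal_mono (by finiteness) h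
  rw [ENNReal.toReal_add (by finiteness) (by finiteness), ENNReal.toReal_mul,
    ENNReal.toReal_ofReal (by norm_num)] at h1
  simp only [ENNReal.toReal_one, ENNReal.toReal_ofNat] at h1
  rw [ENNReal.ofReal_le_iff_le_toReal hfin]
  have h2 : (800 : ℝ) ≤ Real.exp 800 := by linarith [Real.add_one_le_exp 800]
  have h3 : Real.exp (-800) ≤ 1 / 800 := by
    rw [Real.exp_neg, ← one_div]
    exact one_div_le_one_div_of_le (by norm_num) h2
  linarith

/-- The vector and the first row of the array may both be constant equal to a. -/
theorem pow_le_spanProb {n : ℕ} (hn : 0 < n) (a : ℝ) : μ {a} ^ n * μ {a} ^ n ≤ spanProb μ n := by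
  have h1 : ∀ m : ℕ, (Measure.pi fun _ : Fin m => μ) {c | ∀ j, c j = a} = μ {a} ^ m := by
    intro m
    have := measure_const_on_eq μ a (Finset.univ : Finset (Fin m))
    simpa using this
  have hm : MeasurableSet {c : Fin n → ℝ | ∀ j, c j = a} := by
    simp only [Set.ofPred_forall]
    exact MeasurableSet.iInter fun j => measurableSet_eq_fun (by fun_prop) measurable_const
  have h2 : arrayLaw μ (Fin n) (Fin n) {A | ∀ j, A ⟨0, hn⟩ j = a} = μ {a} ^ n := by
    rw [← h1 n]
    exact (measurePreserving_eval (fun _ : Fin n => Measure.pi fun _ : Fin n => μ)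
      ⟨0, hn⟩).measure_preimage hm.nullMeasurableSet
  unfold spanProb
  calc μ {a} ^ n * μ {a} ^ n = ((arrayLaw μ (Fin n) (Fin n)).prod (Measure.pi fun _ : Fin n => μ))
        ({A | ∀ j, A ⟨0, hn⟩ j = a} ×ˢ {c | ∀ j, c j = a}) := by
        rw [Measure.prod_prod, h1, h2]
    _ ≤ _ := by
        refine measure_mono ?_
        rintro ⟨A, c⟩ ⟨hA, hc⟩
        refine ⟨Pi.single ⟨0, hn⟩ 1, fun j => ?_⟩
        rw [Finset.sum_eq_single ⟨0, hn⟩ (fun i _ h => by simp [h]) (by simp)]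
        simp only [Pi.single_eq_same, one_mul]
        exact (hA j).trans (hc j).symm

/-- A random vector is a linear combination of the rows of an independent random square array with
probability bounded below, uniformly in the law of the entries and in the size. -/
theorem le_spanProb {n : ℕ} (hn : 200 ≤ n) :
    ENNReal.ofReal (Real.exp (-800)) ≤ spanProb μ n := by
  have ht : 200 * (n / 200) ≤ n := Nat.mul_div_le n 200
  have ht' : n + 1 ≤ 200 * (n / 200 + 1) := by omega
  by_cases hatom : ∀ a, μ.real {a} ≤ 3 / 4
  -- Without a dominant atom every nonzero κ already obeys the small-ball bound, so s = 1. The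
  -- kernel support is then empty and the value a = 0 plays no role.
  · refine le_spanProb_of_one_le μ (one_le_spanProb_add μ (s := 1) (a := 0) hn ht ht' (by omega)
      (fun κ hκ => ?_) fun r hr => ?_)
    · exact measure_linearForm_eq_zero_le μ (ε := 1 / 4) (by norm_num) (by norm_num)
        (fun a => (hatom a).trans (by norm_num)) (by norm_num) κ hκ
    · obtain rfl : r = 0 := by omega
      simp
  push Not at hatom
  obtain ⟨a, ha⟩ := hatom
  obtain ⟨ε, hε⟩ : ∃ ε, ε = 1 - μ.real {a} := ⟨_, rfl⟩
  have hε0 : 0 ≤ ε := by have := measureReal_le_one (μ := μ) (s := {a}); linarith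
  have hε4 : ε < 1 / 4 := by linarith
  have hμa : μ {a} = ENNReal.ofReal (1 - ε) := by
    rw [hε, sub_sub_cancel, Measure.real, ENNReal.ofReal_toReal (measure_ne_top _ _)]
  have hnn : (200 : ℝ) ≤ n := by exact_mod_cast hn
  by_cases hεn : ε * n < 200
  · refine le_trans ?_ (pow_le_spanProb μ (by omega) a)
    rw [hμa, ← ENNReal.ofReal_pow (by linarith), ← ENNReal.ofReal_mul (by
      have : 0 ≤ 1 - ε := by linarith
      positivity), ← pow_add]
    refine ENNReal.ofReal_le_ofReal ?_
    have h1 : Real.exp (-(2 * ε)) ≤ 1 - ε := by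
      rw [Real.exp_neg, inv_le_comm₀ (Real.exp_pos _) (by linarith)]
      refine le_trans ?_ (Real.add_one_le_exp _)
      rw [inv_le_iff_one_le_mul₀ (by linarith)]
      nlinarith
    calc Real.exp (-800) ≤ Real.exp ((n + n : ℕ) * -(2 * ε)) := by
          rw [Real.exp_le_exp]; push_cast; nlinarith
      _ = Real.exp (-(2 * ε)) ^ (n + n) := Real.exp_nat_mul _ _
      _ ≤ _ := by gcongr
  · push Not at hεn
    have hεpos : 0 < ε := by
      rcases hε0.lt_or_eq with h | h
      · exact h
      · rw [← h] at hεn; linarith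
    have hs := Nat.le_ceil (1 / (2 * ε))
    -- The scale 1/(2ε) serves both demands: s terms bring (1 - 2ε)^s below 1/2, while fewer than s
    -- entries all equal a with probability at least 1/2. The bound ε n ≥ 200 gives s ≤ n/200.
    refine le_spanProb_of_one_le μ (one_le_spanProb_add μ (s := ⌈1 / (2 * ε)⌉₊) (a := a) hn ht ht'
      ?_ (fun κ hκ => ?_) fun r hr => ?_)
    · rw [Nat.ceil_le]
      have h1 : (n : ℝ) + 1 ≤ 200 * (((n / 200 : ℕ) : ℝ) + 1) := by exact_mod_cast ht'
      have h2 : 1 / (2 * ε) ≤ n / 400 := by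
        rw [div_le_div_iff₀ (by positivity) (by norm_num)]; linarith
      have h3 : (800 : ℝ) ≤ n := by nlinarith
      linarith
    · refine measure_linearForm_eq_zero_le μ hε0 (by linarith) (fun x => ?_) ?_ κ hκ
      · by_cases hx : x = a
        · rw [hx]; linarith
        · have hdis : Disjoint ({x} : Set ℝ) {a} := by simpa using hx
          have h1 := measureReal_union (μ := μ) hdis (measurableSet_singleton a)
          have h2 := measureReal_le_one (μ := μ) (s := {x} ∪ {a})
          rw [h1] at h2
          linarith
      · have h1 : 1 - 2 * ε ≤ Real.exp (-(2 * ε)) := by linarith [Real.add_one_le_exp (-(2 * ε))]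
        have h2 : 1 ≤ (⌈1 / (2 * ε)⌉₊ : ℝ) * (2 * ε) := by
          rwa [div_le_iff₀ (by positivity)] at hs
        calc (1 - 2 * ε) ^ ⌈1 / (2 * ε)⌉₊ ≤ Real.exp (-(2 * ε)) ^ ⌈1 / (2 * ε)⌉₊ := by
              have : 0 ≤ 1 - 2 * ε := by linarith
              gcongr
          _ = Real.exp (⌈1 / (2 * ε)⌉₊ * -(2 * ε)) := (Real.exp_nat_mul _ _).symm
          _ ≤ Real.exp (-1) := by rw [Real.exp_le_exp]; linarith
          _ ≤ 1 / 2 := by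
            rw [Real.exp_neg, ← one_div]
            exact one_div_le_one_div_of_le (by norm_num) (by linarith [Real.add_one_le_exp 1])
    · rw [Nat.lt_ceil, lt_div_iff₀ (by positivity)] at hr
      rw [hμa, ← ENNReal.ofReal_pow (by linarith)]
      have h1 := one_add_mul_le_pow (a := -ε) (by linarith) r
      calc (1 / 2 : ℝ≥0∞) = ENNReal.ofReal (1 / 2) := by
            rw [ENNReal.ofReal_div_of_pos (by norm_num)]; simp
        _ ≤ _ := ENNReal.ofReal_le_ofReal (by
            rw [← sub_eq_add_neg] at h1
            linarith)

end Span

/-! ### Two vectors in the same span. -/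

section TwoVectors

variable (μ : Measure ℝ) [IsProbabilityMeasure μ]

theorem sq_lintegral_le {Ω : Type*} [MeasurableSpace Ω] (P : Measure Ω) [IsProbabilityMeasure P]
    {f : Ω → ℝ≥0∞} (hf : Measurable f) (hfin : ∫⁻ x, f x ∂P ≠ ∞) :
    (∫⁻ x, f x ∂P) ^ 2 ≤ ∫⁻ x, f x ^ 2 ∂P := by
  set c := ∫⁻ x, f x ∂P with hc
  have hpt : ∀ x, 2 * c * f x ≤ c ^ 2 + f x ^ 2 := by
    intro x
    by_cases hx : f x = ∞
    · simp [hx]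
    · lift f x to NNReal using hx with y
      lift c to NNReal using hfin with d
      exact_mod_cast two_mul_le_add_sq d y
  have h := lintegral_mono (μ := P) hpt
  rw [lintegral_const_mul _ hf, lintegral_add_left measurable_const, ← hc] at h
  simp only [lintegral_const, measure_univ, mul_one] at h
  have h2 : c ^ 2 + c ^ 2 ≤ c ^ 2 + ∫⁻ x, f x ^ 2 ∂P := by
    refine le_trans (le_of_eq ?_) h
    ring
  exact (ENNReal.add_le_add_iff_left (ENNReal.pow_ne_top hfin)).1 h2

/-- Given the array, the two events are independent with equal probability, and the mean of a square
is at least the square of the mean. -/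
theorem sq_spanProb_le (n : ℕ) :
    spanProb μ n ^ 2 ≤ ((arrayLaw μ (Fin n) (Fin n)).prod
      ((Measure.pi fun _ : Fin n => μ).prod (Measure.pi fun _ : Fin n => μ)))
        {q | InRowSpan q.1 q.2.1 ∧ InRowSpan q.1 q.2.2} := by
  set Q : Measure (Fin n → ℝ) := Measure.pi fun _ => μ with hQ
  set S := {q : (Fin n → Fin n → ℝ) × (Fin n → ℝ) | InRowSpan q.1 q.2} with hS
  have hSm : MeasurableSet S := measurableSet_inRowSpan n n
  have hm : MeasurableSet {q : (Fin n → Fin n → ℝ) × ((Fin n → ℝ) × (Fin n → ℝ)) |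
      InRowSpan q.1 q.2.1 ∧ InRowSpan q.1 q.2.2} := by
    refine MeasurableSet.inter ?_ ?_
    · exact (measurable_fst.prodMk measurable_snd.fst) hSm
    · exact (measurable_fst.prodMk measurable_snd.snd) hSm
  have h1 : spanProb μ n = ∫⁻ A, Q (Prod.mk A ⁻¹' S) ∂(arrayLaw μ (Fin n) (Fin n)) :=
    Measure.prod_apply hSm
  rw [Measure.prod_apply hm]
  have h2 : ∀ A, (Q.prod Q) (Prod.mk A ⁻¹' {q : (Fin n → Fin n → ℝ) × ((Fin n → ℝ) × (Fin n → ℝ)) |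
      InRowSpan q.1 q.2.1 ∧ InRowSpan q.1 q.2.2}) = Q (Prod.mk A ⁻¹' S) ^ 2 := by
    intro A
    rw [sq, ← Measure.prod_prod]
    rfl
  simp_rw [h2]
  have hne : spanProb μ n ≠ ∞ := ((spanProb_le_one μ n).trans_lt ENNReal.one_lt_top).ne
  rw [h1] at hne ⊢
  exact sq_lintegral_le _ (measurable_measure_prodMk_left hSm) hne

theorem sq_spanProb_le_matrixLaw {n p : ℕ} {i j : Fin p} {φ : Fin n → Fin p}
    (hφ : Function.Injective φ) (hij : i ≠ j) (hi : ∀ r, φ r ≠ i) (hj : ∀ r, φ r ≠ j) :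
    spanProb μ n ^ 2 ≤ matrixLaw μ n p
      {X | InRowSpan (fun r l => X l (φ r)) (fun l => X l i) ∧
        InRowSpan (fun r l => X l (φ r)) (fun l => X l j)} := by
  set ψ : Fin (n + 1 + 1) → Fin p := Fin.cons i (Fin.cons j φ) with hψ
  have hψi : Function.Injective ψ := by
    rw [hψ, Fin.cons_injective_iff, Fin.cons_injective_iff]
    refine ⟨?_, ?_, hφ⟩
    · rintro ⟨r, hr⟩
      refine Fin.cases (fun h => ?_) (fun r h => ?_) r hr
      · exact hij h.symm
      · exact hi r h
    · rintro ⟨r, hr⟩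
      exact hj r hr
  have h1 := measurePreserving_entries μ (R := Fin n) (C := Fin p) (R' := Fin (n + 1 + 1))
    (C' := Fin n) (e := fun x => (x.2, ψ x.1)) (by
      rintro ⟨a, b⟩ ⟨c, d⟩ h
      simp only [Prod.mk.injEq] at h
      rw [h.1, hψi h.2])
  have h2 := measurePreserving_piFinSuccAbove
    (fun _ : Fin (n + 1 + 1) => Measure.pi fun _ : Fin n => μ) 0
  have h3 := measurePreserving_piFinSuccAbove
    (fun _ : Fin (n + 1) => Measure.pi fun _ : Fin n => μ) 0
  set Q : Measure (Fin n → ℝ) := Measure.pi fun _ => μ with hQ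
  have h4 := (MeasurePreserving.id Q).prod h3
  have h5 := (measurePreserving_prodAssoc Q Q (arrayLaw μ (Fin n) (Fin n))).symm
  have h6 := Measure.measurePreserving_swap (μ := Q.prod Q) (ν := arrayLaw μ (Fin n) (Fin n))
  have h := h6.comp (h5.comp (h4.comp (h2.comp h1)))
  have hm : MeasurableSet {q : (Fin n → Fin n → ℝ) × ((Fin n → ℝ) × (Fin n → ℝ)) |
      InRowSpan q.1 q.2.1 ∧ InRowSpan q.1 q.2.2} :=
    ((measurable_fst.prodMk measurable_snd.fst) (measurableSet_inRowSpan n n)).inter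
      ((measurable_fst.prodMk measurable_snd.snd) (measurableSet_inRowSpan n n))
  refine (sq_spanProb_le μ n).trans ?_
  rw [← h.measure_preimage hm.nullMeasurableSet]
  exact measure_mono fun X hX => hX

end TwoVectors

/-! ### Indistinguishable spikes and translation of the signal values. -/

section Shift

variable {n p : ℕ} (μ : Measure ℝ) [IsProbabilityMeasure μ]

/-- The signal equal to `a` at `i`, to `θ` on `T`, and to `0` elsewhere. -/
def spikeSignal (a : ℝ) (i : Fin p) (T : Finset (Fin p)) (θ : Fin p → ℝ) : Fin p → ℝ :=
  fun l => (if l = i then a else 0) + if l ∈ T then θ l else 0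

theorem mem_supp {β : Fin p → ℝ} {l : Fin p} : l ∈ supp β ↔ β l ≠ 0 := by
  simp [supp]

theorem supp_spikeSignal {a : ℝ} (ha : 0 < a) {i : Fin p} {T : Finset (Fin p)} (hi : i ∉ T)
    {θ : Fin p → ℝ} (hθ : ∀ l, a ≤ θ l) : supp (spikeSignal a i T θ) = insert i T := by
  ext l
  simp only [mem_supp, spikeSignal, Finset.mem_insert]
  have := hθ l
  by_cases h : l = i
  · subst h; simp [hi, ha.ne']
  · by_cases h' : l ∈ T
    · simp [h, h', (ha.trans_le this).ne']
    · simp [h, h']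

theorem spikeSignal_mem {a : ℝ} (ha : 0 < a) {i : Fin p} {T : Finset (Fin p)} (hi : i ∉ T)
    {θ : Fin p → ℝ} (hθ : ∀ l, a ≤ θ l) : spikeSignal a i T θ ∈ signalClass p a := by
  intro l hl
  rw [supp_spikeSignal ha hi hθ, Finset.mem_insert] at hl
  have := hθ l
  rcases hl with rfl | hl
  · simp [spikeSignal, hi, abs_of_pos ha]
  · have hli : l ≠ i := fun h => hi (h ▸ hl)
    simp only [spikeSignal, hli, hl, if_true, if_false, zero_add]
    exact this.trans (le_abs_self _)

theorem observe_spikeSignal_eq {a : ℝ} {i j : Fin p} {T : Finset (Fin p)}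
    {X : Fin n → Fin p → ℝ} {h : Fin p → ℝ} (hT : ∀ l ∉ T, h l = 0)
    (hX : ∀ r, ∑ l, X r l * h l = a * (X r i - X r j)) (θ : Fin p → ℝ) (W : Fin n → ℝ) :
    observe X (spikeSignal a i T θ) W = observe X (spikeSignal a j T (θ + h)) W := by
  ext r
  simp only [observe, Pi.add_apply, Matrix.mulVec, dotProduct, Matrix.of_apply, add_left_inj]
  rw [← sub_eq_zero, ← Finset.sum_sub_distrib]
  have h1 : ∀ l, X r l * spikeSignal a i T θ l - X r l * spikeSignal a j T (θ + h) l =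
      (if l = i then X r l * a else 0) - (if l = j then X r l * a else 0) - X r l * h l := by
    intro l
    have : (if l ∈ T then θ l + h l else 0) = (if l ∈ T then θ l else 0) + h l := by
      split_ifs with hl
      · rfl
      · rw [hT l hl, add_zero]
    simp only [spikeSignal, Pi.add_apply, this]
    split_ifs <;> ring
  simp_rw [h1]
  rw [Finset.sum_sub_distrib, Finset.sum_sub_distrib, hX]
  simp only [Finset.sum_ite_eq', Finset.mem_univ, if_true]
  ring

/-- The matrices for which some change of the coordinates in `T`, bounded by `R`, compensates the
move of a spike of height `a` from `i` to `j`. -/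
def confusable (n : ℕ) (a : ℝ) (i j : Fin p) (T : Finset (Fin p)) (R : ℝ) :
    Set (Fin n → Fin p → ℝ) :=
  {X | ∃ h : Fin p → ℝ, (∀ l ∉ T, h l = 0) ∧ (∀ l, |h l| ≤ R) ∧
    ∀ r, ∑ l, X r l * h l = a * (X r i - X r j)}

/-- The event that the decoder errs on a spike signal, as a subset of the triples made of the
matrix, the noise and the values on `T`. -/
def spikeFailure (g : Decoder n p) (a : ℝ) (i : Fin p) (T : Finset (Fin p)) :
    Set (((Fin n → Fin p → ℝ) × (Fin n → ℝ)) × (Fin p → ℝ)) :=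
  {q | g.estimate q.1.1 (observe q.1.1 (spikeSignal a i T q.2) q.1.2) ≠ insert i T}

theorem measurableSet_spikeFailure (g : Decoder n p) (a : ℝ) (i : Fin p) (T : Finset (Fin p)) :
    MeasurableSet (spikeFailure g a i T) := by
  have hm : Measurable fun q : ((Fin n → Fin p → ℝ) × (Fin n → ℝ)) × (Fin p → ℝ) =>
      (q.1.1, observe q.1.1 (spikeSignal a i T q.2) q.1.2) := by
    refine measurable_fst.fst.prodMk (measurable_pi_lambda _ fun r => ?_)
    simp only [observe, Pi.add_apply, Matrix.mulVec, dotProduct, Matrix.of_apply, spikeSignal]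
    refine Measurable.add (Finset.measurable_sum _ fun l _ => Measurable.mul (by fun_prop) ?_)
      (by fun_prop)
    split_ifs <;> fun_prop
  exact (hm (g.measurable_estimate (insert i T))).compl

theorem volume_cube (x y : ℝ) :
    volume (Set.univ.pi fun _ : Fin p => Set.Icc x y) = ENNReal.ofReal (y - x) ^ p := by
  rw [volume_pi_pi]
  simp

/-- For θ in the cube shrunk by R, both θ and θ + h stay in the large cube and give the same
observation for two different supports, so the decoder fails on at least one. Translation invariance
of Lebesgue measure removes h from the second term. -/
theorem volume_cube_le_lintegral {a L R : ℝ} {i j : Fin p} {T : Finset (Fin p)} (hij : i ≠ j)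
    (hi : i ∉ T) (g : Decoder n p)
    {X : Fin n → Fin p → ℝ} (hX : X ∈ confusable n a i j T R) (W : Fin n → ℝ) :
    ENNReal.ofReal (L - 2 * R) ^ p ≤
      ∫⁻ θ in Set.univ.pi fun _ : Fin p => Set.Icc a (a + L),
        ((spikeFailure g a i T).indicator 1 ((X, W), θ) +
          (spikeFailure g a j T).indicator 1 ((X, W), θ)) := by
  obtain ⟨h, hT, hR, hXh⟩ := hX
  set D := Set.univ.pi fun _ : Fin p => Set.Icc a (a + L) with hD
  set D' := Set.univ.pi fun _ : Fin p => Set.Icc (a + R) (a + L - R) with hD'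
  have hDm : MeasurableSet D := MeasurableSet.univ_pi fun _ => measurableSet_Icc
  have hD'm : MeasurableSet D' := MeasurableSet.univ_pi fun _ => measurableSet_Icc
  have hmi : ∀ i, Measurable (β := ℝ≥0∞) fun θ : Fin p → ℝ =>
      (spikeFailure g a i T).indicator 1 ((X, W), θ) := fun i =>
    (measurable_one.indicator (measurableSet_spikeFailure g a i T)).comp measurable_prodMk_left
  have hne : insert i T ≠ insert j T := by
    intro heq
    have := Finset.mem_insert_self i T
    rw [heq, Finset.mem_insert] at this
    exact this.elim hij hi
  have hpt : ∀ θ ∈ D', (1 : ℝ≥0∞) ≤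
      D.indicator (fun θ => (spikeFailure g a i T).indicator 1 ((X, W), θ)) θ +
      D.indicator (fun θ => (spikeFailure g a j T).indicator 1 ((X, W), θ)) (θ + h) := by
    intro θ hθ
    have h0 : ∀ l, 0 ≤ R := fun l => (abs_nonneg _).trans (hR l)
    have h1 : θ ∈ D := fun l hl =>
      ⟨by linarith [(hθ l hl).1, h0 l], by linarith [(hθ l hl).2, h0 l]⟩
    have h2 : θ + h ∈ D := fun l hl => by
      have := abs_le.1 (hR l)
      have h3 := hθ l hl
      exact ⟨by simp only [Pi.add_apply]; linarith [h3.1], by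
        simp only [Pi.add_apply]; linarith [h3.2]⟩
    rw [Set.indicator_of_mem h1, Set.indicator_of_mem h2]
    by_cases hmem : ((X, W), θ) ∈ spikeFailure g a i T
    · rw [Set.indicator_of_mem hmem]; exact le_self_add
    · have hmem2 : ((X, W), θ + h) ∈ spikeFailure g a j T := by
        simp only [spikeFailure, Set.mem_ofPred_eq, not_not] at hmem ⊢
        rw [← observe_spikeSignal_eq hT hXh, hmem]
        exact hne
      rw [Set.indicator_of_mem hmem2]; exact le_add_self
  calc ENNReal.ofReal (L - 2 * R) ^ p = volume D' := by
        rw [hD', volume_cube]; congr 2; ring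
    _ = ∫⁻ θ in D', 1 := by simp
    _ ≤ ∫⁻ θ in D', (D.indicator (fun θ => (spikeFailure g a i T).indicator 1 ((X, W), θ)) θ +
      D.indicator (fun θ => (spikeFailure g a j T).indicator 1 ((X, W), θ)) (θ + h)) :=
        setLIntegral_mono' hD'm hpt
    _ ≤ ∫⁻ θ, (D.indicator (fun θ => (spikeFailure g a i T).indicator 1 ((X, W), θ)) θ +
      D.indicator (fun θ => (spikeFailure g a j T).indicator 1 ((X, W), θ)) (θ + h)) :=
        setLIntegral_le_lintegral _ _
    _ = _ := by
        rw [lintegral_add_left ((hmi i).indicator hDm),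
          lintegral_add_right_eq_self
            (D.indicator (fun θ => (spikeFailure g a j T).indicator 1 ((X, W), θ))) h,
          lintegral_indicator hDm, lintegral_indicator hDm, lintegral_add_left (hmi i)]

/-- After exchanging integrals, each θ in the cube has entries at least a, so its spike signal is in
the class and its error is below the worst one. -/
theorem lintegral_spikeFailure_le {a L : ℝ} (ha : 0 < a) {i : Fin p} {T : Finset (Fin p)}
    (hi : i ∉ T) (g : Decoder n p) :
    ∫⁻ z, (∫⁻ θ in Set.univ.pi fun _ : Fin p => Set.Icc a (a + L),
        (spikeFailure g a i T).indicator 1 (z, θ)) ∂(jointLaw μ n p) ≤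
      ENNReal.ofReal L ^ p * worstError μ a g (insert i T) := by
  have hm := (measurable_one (α := ℝ≥0∞)).indicator (measurableSet_spikeFailure g a i T)
  rw [lintegral_lintegral_swap (f := fun z θ => (spikeFailure g a i T).indicator 1 (z, θ))
    (by exact hm.aemeasurable)]
  have h1 : ∀ θ ∈ Set.univ.pi fun _ : Fin p => Set.Icc a (a + L),
      ∫⁻ z, (spikeFailure g a i T).indicator 1 (z, θ) ∂(jointLaw μ n p) ≤
        worstError μ a g (insert i T) := by
    intro θ hθ
    have hθ' : ∀ l, a ≤ θ l := fun l => (hθ l (Set.mem_univ l)).1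
    refine le_trans (le_of_eq ?_) (errorProb_le_worstError μ g (supp_spikeSignal ha hi hθ')
      (spikeSignal_mem ha hi hθ'))
    have hms : MeasurableSet ((fun z => (z, θ)) ⁻¹' spikeFailure g a i T) :=
      measurable_prodMk_right (measurableSet_spikeFailure g a i T)
    unfold errorProb
    rw [supp_spikeSignal ha hi hθ']
    exact lintegral_indicator_one hms
  refine (setLIntegral_mono' (MeasurableSet.univ_pi fun _ => measurableSet_Icc) h1).trans ?_
  rw [setLIntegral_const, volume_cube, add_sub_cancel_left, mul_comm]

theorem volume_mul_confusable_le {a L R : ℝ} (ha : 0 < a) {i j : Fin p} {T : Finset (Fin p)}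
    (hij : i ≠ j) (hi : i ∉ T) (hj : j ∉ T) (g : Decoder n p) :
    ENNReal.ofReal (L - 2 * R) ^ p * matrixLaw μ n p (confusable n a i j T R) ≤
      ENNReal.ofReal L ^ p *
        (worstError μ a g (insert i T) + worstError μ a g (insert j T)) := by
  set D := Set.univ.pi fun _ : Fin p => Set.Icc a (a + L) with hD
  have hmi : ∀ i, Measurable (β := ℝ≥0∞) ((spikeFailure g a i T).indicator 1) := fun i =>
    measurable_one.indicator (measurableSet_spikeFailure g a i T)
  have hF : Measurable fun z => ∫⁻ θ in D, ((spikeFailure g a i T).indicator 1 (z, θ) +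
          (spikeFailure g a j T).indicator 1 (z, θ)) :=
    ((hmi i).add (hmi j)).lintegral_prod_right'
  have h1 := mul_meas_ge_le_lintegral (μ := jointLaw μ n p) hF (ENNReal.ofReal (L - 2 * R) ^ p)
  have h2 : matrixLaw μ n p (confusable n a i j T R) ≤ jointLaw μ n p
      {z | ENNReal.ofReal (L - 2 * R) ^ p ≤ ∫⁻ θ in D,
        ((spikeFailure g a i T).indicator 1 (z, θ) +
          (spikeFailure g a j T).indicator 1 (z, θ))} := by
    calc matrixLaw μ n p (confusable n a i j T R)
        = jointLaw μ n p (confusable n a i j T R ×ˢ Set.univ) := by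
          rw [jointLaw, Measure.prod_prod, measure_univ, mul_one]
      _ ≤ _ := by
          refine measure_mono ?_
          rintro ⟨X, W⟩ ⟨hX, -⟩
          exact volume_cube_le_lintegral hij hi g hX W
  refine (mul_le_mul_right h2 _).trans (h1.trans ?_)
  have h3 : ∀ z, ∫⁻ θ in D, ((spikeFailure g a i T).indicator 1 (z, θ) +
          (spikeFailure g a j T).indicator 1 (z, θ)) =
      (∫⁻ θ in D, (spikeFailure g a i T).indicator 1 (z, θ)) +
        ∫⁻ θ in D, (spikeFailure g a j T).indicator 1 (z, θ) := fun z =>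
    lintegral_add_left ((hmi i).comp measurable_prodMk_left) _
  simp_rw [h3]
  rw [lintegral_add_left (hmi i).lintegral_prod_right', mul_add]
  exact add_le_add (lintegral_spikeFailure_le μ ha hi g) (lintegral_spikeFailure_le μ ha hj g)

/-- Shifts of size up to M are tested on cubes of side M², where the boundary loss (1 - 2/M)^p tends
to 1. -/
theorem matrixLaw_iUnion_confusable_le {a : ℝ} (ha : 0 < a) {i j : Fin p} {T : Finset (Fin p)}
    (hij : i ≠ j) (hi : i ∉ T) (hj : j ∉ T) (g : Decoder n p) :
    matrixLaw μ n p (⋃ M : ℕ, confusable n a i j T M) ≤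
      worstError μ a g (insert i T) + worstError μ a g (insert j T) := by
  have hmono : Monotone fun M : ℕ => confusable n a i j T (M : ℝ) := by
    rintro M M' hM X ⟨h, h1, h2, h3⟩
    exact ⟨h, h1, fun l => (h2 l).trans (by exact_mod_cast hM), h3⟩
  have hlim := tendsto_measure_iUnion_atTop (μ := matrixLaw μ n p) hmono
  have hratio : Tendsto (fun M : ℕ => ENNReal.ofReal ((1 - 2 / (M : ℝ)) ^ p)) atTop (𝓝 1) := by
    have h1 : Tendsto (fun M : ℕ => (1 - 2 / (M : ℝ)) ^ p) atTop (𝓝 ((1 - 0) ^ p)) :=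
      (tendsto_const_nhds.sub (tendsto_const_div_atTop_nhds_zero_nat 2)).pow p
    have h2 := ENNReal.tendsto_ofReal h1
    simpa using h2
  have hprod := ENNReal.Tendsto.mul hratio (Or.inl one_ne_zero) hlim (Or.inr ENNReal.one_ne_top)
  rw [one_mul] at hprod
  refine le_of_tendsto hprod ?_
  filter_upwards [eventually_ge_atTop 2] with M hM
  have hM2 : (2 : ℝ) ≤ M := by exact_mod_cast hM
  have hMpos : (0 : ℝ) < M := by linarith
  have h := volume_mul_confusable_le μ (L := (M : ℝ) * M) (R := M) ha hij hi hj g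
  have hsplit : ENNReal.ofReal ((M : ℝ) * M - 2 * M) ^ p =
      ENNReal.ofReal ((M : ℝ) * M) ^ p * ENNReal.ofReal ((1 - 2 / (M : ℝ)) ^ p) := by
    have h0 : 0 ≤ 1 - 2 / (M : ℝ) := by
      rw [sub_nonneg, div_le_one hMpos]; exact hM2
    rw [ENNReal.ofReal_pow h0, ← mul_pow, ← ENNReal.ofReal_mul (by positivity)]
    congr 2
    field_simp
  rw [hsplit, mul_assoc] at h
  refine (ENNReal.mul_le_mul_iff_right ?_ ?_).1 h
  · exact pow_ne_zero _ (ENNReal.ofReal_pos.2 (by positivity)).ne'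
  · exact ENNReal.pow_ne_top ENNReal.ofReal_ne_top

/-- When the columns indexed by `T` are at least as many as the rows, the supports `T ∪ {i}` and
`T ∪ {j}` cannot both be recovered. -/
theorem sq_spanProb_le_worstError_add {a : ℝ} (ha : 0 < a) {i j : Fin p} {T : Finset (Fin p)}
    (hij : i ≠ j) (hi : i ∉ T) (hj : j ∉ T) (hT : n ≤ T.card) (g : Decoder n p) :
    spanProb μ n ^ 2 ≤ worstError μ a g (insert i T) + worstError μ a g (insert j T) := by
  obtain ⟨T', hT', hcard⟩ := Finset.exists_subset_card_eq hT
  set φ : Fin n → Fin p := fun r => T'.orderEmbOfFin hcard r with hφ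
  have hφT : ∀ r, φ r ∈ T := fun r => hT' (Finset.orderEmbOfFin_mem _ _ _)
  have hφi : Function.Injective φ := (T'.orderEmbOfFin hcard).injective
  refine ((sq_spanProb_le_matrixLaw μ hφi hij (fun r h => hi (h ▸ hφT r))
    (fun r h => hj (h ▸ hφT r))).trans (measure_mono ?_)).trans
    (matrixLaw_iUnion_confusable_le μ ha hij hi hj g)
  rintro X ⟨⟨y, hy⟩, ⟨z, hz⟩⟩
  -- The difference of the two linear combinations, scaled by a and placed on the chosen columns,
  -- compensates moving the spike.
  set h : Fin p → ℝ := fun l => ∑ r, if φ r = l then a * (y r - z r) else 0 with hh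
  obtain ⟨M, hM⟩ := exists_nat_ge (∑ l, |h l|)
  refine Set.mem_iUnion.2 ⟨M, h, fun l hl => ?_, fun l => ?_, fun r => ?_⟩
  · exact Finset.sum_eq_zero fun r _ => if_neg fun he : φ r = l => hl (he ▸ hφT r)
  · exact (Finset.single_le_sum (f := fun l => |h l|) (fun l _ => abs_nonneg _)
      (Finset.mem_univ l)).trans hM
  · simp only [hh, Finset.mul_sum]
    rw [Finset.sum_comm]
    simp only [mul_ite, mul_zero, Finset.sum_ite_eq, Finset.mem_univ, if_true]
    have hy' : ∑ s, y s * X r (φ s) = X r i := hy r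
    have hz' : ∑ s, z s * X r (φ s) = X r j := hz r
    rw [← hy', ← hz', ← Finset.sum_sub_distrib, Finset.mul_sum]
    refine Finset.sum_congr rfl fun s _ => ?_
    ring

end Shift

/-! ### The bound n ≥ k. -/

section Dimension

variable {n p : ℕ} (μ : Measure ℝ) [IsProbabilityMeasure μ]

/-- At most one index can have error below 2ε; the remaining ones are at least half of s, which
explains the factor 4. -/
theorem card_mul_le_sum_of_pairwise {ι : Type*} [DecidableEq ι] {s : Finset ι} (hs : 2 ≤ s.card)
    {e : ι → ℝ≥0∞} {ε : ℝ≥0∞} (h : ∀ i ∈ s, ∀ j ∈ s, i ≠ j → 4 * ε ≤ e i + e j) :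
    (s.card : ℝ≥0∞) * ε ≤ ∑ j ∈ s, e j := by
  have hsum : ∀ u ⊆ s, (∀ j ∈ u, 2 * ε ≤ e j) → s.card ≤ 2 * u.card →
      (s.card : ℝ≥0∞) * ε ≤ ∑ j ∈ s, e j := by
    intro u hu hue hcard
    calc (s.card : ℝ≥0∞) * ε ≤ ((2 * u.card : ℕ) : ℝ≥0∞) * ε := by gcongr
      _ = ∑ j ∈ u, 2 * ε := by rw [Finset.sum_const, nsmul_eq_mul]; push_cast; ring
      _ ≤ ∑ j ∈ u, e j := Finset.sum_le_sum hue
      _ ≤ _ := Finset.sum_le_sum_of_subset hu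
  by_cases hall : ∀ j ∈ s, 2 * ε ≤ e j
  · exact hsum s subset_rfl hall (by omega)
  · push Not at hall
    obtain ⟨i, hi, hlt⟩ := hall
    refine hsum (s.erase i) (Finset.erase_subset _ _) (fun j hj => ?_) ?_
    · by_contra hcon
      push Not at hcon
      have h1 := h i hi j (Finset.mem_of_mem_erase hj) (Finset.ne_of_mem_erase hj).symm
      have h2 := ENNReal.add_lt_add hlt hcon
      rw [← add_mul] at h2
      norm_num at h2
      exact absurd h1 (not_le.2 h2)
    · rw [Finset.card_erase_of_mem hi]; omega

/-- If there are fewer observations than nonzero entries, then the error over the class is bounded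
below by a universal constant. -/
theorem exists_le_classError_of_lt_sparsity :
    ∃ ε : ℝ≥0∞, 0 < ε ∧ ∀ (μ : Measure ℝ) [IsProbabilityMeasure μ] (n p k : ℕ) (βmin : ℝ)
      (g : Decoder n p), 200 ≤ n → k < p → 0 < βmin → n < k → ε ≤ classError μ k βmin g := by
  refine ⟨ENNReal.ofReal (Real.exp (-800)) ^ 2 / 4, ?_, ?_⟩
  · refine ENNReal.div_pos (pow_ne_zero _ (ENNReal.ofReal_pos.2 (Real.exp_pos _)).ne') (by simp)
  intro μ _ n p k βmin g hn hkp hβ hnk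
  obtain ⟨k, rfl⟩ : ∃ k', k = k' + 1 := ⟨k - 1, by omega⟩
  refine le_trans (le_average_of_le_sum_insert (by omega) (worstError μ βmin g) fun T hT => ?_)
    (sum_worstError_le_classError μ hβ g)
  have hc : Tᶜ.card = p - k := by rw [Finset.card_compl, Fintype.card_fin, hT]
  rw [← hc]
  refine card_mul_le_sum_of_pairwise (by omega) fun i hi j hj hij => ?_
  rw [ENNReal.mul_div_cancel (by norm_num) (by norm_num)]
  exact (pow_le_pow_left' (le_spanProb μ hn) 2).trans
    (sq_spanProb_le_worstError_add μ hβ hij (Finset.mem_compl.1 hi) (Finset.mem_compl.1 hj)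
      (by omega) g)

end Dimension

end SupportRecovery

end

theorem theorem1 (b : ℝ) (hb : 2 ≤ b) (p k : ℕ → ℕ) (βmin : ℕ → ℝ) (μ : ℕ → Measure ℝ)
    (hk : ∀ n, 1 ≤ k n) (hkp : ∀ n, k n < p n) (hβ : ∀ n, 0 < βmin n)
    (hprob : ∀ n, IsProbabilityMeasure (μ n))
    (hL2 : ∀ n, MemLp (fun x : ℝ => x) 2 (μ n))
    (hmean : ∀ n, ∫ x, x ∂(μ n) = 0)
    (hvar : ∀ n, variance (fun x : ℝ => x) (μ n) = 1)
    (hrec : SupportRecovery.AsymptoticallyReliable μ p k βmin) :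
    ∀ᶠ n : ℕ in atTop,
      max (max (SupportRecovery.f₁ b (p n) (k n) (βmin n))
          (SupportRecovery.f₂ b (p n) (k n) (βmin n)))
        ((k n : ℝ) - 1) < (n : ℝ) := by
  obtain ⟨ε₁, hε₁, h₁⟩ := SupportRecovery.exists_le_classError_of_le_threshold
  obtain ⟨ε₂, hε₂, h₂⟩ := SupportRecovery.exists_le_classError_of_lt_sparsity
  obtain ⟨g, hg⟩ := hrec
  -- The error eventually lies below both universal constants, which rules out each unfavourable
  -- regime.
  filter_upwards [hg.eventually_lt_const hε₁, hg.eventually_lt_const hε₂,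
    eventually_ge_atTop 200] with n hn₁ hn₂ hn
  have := hprob n
  rw [max_lt_iff, max_lt_iff]
  by_cases hnk : n < k n
  · exact absurd (h₂ (μ n) n (p n) (k n) (βmin n) (g n) hn (hkp n) (hβ n) hnk) (not_le.2 hn₂)
  have hthreshold := fun h => not_le.2 hn₁ (h₁ (μ n) (hL2 n) (hmean n) (hvar n) b n (p n) (k n)
    (βmin n) (g n) hb (hk n) (hkp n) (hβ n) h)
  refine ⟨⟨?_, ?_⟩, ?_⟩
  · exact not_le.1 fun h => hthreshold (Or.inl h)
  · exact not_le.1 fun h => hthreshold (Or.inr h)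
  · have : (k n : ℝ) ≤ n := by exact_mod_cast not_lt.1 hnk
    linarith
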